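/- Let $h:[0,\infty)\to[0,\infty)$ be measurable with $\alpha:=\int_0^\infty h(t)\,dt<1$. Let $\tau_1,\tau_2,\dots$ be i.i.d. nonnegative random variables with finite mean whose distribution function $F$ has a density $f:[0,\infty)\to[0,\infty)$ (measurable), $F(t)=\int_0^t f(s)\,ds$; in particular $\tau_i>0$ a.s. Put $S_0=0$, $S_i=\tau_1+\dots+\tau_i$, and let $$\mu(t)=\frac{f(t)}{1-\int_0^t f(s)\,ds}$$ be the hazard function of the renewal law (with $\mu(t)=0$ where the denominator vanishes). *Construction.* The renewal process $N_R=\sum_{i\ge0}\delta_{S_i}$ is the process of immigrants. Every individual $v$ (an immigrant or an offspring) carries its own Poisson process $\xi_v$ on $[0,\infty)$ with intensity measure $h(x)\,dx$; the processes $\xi_v$ are mutually independent and independent of $(\tau_i)$. An individual born at time $t$ produces offspring according to $\xi_v$ translated by $t$, i.e. a Poisson process with intensity $h(x-t)\,dx$ on $[t,\infty)$. Let $N_c^{(0)}(\cdot\mid S_i)=\delta_{S_i}$, let $N_c^{(n+1)}(\cdot\mid S_i)$ be the superposition of the offspring processes of all the individuals of $N_c^{(n)}(\cdot\mid S_i)$,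 and put $$N_c^{(n)}=\sum_{i\ge0}N_c^{(n)}(\cdot\mid S_i),\qquad N=\sum_{i\ge0}\sum_{n\ge0}N_c^{(n)}(\cdot\mid S_i).$$ Let $T_0\le T_1\le\cdots$ be the points of $N$ in increasing order, let $D_i=0$ if $T_i$ is a point of $N_R$ and $D_i=1$ otherwise, and put $I(t)=\max\{i: T_i\le t,\ D_i=0\}$ and $I(t-)=\max\{i:T_i<t,\ D_i=0\}$, so that $T_{I(t-)}$ is the last immigrant strictly before $t$. Let $(\mathcal F_t)_{t\ge0}$ be the augmentation by the $\mathbb P$-null sets of the filtration $\mathcal F^0_t=\sigma\big(N_c^{(n)}((a,b]):0\le a\le b\le t,\ n\ge0\big)$. *Claim.* $N$ is a.s. locally finite and simple ($T_i<T_{i+1}$ for all $i$ with $T_i<\infty$, and $N=\sum_{i:\,T_i<\infty}\delta_{T_i}$), almost surely for every $t>0$ there is an immigrant before $t$, the processes $N([0,t])$ and $I(t)$ are $(\mathcal F_t)$-adapted, and $N$ admits the predictable $(\mathcal F_t)$-intensity $$\lambda(t)=\mu\big(t-T_{I(t-)}\big)+\int_{[0,t)}h(t-x)\,N(dx),\qquad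 t\ge0.$$ That is, $\lambda$ is nonnegative and $(\mathcal F_t)$-predictable (hence progressive), a.s. $\int_0^t\lambda(s)\,ds<\infty$ for every $t$, and $N([0,t])-\int_0^t\lambda(s)\,ds$ is an $(\mathcal F_t)$-martingale. Hence $N$ is a renewal Hawkes process with hazard function $\mu$ and offspring density $h$. Moreover, for every $(\mathcal F_t)$-predictable process $C$ with values in $[0,\infty]$, $$\mathbb E\Big[\int_{(0,\infty)}C(u)\,N(du)\Big]=\mathbb E\Big[\int_0^\infty C(u)\Big\{\mu\big(u-T_{I(u-)}\big)+\int_{[0,u)}h(u-x)\,N(dx)\Big\}\,du\Big].$$ -/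

import Mathlib

open MeasureTheory ProbabilityTheory Set
open scoped NNReal ENNReal

noncomputable section

namespace RenewalHawkes

/-- Lebesgue measure on the half-line `[0, ∞)`. -/
def leb : Measure ℝ≥0 := Measure.comap ((↑) : ℝ≥0 → ℝ) volume

/-- Locally finite counting measures on `[0, ∞)`: every bounded Borel set has
finite integer mass. -/
def IsCountingMeasure (ν : Measure ℝ≥0) : Prop :=
  ∀ B : Set ℝ≥0, MeasurableSet B → Bornology.IsBounded B → ∃ k : ℕ, ν B = k

/-- The points of a locally finite counting measure on `[0, ∞)`, in increasing order and repeated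
according to multiplicity. `nthPoint ν j` is the point number `j` (counted from `0`); it is `∞` if
`ν` has at most `j` points. -/
def nthPoint (ν : Measure ℝ≥0) (j : ℕ) : ℝ≥0∞ :=
  ⨅ (x : ℝ≥0) (_ : (j : ℝ≥0∞) < ν (Iic x)), (x : ℝ≥0∞)

/-- `ξ` is a Poisson point process on `[0, ∞)` with intensity measure `Λ`. -/
structure IsPoissonProcess {Ω : Type*} [MeasurableSpace Ω] (P : Measure Ω)
    (ξ : Ω → Measure ℝ≥0) (Λ : Measure ℝ≥0) : Prop where
  measurable : Measurable ξ
  counting : ∀ ω, IsCountingMeasure (ξ ω)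
  law : ∀ B : Set ℝ≥0, MeasurableSet B → Λ B ≠ ⊤ →
    P.map (fun ω => ξ ω B) = (poissonMeasure (Λ B).toNNReal).map (fun k : ℕ => (k : ℝ≥0∞))
  indep : ∀ (k : ℕ) (B : Fin k → Set ℝ≥0), (∀ i, MeasurableSet (B i)) →
    Pairwise (fun i j => Disjoint (B i) (B j)) → iIndepFun (fun i ω => ξ ω (B i)) P

section Intensity

variable {Ω : Type*} [m : MeasurableSpace Ω]

/-- `N` is a simple point process on `[0, ∞)`: it is the counting measure of the random points
`T 0 < T 1 < ⋯`, where `T i = ∞` means that there is no `i`-th point; it is locally finite. -/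
structure IsSimplePointProcess (P : Measure Ω) (N : Ω → Measure ℝ≥0)
    (T : ℕ → Ω → ℝ≥0∞) : Prop where
  measurable_points : ∀ i, Measurable (T i)
  strict : ∀ᵐ ω ∂P, ∀ i, T i ω ≠ ⊤ → T i ω < T (i + 1) ω
  absorbing : ∀ᵐ ω ∂P, ∀ i, T i ω = ⊤ → T (i + 1) ω = ⊤
  measurable : Measurable N
  locallyFinite : ∀ᵐ ω ∂P, IsCountingMeasure (N ω)
  eq_sum : ∀ᵐ ω ∂P, N ω = Measure.sum
    (fun i : {i : ℕ // T i ω ≠ ⊤} => Measure.dirac (T i ω).toNNReal)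

/-- `lam` is an intensity of `N` with respect to `𝓕`: `N` is adapted, and `lam` is a nonnegative
progressive process, a.s. locally integrable, such that `N([0,t]) - ∫₀ᵗ lam(s) ds` is a
martingale. -/
structure IsIntensity (P : Measure Ω) (𝓕 : Filtration ℝ≥0 m) (N : Ω → Measure ℝ≥0)
    (lam : ℝ≥0 → Ω → ℝ≥0∞) : Prop where
  adapted : Adapted 𝓕 (fun t ω => N ω (Iic t))
  progressive : IsStronglyProgressive 𝓕 lam
  locallyIntegrable : ∀ᵐ ω ∂P, ∀ t : ℝ≥0, ∫⁻ s in Iic t, lam s ω ∂leb < ⊤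
  martingale : Martingale
    (fun t ω => (N ω (Iic t)).toReal - (∫⁻ s in Iic t, lam s ω ∂leb).toReal) 𝓕 P

/-- The hazard function `f(t) / (1 - ∫₀ᵗ f(s) ds)` of a density `f` on `[0, ∞)`
(with value `0` where the denominator vanishes). -/
def hazard (f : ℝ≥0 → ℝ≥0) (t : ℝ≥0) : ℝ≥0 :=
  f t / (1 - ∫⁻ s in Iic t, (f s : ℝ≥0∞) ∂leb).toNNReal

/-- `I(t) = max {i : T i ≤ t, D i = 0}`, the index of the last immigrant up to time `t`, where the
mark `D i = 0` means that the `i`-th point is an immigrant. -/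
def lastImmigrant (T : ℕ → Ω → ℝ≥0∞) (D : ℕ → Ω → Fin 2) (t : ℝ≥0) (ω : Ω) : ℕ :=
  sSup {i | T i ω ≤ t ∧ D i ω = 0}

/-- `I(t-) = max {i : T i < t, D i = 0}`, the index of the last immigrant strictly before `t`. -/
def lastImmigrantBefore (T : ℕ → Ω → ℝ≥0∞) (D : ℕ → Ω → Fin 2) (t : ℝ≥0) (ω : Ω) : ℕ :=
  sSup {i | T i ω < t ∧ D i ω = 0}

/-- `λ(t) = μ(t - T_{I(t-)}) + ∫_{[0,t)} h(t - x) N(dx)`. -/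
def hawkesIntensity (μ h : ℝ≥0 → ℝ≥0) (N : Ω → Measure ℝ≥0) (T : ℕ → Ω → ℝ≥0∞)
    (D : ℕ → Ω → Fin 2) (t : ℝ≥0) (ω : Ω) : ℝ≥0∞ :=
  μ ((t : ℝ≥0∞) - T (lastImmigrantBefore T D t ω) ω).toNNReal
    + ∫⁻ x in Iio t, (h (t - x) : ℝ≥0∞) ∂(N ω)

/-- The point process `N` with points `T i` and immigrant/offspring marks `D i` (`0` for
immigrants, `1` for offspring) is a renewal Hawkes process with respect to the filtration `𝓕`,
with renewal density `f` and offspring density `h`. -/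
structure IsRenewalHawkesProcess (P : Measure Ω) (𝓕 : Filtration ℝ≥0 m) (N : Ω → Measure ℝ≥0)
    (T : ℕ → Ω → ℝ≥0∞) (D : ℕ → Ω → Fin 2) (f h : ℝ≥0 → ℝ≥0) : Prop where
  measurable_f : Measurable f
  density : ∫⁻ t, (f t : ℝ≥0∞) ∂leb = 1
  measurable_h : Measurable h
  subcritical : ∫⁻ t, (h t : ℝ≥0∞) ∂leb < 1
  simple : IsSimplePointProcess P N T
  measurable_marks : ∀ i, Measurable (D i)
  immigrant_exists : ∀ᵐ ω ∂P, ∀ t : ℝ≥0, 0 < t → ∃ i, T i ω < t ∧ D i ω = 0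
  adapted_lastImmigrant : Adapted 𝓕 (lastImmigrant T D)
  predictable : IsStronglyPredictable 𝓕 (hawkesIntensity (hazard f) h N T D)
  intensity : IsIntensity P 𝓕 N (hawkesIntensity (hazard f) h N T D)

end Intensity

section Construction

variable {Ω : Type*}

/-- The renewal epochs `S 0 = 0`, `S i = τ₁ + ⋯ + τᵢ` (the waiting times `τ` are indexed
from `0`). -/
def epoch (τ : ℕ → Ω → ℝ≥0) (i : ℕ) (ω : Ω) : ℝ≥0 := ∑ k ∈ Finset.range i, τ k ω

/-- Individuals are labelled by pairs `(i, u)`: `i` is the number of the immigrant from which the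
individual descends, and the list `u` is its line of descent, the most recent birth first
(`(i, j :: u)` is the `j`-th child of `(i, u)`). The process `ξ (i, u)` carries the birth times of
the children of `(i, u)` relative to the birth of `(i, u)`.
`birth τ ξ i u` is the birth time of `(i, u)`, and `∞` if there is no such individual. -/
def birth (τ : ℕ → Ω → ℝ≥0) (ξ : ℕ × List ℕ → Ω → Measure ℝ≥0) (i : ℕ) :
    List ℕ → Ω → ℝ≥0∞
  | [], ω => epoch τ i ω
  | j :: u, ω => birth τ ξ i u ω + nthPoint (ξ (i, u) ω) j

/-- The satellite process `N_s(· ∣ t)` obtained by translating `ν` to a centre at `t`. -/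
def satellite (ν : Measure ℝ≥0) (t : ℝ≥0) : Measure ℝ≥0 := ν.map (fun x => x + t)

open Classical in
/-- The process of `n`-th generation descendants of the `i`-th immigrant: generation `0` is the
immigrant, and generation `n + 1` is the superposition of the satellite processes
of all the individuals of generation `n`. -/
def descendants (τ : ℕ → Ω → ℝ≥0) (ξ : ℕ × List ℕ → Ω → Measure ℝ≥0) (i : ℕ) :
    ℕ → Ω → Measure ℝ≥0
  | 0, ω => Measure.dirac (epoch τ i ω)
  | n + 1, ω => Measure.sum (fun u : List ℕ =>
      if u.length = n ∧ birth τ ξ i u ω ≠ ⊤ then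
        satellite (ξ (i, u) ω) (birth τ ξ i u ω).toNNReal
      else 0)

/-- The complete cluster of the `i`-th immigrant (including the immigrant). -/
def cluster (τ : ℕ → Ω → ℝ≥0) (ξ : ℕ × List ℕ → Ω → Measure ℝ≥0) (i : ℕ) (ω : Ω) :
    Measure ℝ≥0 :=
  Measure.sum (fun n => descendants τ ξ i n ω)

/-- The cluster process `N`: the superposition of the clusters of all immigrants. -/
def clusterProcess (τ : ℕ → Ω → ℝ≥0) (ξ : ℕ × List ℕ → Ω → Measure ℝ≥0) (ω : Ω) :
    Measure ℝ≥0 :=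
  Measure.sum (fun i => cluster τ ξ i ω)

/-- The process of all points of generation `n`; for `n = 0` this is the renewal process. -/
def generation (τ : ℕ → Ω → ℝ≥0) (ξ : ℕ × List ℕ → Ω → Measure ℝ≥0) (n : ℕ) (ω : Ω) :
    Measure ℝ≥0 :=
  Measure.sum (fun i => descendants τ ξ i n ω)

/-- The points `T i` of the cluster process in increasing order. -/
def point (τ : ℕ → Ω → ℝ≥0) (ξ : ℕ × List ℕ → Ω → Measure ℝ≥0) (i : ℕ) (ω : Ω) : ℝ≥0∞ :=
  nthPoint (clusterProcess τ ξ ω) i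

open Classical in
/-- The mark of the `i`-th point: `0` if it is a point of the renewal process (an immigrant), and
`1` otherwise. -/
def mark (τ : ℕ → Ω → ℝ≥0) (ξ : ℕ × List ℕ → Ω → Measure ℝ≥0) (i : ℕ) (ω : Ω) : Fin 2 :=
  if ∃ k, point τ ξ i ω = epoch τ k ω then 0 else 1

/-- The σ-field generated by the counts of points of every generation in the intervals
`(a, b]`, `0 ≤ a ≤ b ≤ t`. -/
@[reducible] def naturalSigma (τ : ℕ → Ω → ℝ≥0) (ξ : ℕ × List ℕ → Ω → Measure ℝ≥0) (t : ℝ≥0) :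
    MeasurableSpace Ω :=
  ⨆ (n : ℕ) (a : ℝ≥0) (b : ℝ≥0) (_ : a ≤ b ∧ b ≤ t),
    MeasurableSpace.comap (fun ω => generation τ ξ n ω (Ioc a b)) inferInstance

/-- The augmentation of the natural filtration by the `P`-null sets: an event belongs to it at time
`t` if it coincides with an event of `naturalSigma τ ξ t` up to a `P`-null set. -/
def augmentedFiltration [m : MeasurableSpace Ω] (P : Measure Ω) (τ : ℕ → Ω → ℝ≥0)
    (ξ : ℕ × List ℕ → Ω → Measure ℝ≥0) : Filtration ℝ≥0 m where
  seq t := m ⊓ eventuallyMeasurableSpace (naturalSigma τ ξ t) (ae P)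
  mono' := by
    intro s t hst
    refine inf_le_inf_left m ?_
    rintro A ⟨B, hB, hAB⟩
    refine ⟨B, ?_, hAB⟩
    have hle : naturalSigma τ ξ s ≤ naturalSigma τ ξ t := by
      refine iSup_mono fun n => iSup_mono fun a => iSup_mono fun b => ?_
      exact iSup_le fun h => le_iSup_of_le ⟨h.1, h.2.trans hst⟩ le_rfl
    exact hle B hB
  le' _ := inf_le_left

end Construction

end RenewalHawkes

end

open RenewalHawkes

/-!
An individual born at time `x` has its children at the points of a Poisson process with intensity
`h (t - x) dt`. Conditionally on the history up to time `s`, its children in `(s, r]` have mean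
`∫ h (t - x) dt` over `(s, r]` if `x ≤ s`, by independence of the increments, and the same holds
with `max s x` in place of `s` if `x` lies in `(s, r]`, by independence of the children from the
birth time of their parent. For the immigrants, `μ(x) ℙ(τ ≥ x) = f(x)` turns the conditional
probability that the next epoch falls in `(s, r]` into the conditional mean of the integrated
hazard. Summing over all individuals gives `𝔼[N((s, r]); A] = 𝔼[∫ λ dt; A]`, the integral being
over `(s, r]`, for every event `A` of the history up to time `s`. The sets `A × (s, r]` generate the
predictable σ-algebra, so the identity extends to predictable integrands.

All these expectations are finite: immigrants up to time `t` have finite mean number by a Markov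
bound on the Laplace transform of `S_i`, and a generation is on average at most `∫ h < 1` times as
large as the previous one.
-/

noncomputable section

namespace RenewalHawkes

/-- The unit mass at `x`, which is zero if `x = ∞`; `∞` is the conventional value of the birth
time of an individual that does not exist. -/
def diracTop (x : ℝ≥0∞) : Measure ℝ≥0 := if x = ⊤ then 0 else Measure.dirac x.toNNReal

lemma diracTop_top : diracTop ⊤ = 0 := if_pos rfl

lemma diracTop_coe (x : ℝ≥0) : diracTop x = Measure.dirac x := by simp [diracTop]

lemma diracTop_apply (x : ℝ≥0∞) {B : Set ℝ≥0} (hB : MeasurableSet B) :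
    diracTop x B = ((↑) '' B : Set ℝ≥0∞).indicator 1 x := by
  induction x with
  | top => simp [diracTop_top]
  | coe x =>
    rw [diracTop_coe, Measure.dirac_apply' _ hB]
    by_cases hx : x ∈ B <;> simp [hx]

lemma diracTop_Iic (x : ℝ≥0∞) (a : ℝ≥0) : diracTop x (Iic a) = if x ≤ a then 1 else 0 := by
  induction x with
  | top => simp [diracTop_top]
  | coe x =>
    rw [diracTop_coe, Measure.dirac_apply' _ measurableSet_Iic]
    by_cases hx : x ≤ a <;> simp [hx]

lemma diracTop_Ioc (x : ℝ≥0∞) (a b : ℝ≥0) :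
    diracTop x (Ioc a b) = if (a : ℝ≥0∞) < x ∧ x ≤ b then 1 else 0 := by
  induction x with
  | top => simp [diracTop_top]
  | coe x =>
    rw [diracTop_coe, Measure.dirac_apply' _ measurableSet_Ioc]
    by_cases hx : a < x ∧ x ≤ b <;> simp [hx]

lemma lintegral_diracTop (x : ℝ≥0∞) {g : ℝ≥0 → ℝ≥0∞} (hg : Measurable g) :
    ∫⁻ y, g y ∂diracTop x = if x = ⊤ then 0 else g x.toNNReal := by
  unfold diracTop
  split_ifs
  · simp
  · rw [lintegral_dirac' _ hg]

lemma measurable_diracTop : Measurable diracTop := by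
  refine Measure.measurable_of_measurable_coe _ fun B hB => ?_
  simp_rw [diracTop_apply _ hB]
  exact measurable_one.indicator
    (ENNReal.isOpenEmbedding_coe.measurableEmbedding.measurableSet_image.2 hB)

lemma measurable_diracTop_apply {B : Set ℝ≥0} (hB : MeasurableSet B) :
    Measurable fun x => diracTop x B :=
  (Measure.measurable_coe hB).comp measurable_diracTop

lemma map_add_diracTop (x : ℝ≥0∞) (b : ℝ≥0) :
    (diracTop x).map (fun y => y + b) = diracTop (b + x) := by
  induction x with
  | top => simp [diracTop_top]
  | coe x =>
    rw [diracTop_coe, Measure.map_dirac' (by fun_prop), ← ENNReal.coe_add, diracTop_coe, add_comm]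

lemma nthPoint_le_of_lt {ν : Measure ℝ≥0} {j : ℕ} {x : ℝ≥0} (h : (j : ℝ≥0∞) < ν (Iic x)) :
    nthPoint ν j ≤ x := iInf₂_le x h

lemma nthPoint_mono (ν : Measure ℝ≥0) : Monotone (nthPoint ν) := fun _ _ hij =>
  le_iInf₂ fun _ hx => nthPoint_le_of_lt (hx.trans_le' (Nat.cast_le.2 hij))

lemma IsCountingMeasure.measure_Iic {ν : Measure ℝ≥0} (hν : IsCountingMeasure ν) (x : ℝ≥0) :
    ∃ k : ℕ, ν (Iic x) = k :=
  hν _ measurableSet_Iic (by rw [← Set.Icc_bot]; exact Metric.isBounded_Icc _ _)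

lemma IsCountingMeasure.exists_gt_measure_Iic_eq {ν : Measure ℝ≥0} (hν : IsCountingMeasure ν)
    (x : ℝ≥0) : ∃ y > x, ν (Iic y) = ν (Iic x) := by
  obtain ⟨k, hk⟩ := hν.measure_Iic x
  have hlim : Filter.Tendsto (fun y => ν (Iic y)) (nhdsWithin x (Ioi x)) (nhds k) := by
    have hinter : ⋂ y > x, Iic y = Iic x := by
      ext z
      simp only [mem_iInter, mem_Iic]
      exact ⟨le_of_forall_gt_imp_ge_of_dense, fun hz y hy => hz.trans (le_of_lt hy)⟩
    rw [← hk, ← hinter]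
    refine tendsto_measure_biInter_gt (fun _ _ => measurableSet_Iic.nullMeasurableSet)
      (fun _ _ _ => Iic_subset_Iic.2) ⟨x + 1, by simp, ?_⟩
    obtain ⟨m, hm⟩ := hν.measure_Iic (x + 1)
    simp [hm]
  have hk_lt : (k : ℝ≥0∞) < (k + 1 : ℕ) := by exact_mod_cast Nat.lt_succ_self k
  obtain ⟨y, hy, hxy⟩ := ((hlim.eventually_lt_const hk_lt).and self_mem_nhdsWithin).exists
  obtain ⟨m, hm⟩ := hν.measure_Iic y
  refine ⟨y, hxy, le_antisymm ?_ (measure_mono (Iic_subset_Iic.2 (le_of_lt hxy)))⟩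
  rw [hm] at hy ⊢
  rw [hk]
  exact_mod_cast Nat.lt_succ_iff.1 (by exact_mod_cast hy)

lemma nthPoint_le_iff {ν : Measure ℝ≥0} (hν : IsCountingMeasure ν) (j : ℕ) (x : ℝ≥0) :
    nthPoint ν j ≤ x ↔ (j : ℝ≥0∞) < ν (Iic x) := by
  refine ⟨fun h => ?_, nthPoint_le_of_lt⟩
  by_contra! hle
  obtain ⟨y, hxy, hy⟩ := hν.exists_gt_measure_Iic_eq x
  have hy_le : (y : ℝ≥0∞) ≤ nthPoint ν j := by
    refine le_iInf₂ fun z hz => ?_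
    by_contra! hzy
    have : ν (Iic z) ≤ ν (Iic y) :=
      measure_mono (Iic_subset_Iic.2 (by exact_mod_cast hzy.le))
    exact absurd (hz.trans_le (this.trans (hy.trans_le hle))) (lt_irrefl _)
  exact absurd (ENNReal.coe_le_coe.1 (hy_le.trans h)) (not_le.2 hxy)

lemma measurable_nthPoint (j : ℕ) : Measurable fun ν : Measure ℝ≥0 => nthPoint ν j := by
  refine measurable_of_Iio fun c => ?_
  have hpre : (fun ν : Measure ℝ≥0 => nthPoint ν j) ⁻¹' Iio c =
      ⋃ (q : ℚ) (_ : ((Real.toNNReal q : ℝ≥0) : ℝ≥0∞) < c),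
        {ν : Measure ℝ≥0 | (j : ℝ≥0∞) < ν (Iic (Real.toNNReal q))} := by
    ext ν
    simp only [mem_preimage, mem_Iio, mem_iUnion, mem_ofPred_eq, exists_prop]
    refine ⟨fun h => ?_, fun ⟨q, hq, hν⟩ => (nthPoint_le_of_lt hν).trans_lt hq⟩
    simp only [nthPoint, iInf_lt_iff] at h
    obtain ⟨x, hjx, hxc⟩ := h
    obtain ⟨q, -, hxq, hqc⟩ := ENNReal.lt_iff_exists_rat_btwn.1 hxc
    exact ⟨q, hqc, hjx.trans_le
      (measure_mono (Iic_subset_Iic.2 (ENNReal.coe_le_coe.1 hxq.le)))⟩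
  rw [hpre]
  exact MeasurableSet.iUnion fun q => MeasurableSet.iUnion fun _ =>
    measurableSet_lt measurable_const (Measure.measurable_coe measurableSet_Iic)

lemma tsum_ite_lt (k : ℕ) : ∑' j : ℕ, (if j < k then (1 : ℝ≥0∞) else 0) = k := by
  rw [tsum_eq_sum (s := Finset.range k) fun j hj => by simpa using hj,
    Finset.sum_boole, Finset.filter_true_of_mem fun j => Finset.mem_range.1, Finset.card_range]

lemma measure_ext_of_Iic {μ ν : Measure ℝ≥0} (hfin : ∀ x, μ (Iic x) ≠ ⊤)
    (h : ∀ x, μ (Iic x) = ν (Iic x)) : μ = ν := by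
  refine Measure.ext_of_generateFrom_of_iUnion (range Iic) (fun n : ℕ => Iic (n : ℝ≥0))
    ?_ isPiSystem_Iic (iUnion_eq_univ_iff.2 exists_nat_ge) (fun n => ⟨_, rfl⟩)
    (fun n => hfin _) (forall_mem_range.2 h)
  rw [BorelSpace.measurable_eq (α := ℝ≥0), borel_eq_generateFrom_Iic]

lemma eq_sum_diracTop_nthPoint {ν : Measure ℝ≥0} (hν : IsCountingMeasure ν) :
    ν = Measure.sum fun j => diracTop (nthPoint ν j) := by
  refine measure_ext_of_Iic (fun x => ?_) fun x => ?_ <;>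
    obtain ⟨k, hk⟩ := hν.measure_Iic x
  · simp [hk]
  · rw [Measure.sum_apply _ measurableSet_Iic]
    simp_rw [diracTop_Iic, nthPoint_le_iff hν, hk, Nat.cast_lt]
    exact (tsum_ite_lt k).symm

section Births

variable {Ω : Type*} {τ : ℕ → Ω → ℝ≥0} {ξ : ℕ × List ℕ → Ω → Measure ℝ≥0}

lemma satellite_eq_sum {ν : Measure ℝ≥0} (hν : IsCountingMeasure ν) (b : ℝ≥0) :
    satellite ν b = Measure.sum fun j => diracTop (b + nthPoint ν j) := by
  unfold satellite
  conv_lhs => rw [eq_sum_diracTop_nthPoint hν]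
  rw [Measure.map_sum (by fun_prop)]
  simp_rw [map_add_diracTop]

lemma tsum_list_cons {α : Type*} {g : List α → ℝ≥0∞} (hg : g [] = 0) :
    ∑' w, g w = ∑' (u : List α) (j : α), g (j :: u) := by
  have hinj : Function.Injective fun q : List α × α => q.2 :: q.1 := by
    rintro ⟨u, j⟩ ⟨u', j'⟩ h
    simp_all
  rw [← ENNReal.tsum_prod (f := fun u j => g (j :: u))]
  refine (hinj.tsum_eq fun w hw => ?_).symm
  cases w with
  | nil => exact absurd hg hw
  | cons j u => exact ⟨(u, j), rfl⟩

lemma descendants_eq_sum (hξ : ∀ l ω, IsCountingMeasure (ξ l ω)) (i n : ℕ) (ω : Ω) :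
    descendants τ ξ i n ω = Measure.sum fun u : List ℕ =>
      if u.length = n then diracTop (birth τ ξ i u ω) else 0 := by
  ext B hB
  rw [Measure.sum_apply _ hB]
  cases n with
  | zero =>
    rw [tsum_eq_single [] fun u hu => by simp [hu]]
    simp [descendants, birth, diracTop_coe]
  | succ n =>
    rw [descendants, Measure.sum_apply _ hB,
      tsum_list_cons (g := fun w => (if w.length = n + 1 then diracTop (birth τ ξ i w ω) else 0) B)
        (by simp)]
    refine tsum_congr fun u => ?_
    by_cases hu : u.length = n
    · by_cases hb : birth τ ξ i u ω = ⊤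
      · simp [hb, birth, diracTop_top]
      · rw [if_pos ⟨hu, hb⟩, satellite_eq_sum (hξ _ _), Measure.sum_apply _ hB]
        simp [hu, birth, ENNReal.coe_toNNReal hb]
    · simp [hu]

lemma generation_eq_sum (hξ : ∀ l ω, IsCountingMeasure (ξ l ω)) (n : ℕ) (ω : Ω) :
    generation τ ξ n ω = Measure.sum fun v : ℕ × List ℕ =>
      if v.2.length = n then diracTop (birth τ ξ v.1 v.2 ω) else 0 := by
  ext B hB
  rw [generation, Measure.sum_apply _ hB, Measure.sum_apply _ hB, ENNReal.tsum_prod']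
  refine tsum_congr fun i => ?_
  rw [descendants_eq_sum hξ, Measure.sum_apply _ hB]

lemma clusterProcess_eq_sum_generation (ω : Ω) :
    clusterProcess τ ξ ω = Measure.sum fun n => generation τ ξ n ω := by
  ext B hB
  rw [clusterProcess, Measure.sum_apply _ hB, Measure.sum_apply _ hB]
  simp_rw [cluster, generation, Measure.sum_apply _ hB]
  exact ENNReal.tsum_comm

lemma clusterProcess_eq_sum (hξ : ∀ l ω, IsCountingMeasure (ξ l ω)) (ω : Ω) :
    clusterProcess τ ξ ω = Measure.sum fun v : ℕ × List ℕ =>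
      diracTop (birth τ ξ v.1 v.2 ω) := by
  ext B hB
  rw [clusterProcess_eq_sum_generation, Measure.sum_apply _ hB, Measure.sum_apply _ hB]
  simp_rw [generation_eq_sum hξ, Measure.sum_apply _ hB]
  rw [ENNReal.tsum_comm]
  refine tsum_congr fun v => ?_
  rw [tsum_eq_single v.2.length fun n hn => by simp [hn.symm], if_pos rfl]

end Births

lemma leb_apply (B : Set ℝ≥0) : leb B = volume ((↑) '' B : Set ℝ) :=
  (MeasurableEmbedding.subtype_coe measurableSet_Ici).comap_apply _ _

lemma leb_Ico (a b : ℝ≥0) : leb (Ico a b) = ((b - a : ℝ≥0) : ℝ≥0∞) := by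
  rw [leb_apply, NNReal.image_coe_Ico, Real.volume_Ico, ENNReal.ofReal, NNReal.sub_def]

lemma leb_Icc (a b : ℝ≥0) : leb (Icc a b) = ((b - a : ℝ≥0) : ℝ≥0∞) := by
  rw [leb_apply, NNReal.image_coe_Icc, Real.volume_Icc, ENNReal.ofReal, NNReal.sub_def]

lemma leb_Iic (b : ℝ≥0) : leb (Iic b) = b := by
  rw [← Icc_bot, leb_Icc]; simp

instance : NullSingletonClass leb := ⟨fun x => by rw [← Icc_self, leb_Icc]; simp⟩

instance : SigmaFinite leb :=
  ⟨⟨⟨fun n : ℕ => Iic (n : ℝ≥0), fun _ => trivial, fun n => by simp [leb_Iic],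
    iUnion_eq_univ_iff.2 exists_nat_ge⟩⟩⟩

lemma map_add_leb (b : ℝ≥0) : leb.map (fun x => b + x) = leb.restrict (Ici b) := by
  have hIic (x : ℝ≥0) : leb.map (fun x => b + x) (Iic x) = leb.restrict (Ici b) (Iic x) := by
    rw [Measure.map_apply (by fun_prop) measurableSet_Iic, Measure.restrict_apply measurableSet_Iic,
      inter_comm, Ici_inter_Iic, leb_Icc, ← leb_Iic]
    rcases le_or_gt b x with hbx | hxb
    · congr 1
      ext y
      simp [le_tsub_iff_left hbx]
    · have : (fun y => b + y) ⁻¹' Iic x = ∅ := by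
        ext y
        simpa using hxb.trans_le le_self_add
      simp [this, leb_Iic, tsub_eq_zero_of_le hxb.le]
  refine measure_ext_of_Iic (fun x => ?_) hIic
  rw [hIic, Measure.restrict_apply measurableSet_Iic, inter_comm, Ici_inter_Iic, leb_Icc]
  exact ENNReal.coe_ne_top

lemma lintegral_natCast_poissonMeasure (r : ℝ≥0) :
    ∫⁻ k : ℕ, (k : ℝ≥0∞) ∂poissonMeasure r = r := by
  have hmass : ∑' k : ℕ, poissonMeasure r {k} = 1 := by
    simpa using (lintegral_countable' (μ := poissonMeasure r) 1).symm
  rw [lintegral_countable', tsum_eq_zero_add' ENNReal.summable]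
  simp only [Nat.cast_zero, zero_mul, zero_add]
  calc ∑' k : ℕ, ((k + 1 : ℕ) : ℝ≥0∞) * poissonMeasure r {k + 1}
      = ∑' k : ℕ, r * poissonMeasure r {k} := by
        refine tsum_congr fun k => ?_
        rw [poissonMeasure_singleton, poissonMeasure_singleton, ← ENNReal.ofReal_natCast,
          ← ENNReal.ofReal_coe_nnreal, ← ENNReal.ofReal_mul (by positivity),
          ← ENNReal.ofReal_mul (by positivity), Nat.factorial_succ]
        congr 1
        push_cast
        field_simp
        exact pow_succ' _ _
    _ = r := by rw [ENNReal.tsum_mul_left, hmass, mul_one]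

lemma poissonMeasure_two_le (r : ℝ≥0) :
    poissonMeasure r {k | 2 ≤ k} ≤ (r : ℝ≥0∞) ^ 2 := by
  have hcompl : {k : ℕ | 2 ≤ k} = ({0, 1} : Set ℕ)ᶜ := by
    ext k; simp only [mem_ofPred_eq, mem_compl_iff, mem_insert_iff, mem_singleton_iff]; omega
  have hmass : poissonMeasure r {0, 1} = ENNReal.ofReal (Real.exp (-r) * (1 + r)) := by
    rw [insert_eq, measure_union (by simp) (by measurability), poissonMeasure_singleton,
      poissonMeasure_singleton, ← ENNReal.ofReal_add (by positivity) (by positivity)]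
    congr 1
    simp; ring
  rw [hcompl, prob_compl_eq_one_sub (by measurability), hmass, ← ENNReal.ofReal_coe_nnreal,
    ← ENNReal.ofReal_pow (by positivity), ← ENNReal.ofReal_one,
    ← ENNReal.ofReal_sub _ (by positivity)]
  refine ENNReal.ofReal_le_ofReal ?_
  have hexp : (1 - (r : ℝ)) * (1 + r) ≤ Real.exp (-r) * (1 + r) := by
    gcongr
    linarith [Real.add_one_le_exp (-(r : ℝ))]
  nlinarith

section Atoms

variable {α κ : Type*}

/-- The atom, in the algebra generated by the sets `C i`, of the points that lie in `C i` exactly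
for `i ∈ J`. -/
def atom (C : κ → Set α) (J : Finset κ) : Set α := {x | ∀ i, i ∈ J ↔ x ∈ C i}

lemma disjoint_atom (C : κ → Set α) : Pairwise fun J J' => Disjoint (atom C J) (atom C J') :=
  fun _ _ hne => Set.disjoint_left.2 fun _ hx hx' =>
    hne (Finset.ext fun i => (hx i).trans (hx' i).symm)

lemma iUnion_atom [Fintype κ] [DecidableEq κ] (C : κ → Set α) (i : κ) :
    ⋃ J ∈ Finset.univ.filter (i ∈ ·), atom C J = C i := by
  classical
  ext x
  simp only [mem_iUnion, Finset.mem_filter_univ, exists_prop]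
  exact ⟨fun ⟨_, hi, hx⟩ => (hx i).1 hi,
    fun hx => ⟨Finset.univ.filter fun k => x ∈ C k, by simpa using hx, fun k => by simp⟩⟩

variable [MeasurableSpace α]

lemma measurableSet_atom [Countable κ] {C : κ → Set α} (hC : ∀ i, MeasurableSet (C i))
    (J : Finset κ) : MeasurableSet (atom C J) :=
  measurableSet_setOfPred.2 (Measurable.forall fun i =>
    measurable_const.iff (measurableSet_setOfPred.1 (hC i)))

lemma measure_eq_sum_atom [Fintype κ] [DecidableEq κ] {C : κ → Set α}
    (hC : ∀ i, MeasurableSet (C i)) (ν : Measure α) (i : κ) :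
    ν (C i) = ∑ J with i ∈ J, ν (atom C J) := by
  conv_lhs => rw [← iUnion_atom C i]
  exact measure_biUnion_finset (fun _ _ _ _ hne => disjoint_atom C hne)
    fun J _ => measurableSet_atom hC J

end Atoms

/-- Keep those children that are born up to time `s`, if the parent is born at time `b`. -/
def truncate (b : ℝ≥0∞) (s : ℝ≥0) (q : ℕ → ℝ≥0∞) (j : ℕ) : ℝ≥0∞ :=
  if b + q j ≤ s then q j else ⊤

lemma truncate_nthPoint_le_iff {ν : Measure ℝ≥0} (hν : IsCountingMeasure ν) (b : ℝ≥0∞) (s : ℝ≥0)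
    (j : ℕ) (c : ℝ≥0) :
    truncate b s (nthPoint ν) j ≤ c ↔ (j : ℝ≥0∞) < ν (Iic c ∩ {x : ℝ≥0 | b + x ≤ s}) := by
  have htrunc : truncate b s (nthPoint ν) j ≤ c ↔ b + nthPoint ν j ≤ s ∧ nthPoint ν j ≤ c := by
    unfold truncate
    split_ifs with h <;> simp [h]
  rw [htrunc]
  by_cases hb : b ≤ s
  · lift b to ℝ≥0 using ne_top_of_le_ne_top ENNReal.coe_ne_top hb
    have hset : Iic c ∩ {x : ℝ≥0 | (b : ℝ≥0∞) + x ≤ s} = Iic (min c (s - b)) := by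
      ext x
      simp only [mem_inter_iff, mem_Iic, mem_ofPred_eq, le_min_iff]
      rw [le_tsub_iff_left (by exact_mod_cast hb)]
      norm_cast
    rw [hset, ← nthPoint_le_iff hν, ENNReal.coe_min, le_min_iff, and_comm, ENNReal.coe_sub,
      ENNReal.le_sub_iff_add_le_left ENNReal.coe_ne_top hb]
  · have hset : {x : ℝ≥0 | b + x ≤ s} = ∅ :=
      eq_empty_of_forall_notMem fun x hx => hb (le_self_add.trans hx)
    simp only [hset, inter_empty, measure_empty, not_lt_zero, iff_false, not_and]
    exact fun hx => absurd (le_self_add.trans hx) hb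

lemma measure_singleton_eq_tsum {ν : Measure ℝ≥0} (hν : IsCountingMeasure ν) (x : ℝ≥0) :
    ν {x} = ∑' j, if nthPoint ν j = x then 1 else 0 := by
  conv_lhs => rw [eq_sum_diracTop_nthPoint hν]
  rw [Measure.sum_apply _ (measurableSet_singleton x)]
  refine tsum_congr fun j => ?_
  rw [diracTop_apply _ (measurableSet_singleton x)]
  simp [indicator_apply]

lemma one_le_measure_singleton {ν : Measure ℝ≥0} (hν : IsCountingMeasure ν) {x : ℝ≥0} {j : ℕ}
    (hj : nthPoint ν j = x) : 1 ≤ ν {x} := by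
  rw [measure_singleton_eq_tsum hν]
  exact (if_pos hj).ge.trans (ENNReal.le_tsum j)

lemma two_le_measure_singleton {ν : Measure ℝ≥0} (hν : IsCountingMeasure ν) {x : ℝ≥0} {i j : ℕ}
    (hij : i ≠ j) (hi : nthPoint ν i = x) (hj : nthPoint ν j = x) : 2 ≤ ν {x} := by
  rw [measure_singleton_eq_tsum hν]
  refine le_trans ?_ (ENNReal.sum_le_tsum {i, j})
  rw [Finset.sum_pair hij, if_pos hi, if_pos hj, one_add_one_eq_two]

/-- The cells `[k / n, (k + 1) / n)` of the partition of `[0, ∞)` with mesh `1 / n`. -/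
def gridCell (n k : ℕ) : Set ℝ≥0 := (fun x : ℝ≥0 => ⌊x * n⌋₊) ⁻¹' {k}

lemma measurableSet_gridCell (n k : ℕ) : MeasurableSet (gridCell n k) :=
  (Nat.measurable_floor.comp (by fun_prop)) (measurableSet_singleton k)

lemma disjoint_gridCell (n : ℕ) : Pairwise fun k l => Disjoint (gridCell n k) (gridCell n l) :=
  pairwise_disjoint_fiber _

lemma leb_gridCell_le {n : ℕ} (hn : n ≠ 0) (k : ℕ) : leb (gridCell n k) ≤ (n : ℝ≥0∞)⁻¹ := by
  have hpos : (0 : ℝ≥0) < n := by positivity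
  have hsub : gridCell n k ⊆ Ico ((k : ℝ≥0) / n) ((k + 1 : ℝ≥0) / n) := fun x hx => by
    obtain ⟨hle, hlt⟩ := (Nat.floor_eq_iff zero_le).1 hx
    exact ⟨(div_le_iff₀ hpos).2 hle, (lt_div_iff₀ hpos).2 hlt⟩
  refine (measure_mono hsub).trans_eq ?_
  rw [leb_Ico, ← NNReal.sub_div, add_tsub_cancel_left, one_div, ENNReal.coe_inv hpos.ne',
    ENNReal.coe_natCast]

lemma exists_forall_measure_gridCell_le {g : ℝ≥0 → ℝ≥0∞} (hfin : ∫⁻ t, g t ∂leb ≠ ⊤) {ε : ℝ≥0}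
    (hε : 0 < ε) : ∃ n, ∀ k, leb.withDensity g (gridCell n k) ≤ ε := by
  obtain ⟨δ, hδ, hδε⟩ := exists_pos_setLIntegral_lt_of_measure_lt hfin
    (ε := ε) (by exact_mod_cast hε.ne')
  obtain ⟨n, hn⟩ := ENNReal.exists_inv_nat_lt hδ.ne'
  have hn0 : n ≠ 0 := by
    rintro rfl
    simp at hn
  refine ⟨n, fun k => ?_⟩
  rw [withDensity_apply _ (measurableSet_gridCell n k)]
  exact (hδε _ ((leb_gridCell_le hn0 k).trans_lt hn)).le

namespace IsPoissonProcess

variable {Ω : Type*} [MeasurableSpace Ω] {P : Measure Ω} {ξ : Ω → Measure ℝ≥0} {Λ : Measure ℝ≥0}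

lemma measurable_apply (hξ : IsPoissonProcess P ξ Λ) {B : Set ℝ≥0} (hB : MeasurableSet B) :
    Measurable fun ω => ξ ω B :=
  (Measure.measurable_coe hB).comp hξ.measurable

lemma lintegral_apply (hξ : IsPoissonProcess P ξ Λ) {B : Set ℝ≥0} (hB : MeasurableSet B)
    (hΛ : Λ B ≠ ⊤) : ∫⁻ ω, ξ ω B ∂P = Λ B := by
  rw [← lintegral_map (f := fun x => x) measurable_id (hξ.measurable_apply hB), hξ.law B hB hΛ,
    lintegral_map (f := fun x => x) measurable_id (by fun_prop), lintegral_natCast_poissonMeasure,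
    ENNReal.coe_toNNReal hΛ]

lemma measure_two_le (hξ : IsPoissonProcess P ξ Λ) {B : Set ℝ≥0} (hB : MeasurableSet B)
    (hΛ : Λ B ≠ ⊤) : P {ω | 2 ≤ ξ ω B} ≤ Λ B ^ 2 := by
  have hmap : P {ω | 2 ≤ ξ ω B} = (P.map fun ω => ξ ω B) (Ici 2) := by
    rw [Measure.map_apply (hξ.measurable_apply hB) measurableSet_Ici]; rfl
  have hpre : (fun k : ℕ => (k : ℝ≥0∞)) ⁻¹' Ici 2 = {k | 2 ≤ k} := by
    ext k
    simp only [mem_preimage, mem_Ici, mem_ofPred_eq]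
    exact Nat.ofNat_le_cast
  rw [hmap, hξ.law B hB hΛ, Measure.map_apply (by fun_prop) measurableSet_Ici, hpre]
  simpa [ENNReal.coe_toNNReal hΛ] using poissonMeasure_two_le (Λ B).toNNReal

lemma iIndepFun_atom (hξ : IsPoissonProcess P ξ Λ) {κ : Type*} [Finite κ] {C : κ → Set ℝ≥0}
    (hC : ∀ i, MeasurableSet (C i)) :
    iIndepFun (fun (J : Finset κ) ω => ξ ω (atom C J)) P := by
  let e := Finite.equivFin (Finset κ)
  have h := (hξ.indep _ (fun k => atom C (e.symm k)) (fun k => measurableSet_atom hC _)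
    fun k l hkl => disjoint_atom C (e.symm.injective.ne hkl)).precomp e.injective
  simpa only [Equiv.symm_apply_apply] using h

lemma indepFun_of_finite (hξ : IsPoissonProcess P ξ Λ) {κ : Type*} [Finite κ] {B : κ → Set ℝ≥0}
    (hB : ∀ i, MeasurableSet (B i)) {S : Set ℝ≥0} (hS : MeasurableSet S)
    (hBS : ∀ i, Disjoint (B i) S) :
    IndepFun (fun ω i => ξ ω (B i)) (fun ω => ξ ω S) P := by
  classical
  have := Fintype.ofFinite κ
  let C : Option κ → Set ℝ≥0 := fun o => o.elim S B
  have hC : ∀ o, MeasurableSet (C o) := by rintro (_ | i); exacts [hS, hB i]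
  have hatom := (hξ.iIndepFun_atom hC).indepFun_finset {J | none ∉ J} {J | none ∈ J}
    (Finset.disjoint_filter.2 fun _ _ => id) fun J =>
      hξ.measurable_apply (measurableSet_atom hC J)
  have hsums := hatom.comp
    (φ := fun z i => ∑ J, if some i ∈ J.1 then z J else 0) (ψ := fun z => ∑ J, z J)
    (measurable_pi_lambda _ fun i => Finset.measurable_fun_sum _ fun J _ => by
      split_ifs <;> fun_prop) (by fun_prop)
  convert hsums using 1
  · funext ω i
    have hempty (J : Finset (Option κ)) (hi : some i ∈ J) (hnone : none ∈ J) : atom C J = ∅ :=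
      eq_empty_of_forall_notMem fun x hx =>
        Set.disjoint_left.1 (hBS i) ((hx (some i)).1 hi) ((hx none).1 hnone)
    calc ξ ω (B i) = ∑ J, if some i ∈ J then ξ ω (atom C J) else 0 := by
          rw [← Finset.sum_filter]
          exact measure_eq_sum_atom hC (ξ ω) (some i)
      _ = ∑ J with none ∉ J, if some i ∈ J then ξ ω (atom C J) else 0 := by
          refine (Finset.sum_subset (Finset.filter_subset _ _) fun J _ hJ => ?_).symm
          split_ifs with hi
          · rw [hempty J hi (by simpa using hJ), measure_empty]
          · rfl
      _ = _ := (Finset.sum_coe_sort _ _).symm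
  · funext ω
    exact (measure_eq_sum_atom hC (ξ ω) none).trans (Finset.sum_coe_sort _ _).symm

lemma indepFun_of_disjoint [IsProbabilityMeasure P] (hξ : IsPoissonProcess P ξ Λ) {ι : Type*}
    {B : ι → Set ℝ≥0} (hB : ∀ i, MeasurableSet (B i)) {S : Set ℝ≥0} (hS : MeasurableSet S)
    (hBS : ∀ i, Disjoint (B i) S) :
    IndepFun (fun ω i => ξ ω (B i)) (fun ω => ξ ω S) P :=
  IndepFun.process_indepFun (fun i => hξ.measurable_apply (hB i)) (hξ.measurable_apply hS)
    fun F => hξ.indepFun_of_finite (B := fun i : F => B i) (fun i => hB i) hS fun i => hBS i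

lemma indepFun_truncate [IsProbabilityMeasure P] (hξ : IsPoissonProcess P ξ Λ) (b : ℝ≥0∞)
    (s : ℝ≥0) {S : Set ℝ≥0} (hS : MeasurableSet S) (hbs : ∀ x ∈ S, (s : ℝ≥0∞) < b + x) :
    IndepFun (fun ω => truncate b s (nthPoint (ξ ω))) (fun ω => ξ ω S) P := by
  have hmasses := hξ.indepFun_of_disjoint (B := fun c : ℝ≥0 => Iic c ∩ {x : ℝ≥0 | b + x ≤ s})
    (fun c => measurableSet_Iic.inter (measurableSet_le (by fun_prop) measurable_const)) hS
    (fun c => Set.disjoint_left.2 fun x hx hx' => absurd hx.2 (not_le.2 (hbs x hx')))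
  refine indep_of_indep_of_le_left hmasses ?_
  rw [← measurable_iff_comap_le]
  refine @measurable_pi_lambda _ _ _ (_) _ _ fun j => ?_
  refine @measurable_of_Iic ℝ≥0∞ Ω _ _ _ (_) _ _ inferInstance _ fun c => ?_
  induction c with
  | top => simp
  | coe c =>
    refine ⟨{z | (j : ℝ≥0∞) < z c}, measurableSet_lt measurable_const (measurable_pi_apply _), ?_⟩
    ext ω
    exact (truncate_nthPoint_le_iff (hξ.counting ω) b s j c).symm

lemma measure_nthPoint_eq_zero (hξ : IsPoissonProcess P ξ Λ) {x : ℝ≥0} (hx : Λ {x} = 0) (j : ℕ) :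
    P {ω | nthPoint (ξ ω) j = x} = 0 := by
  have hmean : ∫⁻ ω, ξ ω {x} ∂P = 0 := by
    rw [hξ.lintegral_apply (measurableSet_singleton x) (by simp [hx]), hx]
  rw [lintegral_eq_zero_iff (hξ.measurable_apply (measurableSet_singleton x))] at hmean
  have hnull : ∀ᵐ ω ∂P, ¬ nthPoint (ξ ω) j = x := by
    filter_upwards [hmean] with ω hω hj
    have hone := one_le_measure_singleton (hξ.counting ω) hj
    simp only [Pi.zero_apply] at hω
    simp [hω] at hone
  simpa [ae_iff] using hnull

lemma ae_simple {g : ℝ≥0 → ℝ≥0∞} (hfin : ∫⁻ t, g t ∂leb ≠ ⊤)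
    (hξ : IsPoissonProcess P ξ (leb.withDensity g)) :
    ∀ᵐ ω ∂P, ∀ i j, i ≠ j → nthPoint (ξ ω) i ≠ ⊤ → nthPoint (ξ ω) i ≠ nthPoint (ξ ω) j := by
  rw [ae_iff]
  set D := {ω | ¬ ∀ i j, i ≠ j → nthPoint (ξ ω) i ≠ ⊤ → nthPoint (ξ ω) i ≠ nthPoint (ξ ω) j}
  set Λ := leb.withDensity g
  have hΛ : Λ univ ≠ ⊤ := by rwa [withDensity_apply _ MeasurableSet.univ, setLIntegral_univ]
  have hsub (n : ℕ) : D ⊆ ⋃ k, {ω | 2 ≤ ξ ω (gridCell n k)} := by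
    intro ω hω
    simp only [D, mem_ofPred_eq, not_forall, not_not] at hω
    obtain ⟨i, j, hij, hi, heq⟩ := hω
    obtain ⟨x, hx⟩ := WithTop.ne_top_iff_exists.1 hi
    have hcell : {x} ⊆ gridCell n ⌊x * n⌋₊ := singleton_subset_iff.2 rfl
    exact mem_iUnion.2 ⟨_, (two_le_measure_singleton (hξ.counting ω) hij hx.symm
      (heq ▸ hx.symm)).trans (measure_mono hcell)⟩
  -- The cells of mass at most `ε` contribute at most `∑ Λ(cell)² ≤ ε Λ(univ)`.
  have hbound (ε : ℝ≥0) (hε : 0 < ε) : P D ≤ ε * Λ univ := by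
    obtain ⟨n, hn⟩ := exists_forall_measure_gridCell_le hfin hε
    calc P D ≤ ∑' k, P {ω | 2 ≤ ξ ω (gridCell n k)} :=
          (measure_mono (hsub n)).trans (measure_iUnion_le _)
      _ ≤ ∑' k, ε * Λ (gridCell n k) := by
        refine ENNReal.tsum_le_tsum fun k => (hξ.measure_two_le (measurableSet_gridCell n k)
          (measure_ne_top_of_subset (subset_univ _) hΛ)).trans ?_
        rw [sq]
        gcongr
        exact hn k
      _ = ε * Λ (⋃ k, gridCell n k) := by
        rw [ENNReal.tsum_mul_left, measure_iUnion (disjoint_gridCell n) (measurableSet_gridCell n)]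
      _ ≤ ε * Λ univ := by gcongr; exact subset_univ _
  by_contra hne
  obtain ⟨ε, hε, hlt⟩ := ENNReal.exists_nnreal_pos_mul_lt hΛ hne
  exact absurd (hbound ε hε) (not_le.2 hlt)

end IsPoissonProcess

/-- The birth time of `(i, u)` as a function of the waiting times `t` and of the times `p` between
the birth of an individual and the births of its children. -/
def birthOf (t : ℕ → ℝ≥0) (p : ℕ × List ℕ → ℕ → ℝ≥0∞) (i : ℕ) : List ℕ → ℝ≥0∞
  | [] => ((∑ k ∈ Finset.range i, t k : ℝ≥0) : ℝ≥0∞)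
  | j :: u => birthOf t p i u + p (i, u) j

lemma birth_eq_birthOf {Ω : Type*} (τ : ℕ → Ω → ℝ≥0) (ξ : ℕ × List ℕ → Ω → Measure ℝ≥0) (i : ℕ)
    (u : List ℕ) (ω : Ω) :
    birth τ ξ i u ω = birthOf (fun k => τ k ω) (fun l => nthPoint (ξ l ω)) i u := by
  induction u with
  | nil => rfl
  | cons j u ih => rw [birth, birthOf, ih]

lemma measurable_birthOf (i : ℕ) (u : List ℕ) :
    Measurable fun y : (ℕ → ℝ≥0) × (ℕ × List ℕ → ℕ → ℝ≥0∞) => birthOf y.1 y.2 i u := by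
  induction u with
  | nil => simp only [birthOf]; fun_prop
  | cons j u ih => simp only [birthOf]; fun_prop

lemma birthOf_update_children (t : ℕ → ℝ≥0) (p : ℕ × List ℕ → ℕ → ℝ≥0∞) (l : ℕ × List ℕ)
    (q : ℕ → ℝ≥0∞) (i : ℕ) {u : List ℕ} (hu : u.length ≤ l.2.length) :
    birthOf t (Function.update p l q) i u = birthOf t p i u := by
  induction u with
  | nil => rfl
  | cons j u ih =>
    rw [List.length_cons] at hu
    have hne : (i, u) ≠ l := by
      rintro rfl
      exact absurd hu (Nat.not_succ_le_self _)
    rw [birthOf, birthOf, ih (by omega), Function.update_of_ne hne]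

/-- The birth times up to time `s`; later birth times are replaced by `∞`. -/
def history (s : ℝ≥0) (t : ℕ → ℝ≥0) (p : ℕ × List ℕ → ℕ → ℝ≥0∞) (v : ℕ × List ℕ) : ℝ≥0∞ :=
  if birthOf t p v.1 v.2 ≤ s then birthOf t p v.1 v.2 else ⊤

lemma measurable_history (s : ℝ≥0) :
    Measurable fun y : (ℕ → ℝ≥0) × (ℕ × List ℕ → ℕ → ℝ≥0∞) => history s y.1 y.2 :=
  measurable_pi_lambda _ fun _ => Measurable.ite
    (measurableSet_le (measurable_birthOf _ _) measurable_const)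
    (measurable_birthOf _ _) measurable_const

lemma history_congr {s : ℝ≥0} {t t' : ℕ → ℝ≥0} {p p' : ℕ × List ℕ → ℕ → ℝ≥0∞}
    (h : ∀ i u, birthOf t' p' i u = birthOf t p i u ∨
      (s < birthOf t' p' i u ∧ s < birthOf t p i u)) : history s t' p' = history s t p := by
  funext v
  unfold history
  rcases h v.1 v.2 with heq | ⟨hlt', hlt⟩
  · rw [heq]
  · rw [if_neg (not_le.2 hlt'), if_neg (not_le.2 hlt)]

lemma history_update_truncate (s : ℝ≥0) (t : ℕ → ℝ≥0) (p : ℕ × List ℕ → ℕ → ℝ≥0∞)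
    (l : ℕ × List ℕ) :
    history s t (Function.update p l (truncate (birthOf t p l.1 l.2) s (p l))) =
      history s t p := by
  refine history_congr fun i u => ?_
  induction u with
  | nil => exact Or.inl rfl
  | cons j u ih =>
    rw [birthOf, birthOf]
    by_cases hl : (i, u) = l
    · subst hl
      rw [birthOf_update_children _ _ _ _ _ le_rfl, Function.update_self, truncate]
      split_ifs with h
      · exact Or.inl rfl
      · exact Or.inr ⟨by simp, not_le.1 h⟩
    · rw [Function.update_of_ne hl]
      exact ih.imp (fun heq => by rw [heq]) fun ⟨hlt', hlt⟩ =>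
        ⟨hlt'.trans_le le_self_add, hlt.trans_le le_self_add⟩

/-- The waiting time `x` after an epoch at `b`, replaced by `s + 1` if the next epoch is after
time `s`. -/
def truncateWaiting (b s x : ℝ≥0) : ℝ≥0 := if b + x ≤ s then x else s + 1

lemma history_update_truncateWaiting (s : ℝ≥0) (t : ℕ → ℝ≥0) (p : ℕ × List ℕ → ℕ → ℝ≥0∞) (i : ℕ) :
    history s (Function.update t i (truncateWaiting (∑ k ∈ Finset.range i, t k) s (t i))) p =
      history s t p := by
  rw [truncateWaiting]
  split_ifs with h
  · rw [Function.update_eq_self]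
  refine history_congr fun k u => ?_
  induction u with
  | nil =>
    simp only [birthOf, ENNReal.coe_lt_coe, ENNReal.coe_inj]
    rcases le_or_gt k i with hki | hik
    · exact Or.inl (Finset.sum_congr rfl fun j hj =>
        Function.update_of_ne ((Finset.mem_range.1 hj).trans_le hki).ne _ _)
    · refine Or.inr ⟨(lt_add_one s).trans_le ?_, (not_le.1 h).trans_le ?_⟩
      · simpa using Finset.single_le_sum_of_canonicallyOrdered
          (f := Function.update t i (s + 1)) (Finset.mem_range.2 hik)
      · rw [← Finset.sum_range_succ]
        exact Finset.sum_le_sum_of_subset (Finset.range_subset_range.2 hik)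
  | cons j u ih =>
    rw [birthOf, birthOf]
    exact ih.imp (fun heq => by rw [heq]) fun ⟨hlt', hlt⟩ =>
      ⟨hlt'.trans_le le_self_add, hlt.trans_le le_self_add⟩

section NaturalSigma

variable {Ω : Type*} {τ : ℕ → Ω → ℝ≥0} {ξ : ℕ × List ℕ → Ω → Measure ℝ≥0}

/-- The history of the cluster process up to time `s`. It records the birth time of every labelled
individual, so it carries more information than `naturalSigma τ ξ s`. -/
def historyProcess (τ : ℕ → Ω → ℝ≥0) (ξ : ℕ × List ℕ → Ω → Measure ℝ≥0) (s : ℝ≥0) (ω : Ω) :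
    ℕ × List ℕ → ℝ≥0∞ :=
  history s (fun k => τ k ω) (fun l => nthPoint (ξ l ω))

lemma mem_Ioc_historyProcess_iff {a b s : ℝ≥0} (hbs : b ≤ s) (v : ℕ × List ℕ) (ω : Ω) :
    historyProcess τ ξ s ω v ∈ Ioc (a : ℝ≥0∞) b ↔ birth τ ξ v.1 v.2 ω ∈ Ioc (a : ℝ≥0∞) b := by
  rw [historyProcess, history, ← birth_eq_birthOf]
  split_ifs with h
  · rfl
  · have hb : ¬ birth τ ξ v.1 v.2 ω ≤ b := fun hle => h (hle.trans (by exact_mod_cast hbs))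
    simp [hb]

lemma naturalSigma_le_comap (hξ : ∀ l ω, IsCountingMeasure (ξ l ω)) (s : ℝ≥0) :
    naturalSigma τ ξ s ≤ MeasurableSpace.comap (historyProcess τ ξ s) inferInstance := by
  refine iSup_le fun n => iSup_le fun a => iSup_le fun b => iSup_le fun hab => ?_
  have hcount : (fun ω => generation τ ξ n ω (Ioc a b)) =
      (fun z : ℕ × List ℕ → ℝ≥0∞ => ∑' v : ℕ × List ℕ,
        if v.2.length = n ∧ z v ∈ Ioc (a : ℝ≥0∞) b then 1 else 0) ∘ historyProcess τ ξ s := by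
    funext ω
    rw [generation_eq_sum hξ, Measure.sum_apply _ measurableSet_Ioc]
    refine tsum_congr fun v => ?_
    simp only [mem_Ioc_historyProcess_iff hab.2]
    by_cases hv : v.2.length = n <;> simp [hv, diracTop_Ioc]
  rw [hcount, ← MeasurableSpace.comap_comp]
  refine MeasurableSpace.comap_mono (measurable_iff_comap_le.1 ?_)
  refine Measurable.tsum fun v => Measurable.ite ?_ measurable_const measurable_const
  exact (MeasurableSet.const _).inter (measurable_pi_apply v measurableSet_Ioc)

end NaturalSigma

section Independence

variable {Ω : Type*} [MeasurableSpace Ω] {P : Measure Ω} {α β γ : Type*}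
  [MeasurableSpace α] [MeasurableSpace β] [MeasurableSpace γ] {X : Ω → α} {Y : Ω → β} {Z : Ω → γ}

lemma indepFun_update {ι : Type*} [DecidableEq ι] {W : ι → Ω → β} (hW : iIndepFun W P)
    (hWm : ∀ i, Measurable (W i)) (i : ι) (c : β) :
    IndepFun (W i) (fun ω => Function.update (fun j => W j ω) i c) P := by
  have hindep := indep_iSup_of_disjoint (fun j => (hWm j).comap_le) hW
    (S := {i}) (T := {i}ᶜ) disjoint_compl_right
  refine indep_of_indep_of_le_left (indep_of_indep_of_le_right hindep ?_) (by simp)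
  refine measurable_iff_comap_le.1 (@measurable_pi_lambda _ _ _ (_) _ _ fun j => ?_)
  rcases eq_or_ne j i with rfl | hj
  · simp only [Function.update_self]
    exact measurable_const
  · simp only [Function.update_of_ne hj]
    exact measurable_iff_comap_le.2 (le_iSup₂_of_le j hj le_rfl)

variable [IsFiniteMeasure P]

lemma lintegral_comp_of_indepFun (hXY : IndepFun X Y P) (hX : Measurable X) (hY : Measurable Y)
    {g : α → β → ℝ≥0∞} (hg : Measurable (Function.uncurry g)) :
    ∫⁻ ω, g (X ω) (Y ω) ∂P = ∫⁻ ω', ∫⁻ ω, g (X ω') (Y ω) ∂P ∂P :=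
  calc ∫⁻ ω, g (X ω) (Y ω) ∂P
      = ∫⁻ z, Function.uncurry g z ∂P.map (fun ω => (X ω, Y ω)) :=
        (lintegral_map hg (hX.prodMk hY)).symm
    _ = ∫⁻ x, ∫⁻ y, g x y ∂P.map Y ∂P.map X := by
        rw [(indepFun_iff_map_prod_eq_prod_map_map hX.aemeasurable hY.aemeasurable).1 hXY]
        exact lintegral_prod _ hg.aemeasurable
    _ = ∫⁻ ω', ∫⁻ y, g (X ω') y ∂P.map Y ∂P := lintegral_map hg.lintegral_prod_right' hX
    _ = ∫⁻ ω', ∫⁻ ω, g (X ω') (Y ω) ∂P ∂P :=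
        lintegral_congr fun _ => lintegral_map (hg.comp measurable_prodMk_left) hY

lemma ae_of_indepFun (hXY : IndepFun X Y P) (hX : Measurable X) (hY : Measurable Y)
    {p : α × β → Prop} (hp : MeasurableSet {z | p z}) (h : ∀ x, ∀ᵐ ω ∂P, p (x, Y ω)) :
    ∀ᵐ ω ∂P, p (X ω, Y ω) := by
  have hprod : ∀ᵐ z ∂(P.map X).prod (P.map Y), p z :=
    (Measure.ae_prod_iff_ae_ae hp).2 (Filter.Eventually.of_forall fun x =>
      (ae_map_iff hY.aemeasurable (hp.preimage measurable_prodMk_left)).2 (h x))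
  rw [← (indepFun_iff_map_prod_eq_prod_map_map hX.aemeasurable hY.aemeasurable).1 hXY] at hprod
  exact ae_of_ae_map (hX.prodMk hY).aemeasurable hprod

lemma indepFun_prodMk_of_indepFun (hXY : IndepFun X Y P)
    (hZ : IndepFun Z (fun ω => (X ω, Y ω)) P) (hXm : Measurable X) (hYm : Measurable Y)
    (hZm : Measurable Z) : IndepFun (fun ω => (Z ω, Y ω)) X P := by
  have hZY : IndepFun Z Y P := hZ.comp measurable_id measurable_snd
  have hYX : IndepFun Y X P := hXY.symm
  have hZYX : IndepFun Z (fun ω => (Y ω, X ω)) P := hZ.comp measurable_id measurable_swap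
  rw [indepFun_iff_map_prod_eq_prod_map_map (by fun_prop) (by fun_prop)] at hZY hYX hZYX ⊢
  apply MeasurableEquiv.prodAssoc.map_measurableEquiv_injective
  rw [hZY, Measure.prodAssoc_prod, ← hYX, ← hZYX,
    Measure.map_map MeasurableEquiv.prodAssoc.measurable (by fun_prop)]
  rfl

end Independence

/-- The function `φ` moved to start at time `b`: it is `φ (v - b)` for `v > b`, and `0` up to
time `b`. -/
def shifted (φ : ℝ≥0 → ℝ≥0∞) (b : ℝ≥0∞) (v : ℝ≥0) : ℝ≥0∞ :=
  if b < v then φ (v - b.toNNReal) else 0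

lemma measurable_shifted {φ : ℝ≥0 → ℝ≥0∞} (hφ : Measurable φ) :
    Measurable fun y : ℝ≥0∞ × ℝ≥0 => shifted φ y.1 y.2 :=
  Measurable.ite (measurableSet_lt (by fun_prop) (by fun_prop)) (by fun_prop) measurable_const

lemma measurableSet_shift (b : ℝ≥0∞) (s r : ℝ≥0) :
    MeasurableSet {x : ℝ≥0 | b + x ∈ Ioc (s : ℝ≥0∞) r} :=
  measurableSet_Ioc.preimage (by fun_prop)

lemma setLIntegral_shift {φ : ℝ≥0 → ℝ≥0∞} (hφ : Measurable φ) (b : ℝ≥0∞) (s r : ℝ≥0) :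
    ∫⁻ x in {x : ℝ≥0 | b + x ∈ Ioc (s : ℝ≥0∞) r}, φ x ∂leb =
      ∫⁻ v in Ioc s r, shifted φ b v ∂leb := by
  induction b with
  | top => simp [shifted]
  | coe b =>
    have hset : {x : ℝ≥0 | (b : ℝ≥0∞) + x ∈ Ioc (s : ℝ≥0∞) r} = (fun x => b + x) ⁻¹' Ioc s r := by
      ext x
      simp only [mem_ofPred_eq, mem_preimage, mem_Ioc]
      norm_cast
    have hshift : shifted φ b = (Ioi b).indicator fun v => φ (v - b) := by
      funext v
      simp [shifted, indicator_apply]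
    calc ∫⁻ x in {x : ℝ≥0 | (b : ℝ≥0∞) + x ∈ Ioc (s : ℝ≥0∞) r}, φ x ∂leb
        = ∫⁻ x in (fun x => b + x) ⁻¹' Ioc s r, φ (b + x - b) ∂leb := by
          simp only [hset, add_tsub_cancel_left]
      _ = ∫⁻ v in Ioc s r, φ (v - b) ∂leb.map (fun x => b + x) :=
          (setLIntegral_map (f := fun v => φ (v - b)) measurableSet_Ioc (by fun_prop)
            (by fun_prop)).symm
      _ = ∫⁻ v in Ioi b ∩ Ioc s r, φ (v - b) ∂leb := by
          rw [map_add_leb, ← restrict_Ioi_eq_restrict_Ici,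
            Measure.restrict_restrict measurableSet_Ioc, inter_comm]
      _ = ∫⁻ v in Ioc s r, shifted φ b v ∂leb := by
          rw [hshift, setLIntegral_indicator measurableSet_Ioi]

lemma diracTop_add_apply_Ioc (b x : ℝ≥0∞) (s r : ℝ≥0) :
    diracTop (b + x) (Ioc s r) = diracTop x {y : ℝ≥0 | b + y ∈ Ioc (s : ℝ≥0∞) r} := by
  classical
  rw [diracTop_Ioc]
  induction x with
  | top => simp [diracTop_top]
  | coe x =>
    rw [diracTop_coe, Measure.dirac_apply' _ (measurableSet_shift b s r), indicator_apply]
    rfl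

lemma measure_shift_eq_tsum {ν : Measure ℝ≥0} (hν : IsCountingMeasure ν) (b : ℝ≥0∞) (s r : ℝ≥0) :
    ν {x : ℝ≥0 | b + x ∈ Ioc (s : ℝ≥0∞) r} = ∑' j, diracTop (b + nthPoint ν j) (Ioc s r) := by
  conv_lhs => rw [eq_sum_diracTop_nthPoint hν]
  rw [Measure.sum_apply _ (measurableSet_shift b s r)]
  exact tsum_congr fun j => (diracTop_add_apply_Ioc b _ s r).symm

lemma tsum_diracTop_add_nthPoint_Iic_le {ν : Measure ℝ≥0} (hν : IsCountingMeasure ν) (b : ℝ≥0∞)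
    (r : ℝ≥0) : ∑' j, diracTop (b + nthPoint ν j) (Iic r) ≤ ν univ * diracTop b (Iic r) := by
  conv_rhs => rw [eq_sum_diracTop_nthPoint hν]
  rw [Measure.sum_apply _ MeasurableSet.univ, ← ENNReal.tsum_mul_right]
  refine ENNReal.tsum_le_tsum fun j => ?_
  induction nthPoint ν j with
  | top => simp [diracTop_top]
  | coe x =>
    simp only [diracTop_coe, measure_univ, one_mul, diracTop_Iic]
    split_ifs with hbx hb
    exacts [le_rfl, absurd (le_self_add.trans hbx) hb, zero_le_one, le_rfl]

lemma measurable_truncate (s : ℝ≥0) :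
    Measurable fun y : ℝ≥0∞ × (ℕ → ℝ≥0∞) => truncate y.1 s y.2 :=
  measurable_pi_lambda _ fun _ =>
    Measurable.ite (measurableSet_le (by fun_prop) measurable_const) (by fun_prop) measurable_const

lemma measurable_nthPoints : Measurable nthPoint :=
  measurable_pi_lambda _ measurable_nthPoint

namespace IsPoissonProcess

variable {Ω α : Type*} [MeasurableSpace Ω] [MeasurableSpace α] {P : Measure Ω}
  {ξ : Ω → Measure ℝ≥0} {h : ℝ≥0 → ℝ≥0∞} {Y : Ω → α}

lemma lintegral_truncate_mul_tsum [IsProbabilityMeasure P] (hh : Measurable h)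
    (hfin : ∫⁻ t, h t ∂leb ≠ ⊤) (hξ : IsPoissonProcess P ξ (leb.withDensity h)) (b : ℝ≥0∞)
    {φ : (ℕ → ℝ≥0∞) → ℝ≥0∞} (hφ : Measurable φ) (s r : ℝ≥0) :
    ∫⁻ ω, φ (truncate b s (nthPoint (ξ ω))) *
        ∑' j, diracTop (b + nthPoint (ξ ω) j) (Ioc s r) ∂P =
      ∫⁻ ω, φ (truncate b s (nthPoint (ξ ω))) * ∫⁻ v in Ioc s r, shifted h b v ∂leb ∂P := by
  have hS := measurableSet_shift b s r
  have hmean : leb.withDensity h {x : ℝ≥0 | b + x ∈ Ioc (s : ℝ≥0∞) r} ≠ ⊤ := by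
    rw [withDensity_apply _ hS]
    exact ne_top_of_le_ne_top hfin (setLIntegral_le_lintegral _ _)
  have hφm : Measurable fun ω => φ (truncate b s (nthPoint (ξ ω))) :=
    hφ.comp ((measurable_truncate s).comp
      (measurable_const.prodMk (measurable_nthPoints.comp hξ.measurable)))
  have hindep := (hξ.indepFun_truncate b s hS fun x hx => hx.1).comp hφ measurable_id
  simp_rw [← measure_shift_eq_tsum (hξ.counting _)]
  rw [lintegral_mul_eq_lintegral_mul_lintegral_of_indepFun'' hφm.aemeasurable
      (hξ.measurable_apply hS).aemeasurable hindep, lintegral_mul_const _ hφm,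
    hξ.lintegral_apply hS hmean, withDensity_apply _ hS, setLIntegral_shift hh]

/-- The children born to an individual after time `s` are independent of `Y` and of the children
born up to time `s`. -/
lemma lintegral_children [IsProbabilityMeasure P] (hh : Measurable h)
    (hfin : ∫⁻ t, h t ∂leb ≠ ⊤) (hξ : IsPoissonProcess P ξ (leb.withDensity h))
    (hY : Measurable Y) (hYξ : IndepFun Y ξ P) {b : α → ℝ≥0∞} (hb : Measurable b)
    {φ : α × (ℕ → ℝ≥0∞) → ℝ≥0∞} (hφ : Measurable φ) (s r : ℝ≥0) :
    ∫⁻ ω, φ (Y ω, truncate (b (Y ω)) s (nthPoint (ξ ω))) *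
        ∑' j, diracTop (b (Y ω) + nthPoint (ξ ω) j) (Ioc s r) ∂P =
      ∫⁻ ω, φ (Y ω, truncate (b (Y ω)) s (nthPoint (ξ ω))) *
        ∫⁻ v in Ioc s r, shifted h (b (Y ω)) v ∂leb ∂P := by
  have hφm : Measurable (Function.uncurry fun (y : α) (ν : Measure ℝ≥0) =>
      φ (y, truncate (b y) s (nthPoint ν))) :=
    hφ.comp (measurable_fst.prodMk ((measurable_truncate s).comp
      ((hb.comp measurable_fst).prodMk (measurable_nthPoints.comp measurable_snd))))
  have hcount : Measurable (Function.uncurry fun (y : α) (ν : Measure ℝ≥0) =>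
      ∑' j, diracTop (b y + nthPoint ν j) (Ioc s r)) :=
    Measurable.tsum fun j => (measurable_diracTop_apply measurableSet_Ioc).comp
      ((hb.comp measurable_fst).add ((measurable_nthPoint j).comp measurable_snd))
  have hmean : Measurable (Function.uncurry fun (y : α) (_ : Measure ℝ≥0) =>
      ∫⁻ v in Ioc s r, shifted h (b y) v ∂leb) :=
    (measurable_shifted hh).lintegral_prod_right'.comp (hb.comp measurable_fst)
  rw [lintegral_comp_of_indepFun hYξ hY hξ.measurable
      (g := fun y ν => φ (y, truncate (b y) s (nthPoint ν)) *
        ∑' j, diracTop (b y + nthPoint ν j) (Ioc s r)) (hφm.mul hcount),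
    lintegral_comp_of_indepFun hYξ hY hξ.measurable
      (g := fun y ν => φ (y, truncate (b y) s (nthPoint ν)) *
        ∫⁻ v in Ioc s r, shifted h (b y) v ∂leb) (hφm.mul hmean)]
  exact lintegral_congr fun ω => hξ.lintegral_truncate_mul_tsum hh hfin (b (Y ω))
    (hφ.comp measurable_prodMk_left) s r

lemma lintegral_children_le [IsFiniteMeasure P] (hfin : ∫⁻ t, h t ∂leb ≠ ⊤)
    (hξ : IsPoissonProcess P ξ (leb.withDensity h)) {b : Ω → ℝ≥0∞} (hb : Measurable b)
    (hbξ : IndepFun b ξ P) (r : ℝ≥0) :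
    ∫⁻ ω, ∑' j, diracTop (b ω + nthPoint (ξ ω) j) (Iic r) ∂P ≤
      (∫⁻ t, h t ∂leb) * ∫⁻ ω, diracTop (b ω) (Iic r) ∂P := by
  have hmean : leb.withDensity h univ = ∫⁻ t, h t ∂leb := by
    rw [withDensity_apply _ MeasurableSet.univ, setLIntegral_univ]
  have hdirac : Measurable fun b : ℝ≥0∞ => diracTop b (Iic r) :=
    measurable_diracTop_apply measurableSet_Iic
  have hg : Measurable (Function.uncurry fun (b : ℝ≥0∞) (ν : Measure ℝ≥0) =>
      ν univ * diracTop b (Iic r)) :=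
    ((Measure.measurable_coe MeasurableSet.univ).comp measurable_snd).mul
      (hdirac.comp measurable_fst)
  calc ∫⁻ ω, ∑' j, diracTop (b ω + nthPoint (ξ ω) j) (Iic r) ∂P
      ≤ ∫⁻ ω, ξ ω univ * diracTop (b ω) (Iic r) ∂P :=
        lintegral_mono fun ω => tsum_diracTop_add_nthPoint_Iic_le (hξ.counting ω) (b ω) r
    _ = ∫⁻ ω', ∫⁻ ω, ξ ω univ * diracTop (b ω') (Iic r) ∂P ∂P :=
        lintegral_comp_of_indepFun hbξ hb hξ.measurable hg
    _ = ∫⁻ ω', (∫⁻ t, h t ∂leb) * diracTop (b ω') (Iic r) ∂P := by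
        simp_rw [lintegral_mul_const _ (hξ.measurable_apply MeasurableSet.univ),
          hξ.lintegral_apply MeasurableSet.univ (hmean ▸ hfin), hmean]
    _ = (∫⁻ t, h t ∂leb) * ∫⁻ ω, diracTop (b ω) (Iic r) ∂P :=
        lintegral_const_mul _ (hdirac.comp hb)

lemma ae_add_nthPoint_ne [IsFiniteMeasure P] (hξ : IsPoissonProcess P ξ (leb.withDensity h))
    {b c : Ω → ℝ≥0∞} (hb : Measurable b) (hc : Measurable c)
    (hbcξ : IndepFun (fun ω => (b ω, c ω)) ξ P) (j : ℕ) :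
    ∀ᵐ ω ∂P, c ω ≠ ⊤ → b ω + nthPoint (ξ ω) j ≠ c ω := by
  have hsum : Measurable fun z : (ℝ≥0∞ × ℝ≥0∞) × Measure ℝ≥0 => z.1.1 + nthPoint z.2 j :=
    (by fun_prop : Measurable fun z : (ℝ≥0∞ × ℝ≥0∞) × Measure ℝ≥0 => z.1.1).add
      ((measurable_nthPoint j).comp measurable_snd)
  have hms : MeasurableSet {z : (ℝ≥0∞ × ℝ≥0∞) × Measure ℝ≥0 |
      z.1.2 ≠ ⊤ → z.1.1 + nthPoint z.2 j ≠ z.1.2} :=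
    measurableSet_setOfPred.2 (((measurableSet_setOfPred.1 (measurableSet_eq_fun
      (by fun_prop) measurable_const)).not).imp
      (measurableSet_setOfPred.1 (measurableSet_eq_fun hsum (by fun_prop))).not)
  refine ae_of_indepFun hbcξ (hb.prodMk hc) hξ.measurable hms fun ⟨b, c⟩ => ?_
  have hne : ∀ᵐ ω ∂P, nthPoint (ξ ω) j ≠ (c - b).toNNReal := by
    simpa [ae_iff] using hξ.measure_nthPoint_eq_zero (x := (c - b).toNNReal)
      (withDensity_absolutelyContinuous _ _ (measure_singleton _)) j
  filter_upwards [hne] with ω hω hc heq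
  obtain ⟨hb, hx⟩ : b ≠ ⊤ ∧ nthPoint (ξ ω) j ≠ ⊤ := by
    rw [← ENNReal.add_ne_top]
    exact heq ▸ hc
  rw [← show b + nthPoint (ξ ω) j = c from heq, ENNReal.add_sub_cancel_left hb,
    ENNReal.coe_toNNReal hx] at hω
  exact hω rfl

end IsPoissonProcess

section Renewal

variable {f : ℝ≥0 → ℝ≥0}

lemma measurable_hazard (hf : Measurable f) : Measurable (hazard f) := by
  have hmono : Monotone fun t => ∫⁻ s in Iic t, (f s : ℝ≥0∞) ∂leb :=
    fun s t hst => lintegral_mono_set (Iic_subset_Iic.2 hst)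
  have := hmono.measurable
  unfold hazard
  fun_prop

lemma measurable_measure_Ici (ν : Measure ℝ≥0) : Measurable fun x => ν (Ici x) :=
  Antitone.measurable fun _ _ hxy => measure_mono (Ici_subset_Ici.2 hxy)

lemma measure_eq_zero_of_forall_Ici {ν : Measure ℝ≥0} [NullSingletonClass ν] {Z : Set ℝ≥0}
    (h : ∀ x ∈ Z, ν (Ici x) = 0) : ν Z = 0 := by
  have hsub : Z ⊆ {sInf Z} ∪ ⋃ (q : ℚ) (_ : ν (Ici (Real.toNNReal q)) = 0),
      Ici (Real.toNNReal q) := by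
    intro x hx
    rcases (csInf_le (OrderBot.bddBelow _) hx).eq_or_lt with heq | hlt
    · exact Or.inl heq.symm
    · obtain ⟨z, hz, hzx⟩ := exists_lt_of_csInf_lt ⟨x, hx⟩ hlt
      obtain ⟨q, -, hzq, hqx⟩ := (NNReal.lt_iff_exists_rat_btwn _ _).1 hzx
      exact Or.inr (mem_iUnion₂.2
        ⟨q, measure_mono_null (Ici_subset_Ici.2 hzq.le) (h z hz), hqx.le⟩)
  refine measure_mono_null hsub (measure_union_null (measure_singleton _) ?_)
  exact measure_iUnion_null fun q => measure_iUnion_null id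

instance (g : ℝ≥0 → ℝ≥0∞) : NullSingletonClass (leb.withDensity g) :=
  ⟨fun x => withDensity_absolutelyContinuous _ _ (measure_singleton x)⟩

/-- This uses that the density vanishes almost everywhere where the denominator of the hazard
function does, since the set of these points is a null set of the law. -/
lemma hazard_mul_measure_Ici (hf : Measurable f)
    [IsProbabilityMeasure (leb.withDensity fun t => (f t : ℝ≥0∞))] :
    ∀ᵐ x ∂leb, (hazard f x : ℝ≥0∞) * leb.withDensity (fun t => (f t : ℝ≥0∞)) (Ici x) = f x := by
  set ν := leb.withDensity fun t => (f t : ℝ≥0∞)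
  have hdenom (x : ℝ≥0) : 1 - ∫⁻ s in Iic x, (f s : ℝ≥0∞) ∂leb = ν (Ici x) := by
    rw [← withDensity_apply _ measurableSet_Iic, ← prob_compl_eq_one_sub measurableSet_Iic,
      compl_Iic]
    exact measure_congr Ioi_ae_eq_Ici
  have hZ : MeasurableSet {x | ν (Ici x) = 0} :=
    measurable_measure_Ici ν (measurableSet_singleton 0)
  have hfZ : ∀ᵐ x ∂leb, ν (Ici x) = 0 → (f x : ℝ≥0∞) = 0 := by
    have hνZ : ν {x | ν (Ici x) = 0} = 0 := measure_eq_zero_of_forall_Ici fun x hx => hx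
    rwa [withDensity_apply _ hZ, setLIntegral_eq_zero_iff hZ (by fun_prop)] at hνZ
  filter_upwards [hfZ] with x hx
  rw [hazard, hdenom]
  by_cases h : ν (Ici x) = 0
  · rw [h, hx h, mul_zero]
  · have hne : (ν (Ici x)).toNNReal ≠ 0 := ENNReal.toNNReal_ne_zero.2 ⟨h, measure_ne_top _ _⟩
    nth_rewrite 2 [← ENNReal.coe_toNNReal (measure_ne_top ν (Ici x))]
    rw [← ENNReal.coe_mul, div_mul_cancel₀ _ hne]

/-- The hazard rate at time `v` of a renewal epoch whose predecessor is at time `b`, given that it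
occurs at time `c`: it is zero after time `c`. -/
def hazardBetween (f : ℝ≥0 → ℝ≥0) (b c v : ℝ≥0) : ℝ≥0∞ :=
  if v ≤ c then shifted (fun x => hazard f x) b v else 0

lemma measurable_hazardBetween (hf : Measurable f) :
    Measurable fun y : ℝ≥0 × ℝ≥0 × ℝ≥0 => hazardBetween f y.1 y.2.1 y.2.2 := by
  have := measurable_hazard hf
  refine Measurable.ite (measurableSet_le (by fun_prop) (by fun_prop)) ?_ measurable_const
  exact (measurable_shifted (φ := fun x => (hazard f x : ℝ≥0∞)) (by fun_prop)).comp
    (by fun_prop : Measurable fun y : ℝ≥0 × ℝ≥0 × ℝ≥0 => ((y.1 : ℝ≥0∞), y.2.2))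

lemma measurable_setLIntegral_hazardBetween (hf : Measurable f) (s r : ℝ≥0) :
    Measurable fun y : ℝ≥0 × ℝ≥0 => ∫⁻ v in Ioc s r, hazardBetween f y.1 y.2 v ∂leb :=
  Measurable.lintegral_prod_right' (f := fun q : (ℝ≥0 × ℝ≥0) × ℝ≥0 =>
    hazardBetween f q.1.1 q.1.2 q.2) ((measurable_hazardBetween hf).comp
      (by fun_prop : Measurable fun q : (ℝ≥0 × ℝ≥0) × ℝ≥0 => (q.1.1, q.1.2, q.2)))

lemma setLIntegral_hazardBetween_of_le {b c s : ℝ≥0} (hcs : c ≤ s) (r : ℝ≥0) :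
    ∫⁻ v in Ioc s r, hazardBetween f b c v ∂leb = 0 :=
  (setLIntegral_congr_fun measurableSet_Ioc
    fun _ hv => if_neg (not_le.2 (hcs.trans_lt hv.1))).trans lintegral_zero

variable {Ω α : Type*} [MeasurableSpace Ω] [MeasurableSpace α] {P : Measure Ω}
  {τ : Ω → ℝ≥0} {Y : Ω → α}

lemma lintegral_hazardBetween (hτ : Measurable τ) (b v : ℝ≥0) :
    ∫⁻ ω, hazardBetween f b (b + τ ω) v ∂P =
      shifted (fun x => hazard f x * P.map τ (Ici x)) b v := by
  have hconst : ∫⁻ ω, hazardBetween f b (b + τ ω) v ∂P =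
      shifted (fun x => hazard f x) b v * P {ω | v ≤ b + τ ω} :=
    lintegral_indicator_const (measurableSet_le (by fun_prop) (by fun_prop)) _
  have hset : {ω | v ≤ b + τ ω} = τ ⁻¹' Ici (v - b) := by
    ext ω
    simp only [mem_ofPred_eq, mem_preimage, mem_Ici, tsub_le_iff_left]
  rw [hconst, hset, ← Measure.map_apply hτ measurableSet_Ici]
  simp only [shifted, ENNReal.toNNReal_coe, ENNReal.coe_lt_coe, ite_mul, zero_mul]

lemma lintegral_diracTop_add_waiting [IsProbabilityMeasure P] (hf : Measurable f)
    (hτ : Measurable τ) (hlaw : P.map τ = leb.withDensity fun t => (f t : ℝ≥0∞)) (b s r : ℝ≥0) :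
    ∫⁻ ω, diracTop ((b + τ ω : ℝ≥0)) (Ioc s r) ∂P =
      ∫⁻ ω, ∫⁻ v in Ioc s r, hazardBetween f b (b + τ ω) v ∂leb ∂P := by
  have : IsProbabilityMeasure (leb.withDensity fun t => (f t : ℝ≥0∞)) :=
    hlaw ▸ Measure.isProbabilityMeasure_map hτ.aemeasurable
  have := measurable_hazard hf
  set S := {x : ℝ≥0 | (b : ℝ≥0∞) + x ∈ Ioc (s : ℝ≥0∞) r}
  have hS : MeasurableSet S := measurableSet_shift b s r
  calc ∫⁻ ω, diracTop ((b + τ ω : ℝ≥0)) (Ioc s r) ∂P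
      = ∫⁻ x, S.indicator 1 x ∂P.map τ := by
        rw [lintegral_map (measurable_one.indicator hS) hτ]
        refine lintegral_congr fun ω => ?_
        rw [ENNReal.coe_add, diracTop_add_apply_Ioc, diracTop_coe, Measure.dirac_apply' _ hS]
    _ = ∫⁻ x in S, f x ∂leb := by
        rw [lintegral_indicator_one hS, hlaw, withDensity_apply _ hS]
    _ = ∫⁻ x in S, hazard f x * P.map τ (Ici x) ∂leb := by
        refine lintegral_congr_ae (ae_restrict_of_ae ?_)
        filter_upwards [hazard_mul_measure_Ici hf] with x hx
        rw [hlaw, hx]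
    _ = ∫⁻ v in Ioc s r, shifted (fun x => hazard f x * P.map τ (Ici x)) b v ∂leb :=
        setLIntegral_shift ((by fun_prop : Measurable fun x => (hazard f x : ℝ≥0∞)).mul
          (measurable_measure_Ici _)) b s r
    _ = ∫⁻ v in Ioc s r, ∫⁻ ω, hazardBetween f b (b + τ ω) v ∂P ∂leb := by
        simp_rw [lintegral_hazardBetween hτ]
    _ = ∫⁻ ω, ∫⁻ v in Ioc s r, hazardBetween f b (b + τ ω) v ∂leb ∂P :=
        lintegral_lintegral_swap ((measurable_hazardBetween hf).comp
          (by fun_prop : Measurable fun q : ℝ≥0 × Ω => (b, b + τ q.2, q.1))).aemeasurable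

/-- Both sides only see the event that the next epoch is after time `s`, where the truncated waiting
time is constant. -/
lemma lintegral_truncateWaiting_mul_diracTop [IsProbabilityMeasure P] (hf : Measurable f)
    (hτ : Measurable τ) (hlaw : P.map τ = leb.withDensity fun t => (f t : ℝ≥0∞)) (b s r : ℝ≥0)
    (φ : ℝ≥0 → ℝ≥0∞) :
    ∫⁻ ω, φ (truncateWaiting b s (τ ω)) * diracTop ((b + τ ω : ℝ≥0)) (Ioc s r) ∂P =
      ∫⁻ ω, φ (truncateWaiting b s (τ ω)) *
        ∫⁻ v in Ioc s r, hazardBetween f b (b + τ ω) v ∂leb ∂P := by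
  have hconst {F : ℝ≥0 → ℝ≥0∞} (hF : Measurable F) (hFs : ∀ x, b + x ≤ s → F x = 0) :
      ∫⁻ ω, φ (truncateWaiting b s (τ ω)) * F (τ ω) ∂P = φ (s + 1) * ∫⁻ ω, F (τ ω) ∂P := by
    rw [← lintegral_const_mul (f := fun ω => F (τ ω)) _ (hF.comp hτ)]
    refine lintegral_congr fun ω => ?_
    rw [truncateWaiting]
    split_ifs with h
    · rw [hFs _ h, mul_zero, mul_zero]
    · rfl
  rw [hconst (F := fun x => diracTop ((b + x : ℝ≥0)) (Ioc s r))
      ((measurable_diracTop_apply measurableSet_Ioc).comp (by fun_prop)) ?_,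
    hconst (F := fun x => ∫⁻ v in Ioc s r, hazardBetween f b (b + x) v ∂leb)
      ((measurable_setLIntegral_hazardBetween hf s r).comp
      (by fun_prop : Measurable fun x => (b, b + x))) ?_]
  · exact congrArg _ (lintegral_diracTop_add_waiting hf hτ hlaw b s r)
  · exact fun x hx => setLIntegral_hazardBetween_of_le hx r
  · intro x hx
    rw [diracTop_Ioc, if_neg]
    exact fun hsx => hsx.1.not_ge (by exact_mod_cast hx)

lemma lintegral_next_epoch [IsProbabilityMeasure P] (hf : Measurable f) (hτ : Measurable τ)
    (hlaw : P.map τ = leb.withDensity fun t => (f t : ℝ≥0∞)) (hY : Measurable Y)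
    (hYτ : IndepFun Y τ P) {b : α → ℝ≥0} (hb : Measurable b) {φ : α × ℝ≥0 → ℝ≥0∞}
    (hφ : Measurable φ) (s r : ℝ≥0) :
    ∫⁻ ω, φ (Y ω, truncateWaiting (b (Y ω)) s (τ ω)) *
        diracTop ((b (Y ω) + τ ω : ℝ≥0)) (Ioc s r) ∂P =
      ∫⁻ ω, φ (Y ω, truncateWaiting (b (Y ω)) s (τ ω)) *
        ∫⁻ v in Ioc s r, hazardBetween f (b (Y ω)) (b (Y ω) + τ ω) v ∂leb ∂P := by
  have hφm : Measurable (Function.uncurry fun (y : α) (x : ℝ≥0) =>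
      φ (y, truncateWaiting (b y) s x)) :=
    hφ.comp (measurable_fst.prodMk (Measurable.ite
      (measurableSet_le (by fun_prop) (by fun_prop)) measurable_snd measurable_const))
  have hdirac : Measurable (Function.uncurry fun (y : α) (x : ℝ≥0) =>
      diracTop ((b y + x : ℝ≥0)) (Ioc s r)) :=
    (measurable_diracTop_apply measurableSet_Ioc).comp (by fun_prop)
  have hhazard : Measurable (Function.uncurry fun (y : α) (x : ℝ≥0) =>
      ∫⁻ v in Ioc s r, hazardBetween f (b y) (b y + x) v ∂leb) :=
    (measurable_setLIntegral_hazardBetween hf s r).comp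
      (by fun_prop : Measurable fun q : α × ℝ≥0 => (b q.1, b q.1 + q.2))
  rw [lintegral_comp_of_indepFun hYτ hY hτ (g := fun y x =>
      φ (y, truncateWaiting (b y) s x) * diracTop ((b y + x : ℝ≥0)) (Ioc s r)) (hφm.mul hdirac),
    lintegral_comp_of_indepFun hYτ hY hτ (g := fun y x => φ (y, truncateWaiting (b y) s x) *
      ∫⁻ v in Ioc s r, hazardBetween f (b y) (b y + x) v ∂leb) (hφm.mul hhazard)]
  exact lintegral_congr fun ω => lintegral_truncateWaiting_mul_diracTop hf hτ hlaw (b (Y ω)) s r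
    fun x => φ (Y ω, x)

lemma ae_pos_of_map_singleton_eq_zero (hτ : Measurable τ) (h : P.map τ {0} = 0) :
    ∀ᵐ ω ∂P, 0 < τ ω := by
  rw [Measure.map_apply hτ (measurableSet_singleton 0)] at h
  simp only [ae_iff, pos_iff_ne_zero, ne_eq, not_not]
  exact h

lemma lintegral_exp_neg_lt_one [IsProbabilityMeasure P] (hτ : ∀ᵐ ω ∂P, 0 < τ ω) :
    ∫⁻ ω, ENNReal.ofReal (Real.exp (-τ ω)) ∂P < 1 := by
  have hle : ∫⁻ ω, ENNReal.ofReal (Real.exp (-τ ω)) ∂P ≤ ∫⁻ _, 1 ∂P :=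
    lintegral_mono fun ω => by simp
  have hone : ∫⁻ _, 1 ∂P = 1 := by simp
  refine (lintegral_strict_mono (IsProbabilityMeasure.ne_zero P) aemeasurable_const
    (ne_top_of_le_ne_top ENNReal.one_ne_top (hle.trans hone.le)) ?_).trans_eq hone
  filter_upwards [hτ] with ω hω
  simpa using hω

section Epochs

variable {τ : ℕ → Ω → ℝ≥0} {ν : Measure ℝ≥0}

lemma diracTop_epoch_Iic_le {Ω : Type*} (τ : ℕ → Ω → ℝ≥0) (i : ℕ) (r : ℝ≥0) (ω : Ω) :
    diracTop (epoch τ i ω) (Iic r) ≤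
      ENNReal.ofReal (Real.exp r) * ∏ k ∈ Finset.range i, ENNReal.ofReal (Real.exp (-τ k ω)) := by
  rw [diracTop_Iic]
  split_ifs with h
  · have hsum : ∑ k ∈ Finset.range i, (τ k ω : ℝ) ≤ r := by
      rw [ENNReal.coe_le_coe, epoch] at h
      exact_mod_cast h
    rw [← ENNReal.ofReal_prod_of_nonneg fun _ _ => (Real.exp_pos _).le, ← Real.exp_sum,
      ← ENNReal.ofReal_mul (Real.exp_pos _).le, ← Real.exp_add, ENNReal.one_le_ofReal,
      Real.one_le_exp_iff, Finset.sum_neg_distrib]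
    linarith
  · exact zero_le

lemma tsum_epoch_lt_top [IsProbabilityMeasure P] (hτ : ∀ i, Measurable (τ i))
    (hindep : iIndepFun τ P) (hlaw : ∀ i, P.map (τ i) = ν) (hν : ν {0} = 0) (r : ℝ≥0) :
    ∑' i, ∫⁻ ω, diracTop (epoch τ i ω) (Iic r) ∂P < ⊤ := by
  let e : ℝ≥0 → ℝ≥0∞ := fun x => ENNReal.ofReal (Real.exp (-x))
  have he : Measurable e := by fun_prop
  set ρ := ∫⁻ x, e x ∂ν
  have hρ_eq (i : ℕ) : ∫⁻ ω, e (τ i ω) ∂P = ρ := by rw [← lintegral_map he (hτ i), hlaw i]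
  have hρ : ρ < 1 := hρ_eq 0 ▸
    lintegral_exp_neg_lt_one (ae_pos_of_map_singleton_eq_zero (hτ 0) (hlaw 0 ▸ hν))
  have hle (i : ℕ) : ∫⁻ ω, diracTop (epoch τ i ω) (Iic r) ∂P ≤
      ENNReal.ofReal (Real.exp r) * ρ ^ i :=
    calc ∫⁻ ω, diracTop (epoch τ i ω) (Iic r) ∂P
        ≤ ∫⁻ ω, ENNReal.ofReal (Real.exp r) * ∏ k ∈ Finset.range i, e (τ k ω) ∂P :=
          lintegral_mono fun ω => diracTop_epoch_Iic_le τ i r ω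
      _ = ENNReal.ofReal (Real.exp r) * ∏ k ∈ Finset.range i, ∫⁻ ω, e (τ k ω) ∂P := by
          rw [lintegral_const_mul (f := fun ω => ∏ k ∈ Finset.range i, e (τ k ω)) _
              (Finset.measurable_fun_prod _ fun k _ => he.comp (hτ k)),
            lintegral_prod_eq_prod_lintegral_of_indepFun (Finset.range i) (fun k ω => e (τ k ω))
              (hindep.comp (fun _ => e) fun _ => he) fun k => he.comp (hτ k)]
      _ = ENNReal.ofReal (Real.exp r) * ρ ^ i := by simp [hρ_eq]
  refine (ENNReal.tsum_le_tsum hle).trans_lt ?_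
  rw [ENNReal.tsum_mul_left, ENNReal.tsum_geometric]
  exact ENNReal.mul_lt_top ENNReal.ofReal_lt_top (ENNReal.inv_lt_top.2 (tsub_pos_of_lt hρ))

end Epochs

end Renewal

lemma lintegral_tsum_add_tsum {α ι κ : Type*} [Countable ι] [Countable κ] [MeasurableSpace α]
    {μ : Measure α} {X : ι → α → ℝ≥0∞} {Y : κ → α → ℝ≥0∞} (hX : ∀ i, Measurable (X i))
    (hY : ∀ k, Measurable (Y k)) :
    ∫⁻ a, (∑' i, X i a + ∑' k, Y k a) ∂μ = ∑' i, ∫⁻ a, X i a ∂μ + ∑' k, ∫⁻ a, Y k a ∂μ := by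
  rw [lintegral_add_left (Measurable.tsum hX), lintegral_tsum fun i => (hX i).aemeasurable,
    lintegral_tsum fun k => (hY k).aemeasurable]

lemma lintegral_mul_tsum_add_tsum {α ι κ : Type*} [Countable ι] [Countable κ] [MeasurableSpace α]
    {μ : Measure α} {g : α → ℝ≥0∞} {X : ι → α → ℝ≥0∞} {Y : κ → α → ℝ≥0∞} (hg : Measurable g)
    (hX : ∀ i, Measurable (X i)) (hY : ∀ k, Measurable (Y k)) :
    ∫⁻ a, g a * (∑' i, X i a + ∑' k, Y k a) ∂μ =
      ∑' i, ∫⁻ a, g a * X i a ∂μ + ∑' k, ∫⁻ a, g a * Y k a ∂μ := by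
  simp_rw [mul_add, ← ENNReal.tsum_mul_left]
  exact lintegral_tsum_add_tsum (fun i => hg.mul (hX i)) fun k => hg.mul (hY k)

section ClusterModel

variable {Ω : Type*}

/-- The renewal cluster model with inter-immigrant density `f` and offspring density `h`: the
waiting times `τ` and the offspring processes `ξ` have the prescribed laws, and all of them are
independent. -/
structure IsClusterModel [MeasurableSpace Ω] (P : Measure Ω) (f h : ℝ≥0 → ℝ≥0)
    (τ : ℕ → Ω → ℝ≥0) (ξ : ℕ × List ℕ → Ω → Measure ℝ≥0) : Prop where
  measurable_f : Measurable f
  measurable_h : Measurable h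
  subcritical : ∫⁻ t, (h t : ℝ≥0∞) ∂leb < 1
  measurable_waiting : ∀ i, Measurable (τ i)
  indep_waiting : iIndepFun τ P
  law_waiting : ∀ i, P.map (τ i) = leb.withDensity fun t => (f t : ℝ≥0∞)
  offspring : ∀ l, IsPoissonProcess P (ξ l) (leb.withDensity fun t => (h t : ℝ≥0∞))
  indep_offspring : iIndepFun ξ P
  indep : IndepFun (fun ω i => τ i ω) (fun ω l => ξ l ω) P

/-- The data of the model with the children of the individual `l` removed. -/
def withoutChildren (τ : ℕ → Ω → ℝ≥0) (ξ : ℕ × List ℕ → Ω → Measure ℝ≥0) (l : ℕ × List ℕ)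
    (ω : Ω) : (ℕ → ℝ≥0) × (ℕ × List ℕ → ℕ → ℝ≥0∞) :=
  (fun k => τ k ω, Function.update (fun l' => nthPoint (ξ l' ω)) l (nthPoint 0))

/-- The data of the model with the `i`-th waiting time removed. -/
def withoutWaiting (τ : ℕ → Ω → ℝ≥0) (ξ : ℕ × List ℕ → Ω → Measure ℝ≥0) (i : ℕ) (ω : Ω) :
    (ℕ × List ℕ → ℕ → ℝ≥0∞) × (ℕ → ℝ≥0) :=
  (fun l => nthPoint (ξ l ω), Function.update (fun k => τ k ω) i 0)

/-- The intensity of the cluster process, as the sum of the hazard rates of the renewal epochs and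
of the intensities of the offspring processes of all individuals. -/
def sumIntensity (f h : ℝ≥0 → ℝ≥0) (τ : ℕ → Ω → ℝ≥0) (ξ : ℕ × List ℕ → Ω → Measure ℝ≥0)
    (v : ℝ≥0) (ω : Ω) : ℝ≥0∞ :=
  ∑' i, hazardBetween f (epoch τ i ω) (epoch τ (i + 1) ω) v +
    ∑' l : ℕ × List ℕ, shifted (fun x => h x) (birth τ ξ l.1 l.2 ω) v

variable {τ : ℕ → Ω → ℝ≥0} {ξ : ℕ × List ℕ → Ω → Measure ℝ≥0}

lemma birthOf_withoutChildren (l : ℕ × List ℕ) (i : ℕ) {u : List ℕ}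
    (hu : u.length ≤ l.2.length) (ω : Ω) :
    birthOf (withoutChildren τ ξ l ω).1 (withoutChildren τ ξ l ω).2 i u = birth τ ξ i u ω := by
  rw [withoutChildren, birthOf_update_children _ _ _ _ _ hu, birth_eq_birthOf]

lemma birthOf_withoutChildren_cons (l : ℕ × List ℕ) (i j : ℕ) {u : List ℕ}
    (hu : u.length ≤ l.2.length) (hne : (i, u) ≠ l) (ω : Ω) :
    birthOf (withoutChildren τ ξ l ω).1 (withoutChildren τ ξ l ω).2 i (j :: u) =
      birth τ ξ i (j :: u) ω := by
  rw [birthOf, birthOf_withoutChildren l i hu, birth]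
  simp only [withoutChildren, Function.update_of_ne hne]

lemma clusterProcess_Ioc_eq (hξ : ∀ l ω, IsCountingMeasure (ξ l ω)) (ω : Ω) (s r : ℝ≥0) :
    clusterProcess τ ξ ω (Ioc s r) =
      ∑' i, diracTop (epoch τ (i + 1) ω) (Ioc s r) +
        ∑' l : ℕ × List ℕ, ∑' j, diracTop (birth τ ξ l.1 (j :: l.2) ω) (Ioc s r) := by
  classical
  have htree (i : ℕ) : ∑' u, diracTop (birth τ ξ i u ω) (Ioc s r) =
      diracTop (epoch τ i ω) (Ioc s r) +
        ∑' (u : List ℕ) (j : ℕ), diracTop (birth τ ξ i (j :: u) ω) (Ioc s r) := by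
    rw [ENNReal.tsum_eq_add_tsum_ite [], tsum_list_cons (by simp)]
    simp [birth]
  have hfirst : diracTop (epoch τ 0 ω) (Ioc s r) = 0 := by simp [diracTop_Ioc, epoch]
  rw [clusterProcess_eq_sum hξ, Measure.sum_apply _ measurableSet_Ioc, ENNReal.tsum_prod',
    ENNReal.tsum_prod' (f := fun l : ℕ × List ℕ =>
      ∑' j, diracTop (birth τ ξ l.1 (j :: l.2) ω) (Ioc s r))]
  simp_rw [htree]
  rw [ENNReal.tsum_add, tsum_eq_zero_add' ENNReal.summable, hfirst, zero_add]

namespace IsClusterModel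

variable [MeasurableSpace Ω] {P : Measure Ω} {f h : ℝ≥0 → ℝ≥0}

section Measurability

lemma counting (hM : IsClusterModel P f h τ ξ) (l : ℕ × List ℕ) (ω : Ω) :
    IsCountingMeasure (ξ l ω) := (hM.offspring l).counting ω

lemma lintegral_h_ne_top (hM : IsClusterModel P f h τ ξ) : ∫⁻ t, (h t : ℝ≥0∞) ∂leb ≠ ⊤ :=
  (hM.subcritical.trans ENNReal.one_lt_top).ne

lemma measurable_waitings (hM : IsClusterModel P f h τ ξ) : Measurable fun ω i => τ i ω :=
  measurable_pi_lambda _ hM.measurable_waiting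

lemma measurable_offspringPoints (hM : IsClusterModel P f h τ ξ) :
    Measurable fun ω l => nthPoint (ξ l ω) :=
  measurable_pi_lambda _ fun l => measurable_nthPoints.comp (hM.offspring l).measurable

lemma measurable_birth (hM : IsClusterModel P f h τ ξ) (i : ℕ) (u : List ℕ) :
    Measurable (birth τ ξ i u) := by
  rw [funext fun ω => birth_eq_birthOf τ ξ i u ω]
  exact (measurable_birthOf i u).comp (hM.measurable_waitings.prodMk hM.measurable_offspringPoints)

lemma measurable_epoch (hM : IsClusterModel P f h τ ξ) (i : ℕ) : Measurable (epoch τ i) :=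
  Finset.measurable_fun_sum _ fun k _ => hM.measurable_waiting k

lemma measurable_historyProcess (hM : IsClusterModel P f h τ ξ) (s : ℝ≥0) :
    Measurable (historyProcess τ ξ s) :=
  (measurable_history s).comp (hM.measurable_waitings.prodMk hM.measurable_offspringPoints)

lemma naturalSigma_le (hM : IsClusterModel P f h τ ξ) (s : ℝ≥0) :
    naturalSigma τ ξ s ≤ ‹MeasurableSpace Ω› :=
  (naturalSigma_le_comap hM.counting s).trans (hM.measurable_historyProcess s).comap_le

lemma measurable_withoutChildren (hM : IsClusterModel P f h τ ξ) (l : ℕ × List ℕ) :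
    Measurable (withoutChildren τ ξ l) :=
  hM.measurable_waitings.prodMk (measurable_update_left.comp hM.measurable_offspringPoints)

lemma measurable_withoutWaiting (hM : IsClusterModel P f h τ ξ) (i : ℕ) :
    Measurable (withoutWaiting τ ξ i) :=
  hM.measurable_offspringPoints.prodMk (measurable_update_left.comp hM.measurable_waitings)

lemma measurable_epochIntensity (hM : IsClusterModel P f h τ ξ) (i : ℕ) :
    Measurable fun y : Ω × ℝ≥0 => hazardBetween f (epoch τ i y.1) (epoch τ (i + 1) y.1) y.2 := by
  have := hM.measurable_epoch i
  have := hM.measurable_epoch (i + 1)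
  exact (measurable_hazardBetween hM.measurable_f).comp
    (by fun_prop : Measurable fun y : Ω × ℝ≥0 => (epoch τ i y.1, epoch τ (i + 1) y.1, y.2))

lemma measurable_offspringIntensity (hM : IsClusterModel P f h τ ξ) (l : ℕ × List ℕ) :
    Measurable fun y : Ω × ℝ≥0 => shifted (fun x => h x) (birth τ ξ l.1 l.2 y.1) y.2 := by
  have := hM.measurable_birth l.1 l.2
  have := hM.measurable_h
  exact (measurable_shifted (φ := fun x => h x) (by fun_prop)).comp
    (by fun_prop : Measurable fun y : Ω × ℝ≥0 => (birth τ ξ l.1 l.2 y.1, y.2))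

end Measurability

section Independence

variable [IsProbabilityMeasure P]

lemma indepFun_withoutChildren (hM : IsClusterModel P f h τ ξ) (l : ℕ × List ℕ) :
    IndepFun (withoutChildren τ ξ l) (ξ l) P := by
  have hξ : Measurable fun ω l => ξ l ω :=
    measurable_pi_lambda _ fun l => (hM.offspring l).measurable
  have hwaiting : IndepFun (fun ω i => τ i ω)
      (fun ω => (ξ l ω, Function.update (fun l => ξ l ω) l 0)) P :=
    hM.indep.comp measurable_id ((measurable_pi_apply l).prodMk measurable_update_left)
  have hindep := indepFun_prodMk_of_indepFun
    (indepFun_update hM.indep_offspring (fun l => (hM.offspring l).measurable) l 0) hwaiting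
    (hM.offspring l).measurable (measurable_update_left.comp hξ) hM.measurable_waitings
  have hpoints : Measurable fun y : (ℕ → ℝ≥0) × (ℕ × List ℕ → Measure ℝ≥0) =>
      (y.1, fun l => nthPoint (y.2 l)) :=
    measurable_fst.prodMk (measurable_pi_lambda _ fun l =>
      measurable_nthPoints.comp ((measurable_pi_apply l).comp measurable_snd))
  convert! hindep.comp hpoints measurable_id using 1
  funext ω
  refine Prod.ext rfl (funext fun l' => ?_)
  by_cases hl : l' = l
  · subst hl; simp [withoutChildren]
  · simp [withoutChildren, hl]

lemma indepFun_withoutWaiting (hM : IsClusterModel P f h τ ξ) (i : ℕ) :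
    IndepFun (withoutWaiting τ ξ i) (τ i) P := by
  have hpoints : Measurable fun (ν : ℕ × List ℕ → Measure ℝ≥0) l => nthPoint (ν l) :=
    measurable_pi_lambda _ fun l => measurable_nthPoints.comp (measurable_pi_apply l)
  have hoffspring : IndepFun (fun ω l => nthPoint (ξ l ω))
      (fun ω => (τ i ω, Function.update (fun k => τ k ω) i 0)) P :=
    (hM.indep.comp ((measurable_pi_apply i).prodMk measurable_update_left) hpoints).symm
  exact indepFun_prodMk_of_indepFun (indepFun_update hM.indep_waiting hM.measurable_waiting i 0)
    hoffspring (hM.measurable_waiting i) (measurable_update_left.comp hM.measurable_waitings)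
    hM.measurable_offspringPoints

end Independence

section Compensator

variable [IsProbabilityMeasure P] {A : Set Ω}

lemma lintegral_offspring (hM : IsClusterModel P f h τ ξ) (s r : ℝ≥0)
    (hA : MeasurableSet[naturalSigma τ ξ s] A) (l : ℕ × List ℕ) :
    ∫⁻ ω, A.indicator 1 ω * ∑' j, diracTop (birth τ ξ l.1 (j :: l.2) ω) (Ioc s r) ∂P =
      ∫⁻ ω, A.indicator 1 ω *
        ∫⁻ v in Ioc s r, shifted (fun x => h x) (birth τ ξ l.1 l.2 ω) v ∂leb ∂P := by
  obtain ⟨A', hA', rfl⟩ := naturalSigma_le_comap hM.counting s A hA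
  have := hM.measurable_h
  have hφ : Measurable fun y : ((ℕ → ℝ≥0) × (ℕ × List ℕ → ℕ → ℝ≥0∞)) × (ℕ → ℝ≥0∞) =>
      A'.indicator (1 : (ℕ × List ℕ → ℝ≥0∞) → ℝ≥0∞)
        (history s y.1.1 (Function.update y.1.2 l y.2)) :=
    (measurable_one.indicator hA').comp ((measurable_history s).comp
      ((measurable_fst.comp measurable_fst).prodMk
        (measurable_update'.comp ((measurable_snd.comp measurable_fst).prodMk measurable_snd))))
  have hchildren := (hM.offspring l).lintegral_children (by fun_prop) hM.lintegral_h_ne_top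
    (hM.measurable_withoutChildren l) (hM.indepFun_withoutChildren l)
    (measurable_birthOf l.1 l.2) hφ s r
  have hhistory (ω : Ω) : history s (withoutChildren τ ξ l ω).1
      (Function.update (withoutChildren τ ξ l ω).2 l
        (truncate (birth τ ξ l.1 l.2 ω) s (nthPoint (ξ l ω)))) = historyProcess τ ξ s ω := by
    rw [withoutChildren, Function.update_idem, birth_eq_birthOf]
    exact history_update_truncate s _ (fun l => nthPoint (ξ l ω)) l
  simp only [birthOf_withoutChildren l l.1 le_rfl, hhistory] at hchildren
  exact hchildren

lemma lintegral_epoch (hM : IsClusterModel P f h τ ξ) (s r : ℝ≥0)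
    (hA : MeasurableSet[naturalSigma τ ξ s] A) (i : ℕ) :
    ∫⁻ ω, A.indicator 1 ω * diracTop (epoch τ (i + 1) ω) (Ioc s r) ∂P =
      ∫⁻ ω, A.indicator 1 ω *
        ∫⁻ v in Ioc s r, hazardBetween f (epoch τ i ω) (epoch τ (i + 1) ω) v ∂leb ∂P := by
  obtain ⟨A', hA', rfl⟩ := naturalSigma_le_comap hM.counting s A hA
  have hφ : Measurable fun y : ((ℕ × List ℕ → ℕ → ℝ≥0∞) × (ℕ → ℝ≥0)) × ℝ≥0 =>
      A'.indicator (1 : (ℕ × List ℕ → ℝ≥0∞) → ℝ≥0∞)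
        (history s (Function.update y.1.2 i y.2) y.1.1) :=
    (measurable_one.indicator hA').comp ((measurable_history s).comp
      ((measurable_update'.comp ((measurable_snd.comp measurable_fst).prodMk measurable_snd)).prodMk
        (measurable_fst.comp measurable_fst)))
  have hnext := lintegral_next_epoch hM.measurable_f (hM.measurable_waiting i) (hM.law_waiting i)
    (hM.measurable_withoutWaiting i) (hM.indepFun_withoutWaiting i)
    (b := fun y => ∑ k ∈ Finset.range i, y.2 k) (by fun_prop) hφ s r
  have hepoch (ω : Ω) : ∑ k ∈ Finset.range i, (withoutWaiting τ ξ i ω).2 k = epoch τ i ω :=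
    Finset.sum_congr rfl fun k hk =>
      Function.update_of_ne (Finset.mem_range.1 hk).ne 0 fun k => τ k ω
  have hhistory (ω : Ω) : history s (Function.update (withoutWaiting τ ξ i ω).2 i
      (truncateWaiting (epoch τ i ω) s (τ i ω))) (withoutWaiting τ ξ i ω).1 =
      historyProcess τ ξ s ω := by
    rw [withoutWaiting, Function.update_idem]
    exact history_update_truncateWaiting s (fun k => τ k ω) _ i
  have hsucc (ω : Ω) : epoch τ i ω + τ i ω = epoch τ (i + 1) ω :=
    (Finset.sum_range_succ _ _).symm
  simp only [hepoch, hhistory, hsucc] at hnext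
  exact hnext

lemma lintegral_clusterProcess (hM : IsClusterModel P f h τ ξ) (s r : ℝ≥0)
    (hA : MeasurableSet[naturalSigma τ ξ s] A) :
    ∫⁻ ω, A.indicator 1 ω * clusterProcess τ ξ ω (Ioc s r) ∂P =
      ∫⁻ ω, A.indicator 1 ω * ∫⁻ v in Ioc s r, sumIntensity f h τ ξ v ω ∂leb ∂P := by
  have hA_meas : Measurable (A.indicator (1 : Ω → ℝ≥0∞)) :=
    measurable_one.indicator (hM.naturalSigma_le s A hA)
  have hepoch (i : ℕ) : Measurable fun ω => diracTop (epoch τ (i + 1) ω) (Ioc s r) :=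
    (measurable_diracTop_apply measurableSet_Ioc).comp
      (hM.measurable_epoch (i + 1)).coe_nnreal_ennreal
  have hchildren (l : ℕ × List ℕ) :
      Measurable fun ω => ∑' j, diracTop (birth τ ξ l.1 (j :: l.2) ω) (Ioc s r) :=
    Measurable.tsum fun j => (measurable_diracTop_apply measurableSet_Ioc).comp
      (hM.measurable_birth l.1 (j :: l.2))
  have hsum (ω : Ω) : ∫⁻ v in Ioc s r, sumIntensity f h τ ξ v ω ∂leb =
      ∑' i, ∫⁻ v in Ioc s r, hazardBetween f (epoch τ i ω) (epoch τ (i + 1) ω) v ∂leb +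
      ∑' l : ℕ × List ℕ, ∫⁻ v in Ioc s r,
        shifted (fun x => h x) (birth τ ξ l.1 l.2 ω) v ∂leb :=
    lintegral_tsum_add_tsum
      (fun i => (hM.measurable_epochIntensity i).comp measurable_prodMk_left)
      fun l => (hM.measurable_offspringIntensity l).comp measurable_prodMk_left
  simp_rw [clusterProcess_Ioc_eq hM.counting, hsum]
  rw [lintegral_mul_tsum_add_tsum hA_meas hepoch hchildren,
    lintegral_mul_tsum_add_tsum hA_meas
      (fun i => (hM.measurable_epochIntensity i).lintegral_prod_right')
      fun l => (hM.measurable_offspringIntensity l).lintegral_prod_right']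
  exact congrArg₂ _ (tsum_congr fun i => hM.lintegral_epoch s r hA i)
    (tsum_congr fun l => hM.lintegral_offspring s r hA l)

end Compensator

end IsClusterModel

end ClusterModel

lemma exists_nat_eq_tsum {ι : Type*} {a : ι → ℝ≥0∞} (h01 : ∀ i, a i = 0 ∨ a i = 1)
    (h : ∑' i, a i ≠ ⊤) : ∃ k : ℕ, ∑' i, a i = k := by
  have hfin := ENNReal.finite_const_le_of_tsum_ne_top h one_ne_zero
  refine ⟨hfin.toFinset.card, ?_⟩
  rw [tsum_eq_sum (s := hfin.toFinset), Finset.card_eq_sum_ones, Nat.cast_sum]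
  · refine Finset.sum_congr rfl fun i hi => ?_
    rcases h01 i with h0 | h1
    · simp [h0] at hi
    · simpa using h1
  · intro i hi
    rcases h01 i with h0 | h1
    · exact h0
    · simp [h1] at hi

lemma diracTop_apply_eq_zero_or_one (x : ℝ≥0∞) {B : Set ℝ≥0} (hB : MeasurableSet B) :
    diracTop x B = 0 ∨ diracTop x B = 1 := by
  rw [diracTop_apply _ hB]
  exact indicator_eq_zero_or_self _ _ _

lemma lintegral_Iio_of_eq_sum {ι : Type*} {ν : Measure ℝ≥0} {b : ι → ℝ≥0∞}
    (hν : ν = Measure.sum fun i => diracTop (b i)) {h : ℝ≥0 → ℝ≥0} (hh : Measurable h) (t : ℝ≥0) :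
    ∫⁻ x in Iio t, (h (t - x) : ℝ≥0∞) ∂ν = ∑' i, shifted (fun x => h x) (b i) t := by
  rw [hν, ← lintegral_indicator measurableSet_Iio, lintegral_sum_measure]
  refine tsum_congr fun i => ?_
  rw [lintegral_diracTop _ (Measurable.indicator (by fun_prop) measurableSet_Iio), shifted]
  induction b i with
  | top => simp
  | coe b => simp [indicator_apply]

section Branching

variable {α : Type*} {e : List α → ℝ≥0∞} {c : ℝ≥0∞}

lemma tsum_length_eq_le_pow_mul (hchild : ∀ u, ∑' j, e (j :: u) ≤ c * e u) (n : ℕ) :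
    ∑' u : List α, (if u.length = n then e u else 0) ≤ c ^ n * e [] := by
  induction n with
  | zero =>
    rw [pow_zero, one_mul, tsum_eq_single [] fun u hu => by simp [hu]]
    simp
  | succ n ih =>
    calc ∑' u : List α, (if u.length = n + 1 then e u else 0)
        = ∑' (u : List α) (j : α), (if u.length = n then e (j :: u) else 0) := by
          rw [tsum_list_cons (by simp)]
          simp
      _ ≤ ∑' u : List α, c * (if u.length = n then e u else 0) := by
          refine ENNReal.tsum_le_tsum fun u => ?_
          split_ifs
          · exact hchild u
          · simp
      _ = c * ∑' u : List α, (if u.length = n then e u else 0) := ENNReal.tsum_mul_left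
      _ ≤ c * (c ^ n * e []) := by gcongr
      _ = c ^ (n + 1) * e [] := by ring

lemma tsum_list_le_inv_one_sub_mul (hchild : ∀ u, ∑' j, e (j :: u) ≤ c * e u) :
    ∑' u, e u ≤ (1 - c)⁻¹ * e [] :=
  calc ∑' u, e u = ∑' (n : ℕ) (u : List α), (if u.length = n then e u else 0) := by
        rw [ENNReal.tsum_comm]
        refine tsum_congr fun u => ?_
        rw [tsum_eq_single u.length fun n hn => if_neg hn.symm, if_pos rfl]
    _ ≤ ∑' n, c ^ n * e [] := ENNReal.tsum_le_tsum fun n => tsum_length_eq_le_pow_mul hchild n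
    _ = (1 - c)⁻¹ * e [] := by rw [ENNReal.tsum_mul_right, ENNReal.tsum_geometric]

end Branching

section Regularity

variable {Ω : Type*} {τ : ℕ → Ω → ℝ≥0} {ξ : ℕ × List ℕ → Ω → Measure ℝ≥0}

/-- The realizations in which the cluster process is locally finite and simple and the epochs are
strictly increasing. The first two fields are the labelled descriptions of the processes, which hold
wherever the offspring processes are counting measures. -/
structure IsRegular (τ : ℕ → Ω → ℝ≥0) (ξ : ℕ × List ℕ → Ω → Measure ℝ≥0) (ω : Ω) : Prop where
  eq_sum : clusterProcess τ ξ ω =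
    Measure.sum fun v : ℕ × List ℕ => diracTop (birth τ ξ v.1 v.2 ω)
  generation_zero : generation τ ξ 0 ω = Measure.sum fun k => diracTop (epoch τ k ω)
  finite : ∀ r, clusterProcess τ ξ ω (Iic r) ≠ ⊤
  birth_ne : ∀ v v' : ℕ × List ℕ, v ≠ v' → birth τ ξ v.1 v.2 ω ≠ ⊤ →
    birth τ ξ v.1 v.2 ω ≠ birth τ ξ v'.1 v'.2 ω
  epoch_lt : ∀ k, epoch τ k ω < epoch τ (k + 1) ω

namespace IsClusterModel

variable [MeasurableSpace Ω] {P : Measure Ω} {f h : ℝ≥0 → ℝ≥0}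

lemma measurable_clusterProcess (hM : IsClusterModel P f h τ ξ) :
    Measurable (clusterProcess τ ξ) := by
  refine Measure.measurable_of_measurable_coe _ fun B hB => ?_
  simp_rw [clusterProcess_eq_sum hM.counting, Measure.sum_apply _ hB]
  exact Measurable.tsum fun v =>
    (measurable_diracTop_apply hB).comp (hM.measurable_birth v.1 v.2)

lemma generation_zero_eq_sum (hM : IsClusterModel P f h τ ξ) (ω : Ω) :
    generation τ ξ 0 ω = Measure.sum fun k => diracTop (epoch τ k ω) := by
  ext B hB
  rw [generation_eq_sum hM.counting, Measure.sum_apply _ hB, Measure.sum_apply _ hB,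
    ENNReal.tsum_prod']
  refine tsum_congr fun i => ?_
  rw [tsum_eq_single [] fun u hu => by simp [hu]]
  simp [birth]

lemma ae_epoch_lt (hM : IsClusterModel P f h τ ξ) :
    ∀ᵐ ω ∂P, ∀ k, epoch τ k ω < epoch τ (k + 1) ω := by
  refine ae_all_iff.2 fun k => ?_
  filter_upwards [ae_pos_of_map_singleton_eq_zero (hM.measurable_waiting k)
    (by rw [hM.law_waiting k, measure_singleton])] with ω hω
  rw [epoch, epoch, Finset.sum_range_succ]
  exact lt_add_of_pos_right _ hω

lemma ae_birth_siblings_ne (hM : IsClusterModel P f h τ ξ) (i : ℕ) (u : List ℕ) {j j' : ℕ}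
    (hj : j ≠ j') :
    ∀ᵐ ω ∂P, birth τ ξ i (j :: u) ω ≠ ⊤ → birth τ ξ i (j :: u) ω ≠ birth τ ξ i (j' :: u) ω := by
  filter_upwards [(hM.offspring (i, u)).ae_simple hM.lintegral_h_ne_top] with ω hω htop heq
  rw [birth, birth] at heq
  rw [birth, ENNReal.add_ne_top] at htop
  exact hω j j' hj htop.2 ((ENNReal.add_right_inj htop.1).1 heq)

variable [IsProbabilityMeasure P]

lemma indepFun_birth_of_unchanged (hM : IsClusterModel P f h τ ξ) (l v : ℕ × List ℕ)
    (hv : ∀ ω, birthOf (withoutChildren τ ξ l ω).1 (withoutChildren τ ξ l ω).2 v.1 v.2 =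
      birth τ ξ v.1 v.2 ω) :
    IndepFun (fun ω => (birth τ ξ l.1 l.2 ω, birth τ ξ v.1 v.2 ω)) (ξ l) P := by
  have hindep := (hM.indepFun_withoutChildren l).comp
    ((measurable_birthOf l.1 l.2).prodMk (measurable_birthOf v.1 v.2)) measurable_id
  convert! hindep using 1
  exact funext fun ω => Prod.ext (birthOf_withoutChildren l l.1 le_rfl ω).symm (hv ω).symm

lemma lintegral_clusterProcess_Iic_lt_top (hM : IsClusterModel P f h τ ξ) (r : ℝ≥0) :
    ∫⁻ ω, clusterProcess τ ξ ω (Iic r) ∂P < ⊤ := by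
  have hmeas (v : ℕ × List ℕ) : Measurable fun ω => diracTop (birth τ ξ v.1 v.2 ω) (Iic r) :=
    (measurable_diracTop_apply measurableSet_Iic).comp (hM.measurable_birth v.1 v.2)
  let e : ℕ → List ℕ → ℝ≥0∞ := fun i u => ∫⁻ ω, diracTop (birth τ ξ i u ω) (Iic r) ∂P
  have hchild (i : ℕ) (u : List ℕ) :
      ∑' j, e i (j :: u) ≤ (∫⁻ t, (h t : ℝ≥0∞) ∂leb) * e i u := by
    rw [← lintegral_tsum fun j => (hmeas (i, j :: u)).aemeasurable]
    exact (hM.offspring (i, u)).lintegral_children_le hM.lintegral_h_ne_top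
      (hM.measurable_birth i u) ((hM.indepFun_birth_of_unchanged (i, u) (i, u)
        (birthOf_withoutChildren _ i le_rfl)).comp measurable_fst measurable_id) r
  have hN : ∫⁻ ω, clusterProcess τ ξ ω (Iic r) ∂P = ∑' i, ∑' u, e i u := by
    simp_rw [clusterProcess_eq_sum hM.counting, Measure.sum_apply _ measurableSet_Iic]
    rw [lintegral_tsum fun v => (hmeas v).aemeasurable]
    exact ENNReal.tsum_prod' (f := fun v : ℕ × List ℕ => e v.1 v.2)
  calc ∫⁻ ω, clusterProcess τ ξ ω (Iic r) ∂P
      ≤ ∑' i, (1 - ∫⁻ t, (h t : ℝ≥0∞) ∂leb)⁻¹ * e i [] :=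
        hN.trans_le (ENNReal.tsum_le_tsum fun i => tsum_list_le_inv_one_sub_mul (hchild i))
    _ = (1 - ∫⁻ t, (h t : ℝ≥0∞) ∂leb)⁻¹ * ∑' i, e i [] := ENNReal.tsum_mul_left
    _ < ⊤ := ENNReal.mul_lt_top (ENNReal.inv_lt_top.2 (tsub_pos_of_lt hM.subcritical))
        (tsum_epoch_lt_top hM.measurable_waiting hM.indep_waiting hM.law_waiting
          (measure_singleton 0) r)

lemma ae_birth_ne_child (hM : IsClusterModel P f h τ ξ) (l v : ℕ × List ℕ) (j : ℕ)
    (hv : ∀ ω, birthOf (withoutChildren τ ξ l ω).1 (withoutChildren τ ξ l ω).2 v.1 v.2 =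
      birth τ ξ v.1 v.2 ω) :
    ∀ᵐ ω ∂P, birth τ ξ v.1 v.2 ω ≠ ⊤ → birth τ ξ v.1 v.2 ω ≠ birth τ ξ l.1 (j :: l.2) ω := by
  filter_upwards [(hM.offspring l).ae_add_nthPoint_ne (hM.measurable_birth l.1 l.2)
    (hM.measurable_birth v.1 v.2) (hM.indepFun_birth_of_unchanged l v hv) j] with ω hω htop
  exact (hω htop).symm

lemma ae_birth_ne_of_length_le (hM : IsClusterModel P f h τ ξ) {v v' : ℕ × List ℕ} (hne : v ≠ v')
    (hle : v.2.length ≤ v'.2.length) :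
    ∀ᵐ ω ∂P, birth τ ξ v.1 v.2 ω ≠ ⊤ → birth τ ξ v.1 v.2 ω ≠ birth τ ξ v'.1 v'.2 ω := by
  obtain ⟨i, w⟩ := v
  obtain ⟨i', w'⟩ := v'
  match w, w' with
  | [], [] =>
    filter_upwards [hM.ae_epoch_lt] with ω hω _ heq
    exact hne (by rw [(strictMono_nat_of_lt_succ hω).injective (ENNReal.coe_injective heq)])
  | [], j' :: u' =>
    exact hM.ae_birth_ne_child (i', u') (i, []) j'
      (birthOf_withoutChildren (i', u') i (Nat.zero_le _))
  | j :: u, j' :: u' =>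
    by_cases hparent : (i, u) = (i', u')
    · obtain ⟨rfl, rfl⟩ := Prod.mk.inj hparent
      exact hM.ae_birth_siblings_ne i u fun hj => hne (by rw [hj])
    · exact hM.ae_birth_ne_child (i', u') (i, j :: u) j'
        (birthOf_withoutChildren_cons (i', u') i j (Nat.le_of_succ_le_succ hle) hparent)

lemma ae_birth_ne (hM : IsClusterModel P f h τ ξ) :
    ∀ᵐ ω ∂P, ∀ v v' : ℕ × List ℕ, v ≠ v' → birth τ ξ v.1 v.2 ω ≠ ⊤ →
      birth τ ξ v.1 v.2 ω ≠ birth τ ξ v'.1 v'.2 ω := by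
  refine ae_all_iff.2 fun v => ae_all_iff.2 fun v' => ?_
  by_cases hne : v = v'
  · exact Filter.Eventually.of_forall fun ω h => absurd hne h
  rcases le_total v.2.length v'.2.length with hle | hle
  · filter_upwards [hM.ae_birth_ne_of_length_le hne hle] with ω hω _
    exact hω
  · filter_upwards [hM.ae_birth_ne_of_length_le (Ne.symm hne) hle] with ω hω _ htop heq
    exact hω (heq ▸ htop) heq.symm

lemma ae_isRegular (hM : IsClusterModel P f h τ ξ) : ∀ᵐ ω ∂P, IsRegular τ ξ ω := by
  have hfin : ∀ᵐ ω ∂P, ∀ n : ℕ, clusterProcess τ ξ ω (Iic n) < ⊤ :=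
    ae_all_iff.2 fun n => ae_lt_top ((Measure.measurable_coe measurableSet_Iic).comp
      hM.measurable_clusterProcess) (hM.lintegral_clusterProcess_Iic_lt_top n).ne
  filter_upwards [hfin, hM.ae_birth_ne, hM.ae_epoch_lt] with ω hω hne hlt
  refine ⟨clusterProcess_eq_sum hM.counting ω, hM.generation_zero_eq_sum ω, fun r => ?_, hne, hlt⟩
  obtain ⟨n, hn⟩ := exists_nat_ge r
  exact ((measure_mono (Iic_subset_Iic.2 hn)).trans_lt (hω n)).ne

end IsClusterModel

end Regularity

lemma measure_Iic_eq (ν : Measure ℝ≥0) (t : ℝ≥0) : ν (Iic t) = ν {0} + ν (Ioc 0 t) := by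
  rw [← measure_union (by simp) measurableSet_Ioc, singleton_union, Ioc_insert_left zero_le,
    ← Icc_bot, bot_eq_zero]

lemma le_iff_lt_tsum_ite {e : ℕ → ℝ≥0} (he : Monotone e) (k : ℕ) (r : ℝ≥0) :
    e k ≤ r ↔ (k : ℝ≥0∞) < ∑' j, if e j ≤ r then 1 else 0 := by
  constructor
  · intro hk
    calc (k : ℝ≥0∞) < (k + 1 : ℕ) := by exact_mod_cast k.lt_succ_self
      _ = ∑' j, if j < k + 1 then 1 else 0 := (tsum_ite_lt _).symm
      _ ≤ ∑' j, if e j ≤ r then 1 else 0 := by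
        refine ENNReal.tsum_le_tsum fun j => ?_
        by_cases hj : j < k + 1
        · rw [if_pos hj, if_pos ((he (Nat.lt_succ_iff.1 hj)).trans hk)]
        · simp [hj]
  · intro hlt
    by_contra hk
    refine hlt.not_ge ((ENNReal.tsum_le_tsum fun j => ?_).trans_eq (tsum_ite_lt k))
    by_cases hj : e j ≤ r
    · have hjk : j < k := he.reflect_lt (hj.trans_lt (not_le.1 hk))
      rw [if_pos hj, if_pos hjk]
    · simp [hj]

namespace IsRegular

variable {Ω : Type*} {τ : ℕ → Ω → ℝ≥0} {ξ : ℕ × List ℕ → Ω → Measure ℝ≥0} {ω : Ω}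

lemma isCountingMeasure (R : IsRegular τ ξ ω) : IsCountingMeasure (clusterProcess τ ξ ω) := by
  intro B hB hbd
  obtain ⟨r, hr⟩ := hbd.bddAbove
  have hfin : clusterProcess τ ξ ω B ≠ ⊤ :=
    ne_top_of_le_ne_top (R.finite r) (measure_mono fun x hx => hr hx)
  rw [R.eq_sum, Measure.sum_apply _ hB] at hfin ⊢
  exact exists_nat_eq_tsum (fun v => diracTop_apply_eq_zero_or_one _ hB) hfin

lemma strictMono_epoch (R : IsRegular τ ξ ω) : StrictMono fun k => epoch τ k ω :=
  strictMono_nat_of_lt_succ R.epoch_lt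

lemma eq_sum_point (R : IsRegular τ ξ ω) :
    clusterProcess τ ξ ω = Measure.sum fun i => diracTop (point τ ξ i ω) :=
  eq_sum_diracTop_nthPoint R.isCountingMeasure

lemma measure_singleton_le_one (R : IsRegular τ ξ ω) (x : ℝ≥0) :
    clusterProcess τ ξ ω {x} ≤ 1 := by
  have hzero {v : ℕ × List ℕ} (hv : birth τ ξ v.1 v.2 ω ≠ x) :
      diracTop (birth τ ξ v.1 v.2 ω) {x} = 0 := by
    rw [diracTop_apply _ (measurableSet_singleton x), indicator_of_notMem]
    rintro ⟨y, rfl, hy⟩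
    exact hv hy.symm
  rw [R.eq_sum, Measure.sum_apply _ (measurableSet_singleton x)]
  by_cases hex : ∃ v : ℕ × List ℕ, birth τ ξ v.1 v.2 ω = x
  · obtain ⟨v, hv⟩ := hex
    rw [tsum_eq_single v fun v' hv' =>
      hzero fun hx => R.birth_ne v v' hv'.symm (by simp [hv]) (hv.trans hx.symm)]
    rcases diracTop_apply_eq_zero_or_one (birth τ ξ v.1 v.2 ω) (measurableSet_singleton x)
      with h | h <;> simp [h]
  · rw [ENNReal.tsum_eq_zero.2 fun v => hzero fun hv => hex ⟨v, hv⟩]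
    exact zero_le_one

lemma one_le_measure_singleton_epoch (R : IsRegular τ ξ ω) (k : ℕ) :
    1 ≤ clusterProcess τ ξ ω {epoch τ k ω} := by
  rw [R.eq_sum, Measure.sum_apply _ (measurableSet_singleton _)]
  refine le_trans ?_ (ENNReal.le_tsum (k, []))
  simp [birth, diracTop_coe]

lemma measure_singleton_zero (R : IsRegular τ ξ ω) : clusterProcess τ ξ ω {0} = 1 := by
  refine le_antisymm (R.measure_singleton_le_one 0) ?_
  simpa [epoch] using R.one_le_measure_singleton_epoch 0

lemma point_le_iff (R : IsRegular τ ξ ω) (i : ℕ) (x : ℝ≥0) :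
    point τ ξ i ω ≤ x ↔ (i : ℝ≥0∞) < clusterProcess τ ξ ω (Iic x) :=
  nthPoint_le_iff R.isCountingMeasure i x

lemma point_lt_succ (R : IsRegular τ ξ ω) (i : ℕ) (hi : point τ ξ i ω ≠ ⊤) :
    point τ ξ i ω < point τ ξ (i + 1) ω := by
  refine lt_of_le_of_ne (nthPoint_mono _ (Nat.le_succ i)) fun heq => ?_
  obtain ⟨x, hx⟩ := WithTop.ne_top_iff_exists.1 hi
  have htwo : (2 : ℝ≥0∞) ≤ clusterProcess τ ξ ω {x} := by
    rw [measure_singleton_eq_tsum R.isCountingMeasure]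
    refine le_trans ?_ (ENNReal.sum_le_tsum {i, i + 1})
    rw [Finset.sum_pair (by omega), if_pos (show nthPoint _ i = (x : ℝ≥0∞) from hx.symm),
      if_pos (show nthPoint _ (i + 1) = (x : ℝ≥0∞) from heq.symm.trans hx.symm), one_add_one_eq_two]
  exact absurd (htwo.trans (R.measure_singleton_le_one x)) (by norm_num)

lemma finite_point_le (R : IsRegular τ ξ ω) (t : ℝ≥0) : {i | point τ ξ i ω ≤ t}.Finite := by
  obtain ⟨k, hk⟩ := R.isCountingMeasure.measure_Iic t
  refine (finite_lt_nat k).subset fun i hi => ?_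
  rw [mem_ofPred_eq, R.point_le_iff, hk] at hi
  exact_mod_cast hi

lemma exists_point_eq_epoch (R : IsRegular τ ξ ω) (k : ℕ) :
    ∃ i, point τ ξ i ω = epoch τ k ω := by
  by_contra! hne
  have hzero : clusterProcess τ ξ ω {epoch τ k ω} = 0 := by
    rw [measure_singleton_eq_tsum R.isCountingMeasure]
    exact ENNReal.tsum_eq_zero.2 fun i => if_neg (hne i)
  simpa [hzero] using R.one_le_measure_singleton_epoch k

lemma point_zero (R : IsRegular τ ξ ω) : point τ ξ 0 ω = epoch τ 0 ω := by
  obtain ⟨i, hi⟩ := R.exists_point_eq_epoch 0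
  refine le_antisymm ?_ (by simp [epoch])
  rw [← hi]
  exact nthPoint_mono _ (Nat.zero_le i)

lemma epoch_le_iff (R : IsRegular τ ξ ω) (k : ℕ) (r : ℝ≥0) :
    epoch τ k ω ≤ r ↔ (k : ℝ≥0∞) < generation τ ξ 0 ω (Iic r) := by
  rw [R.generation_zero, Measure.sum_apply _ measurableSet_Iic]
  simp_rw [diracTop_Iic, ENNReal.coe_le_coe]
  exact le_iff_lt_tsum_ite R.strictMono_epoch.monotone k r

lemma generation_zero_singleton_zero (R : IsRegular τ ξ ω) : generation τ ξ 0 ω {0} = 1 := by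
  have hepoch : epoch τ 0 ω = 0 := by simp [epoch]
  rw [R.generation_zero, Measure.sum_apply _ (measurableSet_singleton 0),
    tsum_eq_single 0 fun k hk => ?_]
  · rw [hepoch, diracTop_coe, Measure.dirac_apply' _ (measurableSet_singleton 0)]
    exact indicator_of_mem (mem_singleton _) _
  · have hpos : epoch τ k ω ∉ ({0} : Set ℝ≥0) :=
      (hepoch.symm.trans_lt (R.strictMono_epoch (Nat.pos_of_ne_zero hk))).ne'
    rw [diracTop_coe, Measure.dirac_apply' _ (measurableSet_singleton 0)]
    exact indicator_of_notMem hpos _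

section LastImmigrant

lemma mark_eq_zero_iff (i : ℕ) : mark τ ξ i ω = 0 ↔ ∃ k, point τ ξ i ω = epoch τ k ω := by
  unfold mark
  split_ifs with h <;> simp [h]

lemma exists_immigrant_lt (R : IsRegular τ ξ ω) {t : ℝ≥0} (ht : 0 < t) :
    ∃ i, point τ ξ i ω < t ∧ mark τ ξ i ω = 0 :=
  ⟨0, by rw [R.point_zero]; simpa [epoch] using ht, (mark_eq_zero_iff 0).2 ⟨0, R.point_zero⟩⟩

lemma exists_point_lastImmigrantBefore_eq_epoch (R : IsRegular τ ξ ω) {t : ℝ≥0} (ht : 0 < t) :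
    ∃ k, point τ ξ (lastImmigrantBefore (point τ ξ) (mark τ ξ) t ω) ω = epoch τ k ω ∧
      epoch τ k ω < t ∧ t ≤ epoch τ (k + 1) ω := by
  set J := lastImmigrantBefore (point τ ξ) (mark τ ξ) t ω
  have hfin : {i | point τ ξ i ω < t ∧ mark τ ξ i ω = 0}.Finite :=
    (R.finite_point_le t).subset fun i hi => hi.1.le
  obtain ⟨hJt, hJ⟩ : point τ ξ J ω < t ∧ mark τ ξ J ω = 0 :=
    Nat.sSup_mem (R.exists_immigrant_lt ht) hfin.bddAbove
  obtain ⟨k, hk⟩ := (mark_eq_zero_iff J).1 hJ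
  refine ⟨k, hk, by rw [hk] at hJt; exact_mod_cast hJt, ?_⟩
  by_contra! hlt
  obtain ⟨i, hi⟩ := R.exists_point_eq_epoch (k + 1)
  have hiJ : i ≤ J := le_csSup hfin.bddAbove
    ⟨by rw [hi]; exact_mod_cast hlt, (mark_eq_zero_iff i).2 ⟨k + 1, hi⟩⟩
  have hle : point τ ξ i ω ≤ point τ ξ J ω := nthPoint_mono _ hiJ
  rw [hi, hk, ENNReal.coe_le_coe] at hle
  exact (R.epoch_lt k).not_ge hle

lemma hazard_lastImmigrantBefore (R : IsRegular τ ξ ω) (f : ℝ≥0 → ℝ≥0) {t : ℝ≥0} (ht : 0 < t) :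
    (hazard f ((t : ℝ≥0∞) -
      point τ ξ (lastImmigrantBefore (point τ ξ) (mark τ ξ) t ω) ω).toNNReal : ℝ≥0∞) =
        ∑' k, hazardBetween f (epoch τ k ω) (epoch τ (k + 1) ω) t := by
  obtain ⟨k, hk, hkt, htk⟩ := R.exists_point_lastImmigrantBefore_eq_epoch ht
  simp only [hazardBetween, shifted, ENNReal.coe_lt_coe, ENNReal.toNNReal_coe]
  rw [hk, ← ENNReal.coe_sub, ENNReal.toNNReal_coe, tsum_eq_single k fun k' hk' => ?_, if_pos htk,
    if_pos hkt]
  rcases hk'.lt_or_gt with hlt | hlt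
  · exact if_neg ((R.strictMono_epoch.monotone hlt).trans_lt hkt).not_ge
  · rw [if_neg (htk.trans (R.strictMono_epoch.monotone hlt)).not_gt, ite_self]

end LastImmigrant

end IsRegular

lemma sSup_eq_iSup_ite (S : Set ℕ) [DecidablePred (· ∈ S)] :
    sSup S = ⨆ i, if i ∈ S then i else 0 := by
  by_cases hS : BddAbove S
  · obtain ⟨k, hk⟩ := hS
    have hbdd : BddAbove (range fun i => if i ∈ S then i else 0) := by
      refine ⟨k, forall_mem_range.2 fun i => ?_⟩
      split_ifs with hi
      exacts [hk hi, Nat.zero_le k]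
    refine le_antisymm (csSup_le' fun i hi => ?_) (ciSup_le' fun i => ?_)
    · simpa [hi] using le_ciSup hbdd i
    · split_ifs with hi
      exacts [le_csSup ⟨k, hk⟩ hi, Nat.zero_le _]
  · rw [Nat.sSup_of_not_bddAbove hS, iSup, Nat.sSup_of_not_bddAbove]
    rintro ⟨k, hk⟩
    exact hS ⟨k, fun i hi => by simpa [hi] using hk (mem_range_self i)⟩

open Classical in
lemma measurable_sSup_nat {α : Type*} {mα : MeasurableSpace α} {S : α → Set ℕ}
    (hS : ∀ i, MeasurableSet {x | i ∈ S x}) : Measurable fun x => sSup (S x) := by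
  simp_rw [sSup_eq_iSup_ite]
  exact Measurable.iSup fun i => Measurable.ite (hS i) measurable_const measurable_const

lemma measurable_min_of_measurableSet_le {α : Type*} {mα : MeasurableSpace α} {t : ℝ≥0}
    {σ : α → ℝ≥0∞} (hσ : ∀ r ≤ t, MeasurableSet {x | σ x ≤ r}) :
    Measurable fun x => min (σ x) t := by
  refine measurable_of_Iic fun c => ?_
  by_cases hc : (t : ℝ≥0∞) ≤ c
  · convert! MeasurableSet.univ using 1
    ext x
    simp [hc]
  · lift c to ℝ≥0 using ne_top_of_lt (not_le.1 hc)
    convert! hσ c (by exact_mod_cast (not_le.1 hc).le) using 1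
    ext x
    simp only [mem_preimage, mem_Iic, min_le_iff, hc, or_false, mem_ofPred_eq]

lemma measurableSet_le_inter_eq {α : Type*} {mα : MeasurableSpace α} {t : ℝ≥0} {σ ρ : α → ℝ≥0∞}
    (hσ : ∀ r ≤ t, MeasurableSet {x | σ x ≤ r}) (hρ : ∀ r ≤ t, MeasurableSet {x | ρ x ≤ r}) :
    MeasurableSet {x | σ x ≤ t ∧ σ x = ρ x} := by
  have hset : {x | σ x ≤ t ∧ σ x = ρ x} =
      {x | σ x ≤ t} ∩ {x | ρ x ≤ t} ∩ {x | min (σ x) t = min (ρ x) t} := by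
    ext x
    simp only [mem_ofPred_eq, mem_inter_iff]
    constructor
    · rintro ⟨hle, heq⟩
      exact ⟨⟨hle, heq ▸ hle⟩, by rw [heq]⟩
    · rintro ⟨⟨hσt, hρt⟩, hmin⟩
      rw [min_eq_left hσt, min_eq_left hρt] at hmin
      exact ⟨hσt, hmin⟩
  rw [hset]
  exact ((hσ t le_rfl).inter (hρ t le_rfl)).inter (measurableSet_eq_fun
    (measurable_min_of_measurableSet_le hσ) (measurable_min_of_measurableSet_le hρ))

lemma measurable_min_of_measurableSet_lt {α : Type*} {mα : MeasurableSpace α} {σ T : α → ℝ≥0∞}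
    (hT : Measurable T) (hσ : ∀ c, MeasurableSet {x | σ x < T x ∧ σ x < c}) :
    Measurable fun x => min (σ x) (T x) := by
  refine measurable_of_Iio fun c => ?_
  have hset : (fun x => min (σ x) (T x)) ⁻¹' Iio c =
      {x | T x < c} ∪ {x | σ x < T x ∧ σ x < c} := by
    ext x
    simp only [mem_preimage, mem_Iio, min_lt_iff, mem_union, mem_ofPred_eq]
    constructor
    · rintro (hlt | hlt)
      · exact (lt_or_ge (T x) c).imp_right fun hc => ⟨hlt.trans_le hc, hlt⟩
      · exact Or.inl hlt
    · rintro (hlt | ⟨-, hlt⟩)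
      exacts [Or.inr hlt, Or.inl hlt]
  rw [hset]
  exact (measurableSet_lt hT measurable_const).union (hσ c)

lemma measurable_shifted_of_measurableSet_lt {α : Type*} {mα : MeasurableSpace α}
    {φ : ℝ≥0 → ℝ≥0∞} (hφ : Measurable φ) {T : α → ℝ≥0} (hT : Measurable T) {σ : α → ℝ≥0∞}
    (hσ : ∀ c, MeasurableSet {x | σ x < T x ∧ σ x < c}) :
    Measurable fun x => shifted φ (σ x) (T x) := by
  have hmin := measurable_min_of_measurableSet_lt hT.coe_nnreal_ennreal hσ
  have heq : (fun x => shifted φ (σ x) (T x)) = fun x =>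
      if σ x < T x ∧ σ x < ⊤ then φ (T x - (min (σ x) (T x)).toNNReal) else 0 := by
    funext x
    rw [shifted]
    by_cases hlt : σ x < T x
    · rw [if_pos hlt, if_pos ⟨hlt, hlt.trans ENNReal.coe_lt_top⟩, min_eq_left hlt.le]
    · rw [if_neg hlt, if_neg fun h => hlt h.1]
  rw [heq]
  exact Measurable.ite (hσ ⊤) (hφ.comp (by fun_prop)) measurable_const

section Predictable

variable {Ω : Type*} {m : MeasurableSpace Ω} {𝓕 : Filtration ℝ≥0 m}

lemma predictable_le_prod : 𝓕.predictable ≤ (inferInstance : MeasurableSpace (ℝ≥0 × Ω)) :=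
  measurableSpace_le_predictable_of_measurableSet
    (fun A hA => (measurableSet_singleton _).prod (𝓕.le _ A hA))
    fun i A hA => measurableSet_Ioi.prod (𝓕.le i A hA)

lemma measurable_fst_predictable : Measurable[𝓕.predictable] (Prod.fst : ℝ≥0 × Ω → ℝ≥0) := by
  refine @measurable_of_Ioi ℝ≥0 (ℝ≥0 × Ω) _ _ _ (_) _ _ inferInstance _ fun c => ?_
  rw [← prod_univ]
  exact measurableSet_predictable_Ioi_prod MeasurableSet.univ

lemma measurableSet_predictable_univ_prod {A : Set Ω} (hA : MeasurableSet[𝓕 0] A) :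
    MeasurableSet[𝓕.predictable] ((univ : Set ℝ≥0) ×ˢ A) := by
  rw [← Ici_bot, ← Ioi_union_left, union_prod]
  exact (measurableSet_predictable_Ioi_prod hA).union
    (measurableSet_predictable_singleton_bot_prod hA)

lemma measurableSet_predictable_lt {σ : Ω → ℝ≥0∞}
    (hσ : ∀ r : ℝ≥0, MeasurableSet[𝓕 r] {ω | σ ω ≤ r}) (c : ℝ≥0∞) :
    MeasurableSet[𝓕.predictable] {y : ℝ≥0 × Ω | σ y.2 < y.1 ∧ σ y.2 < c} := by
  have hset : {y : ℝ≥0 × Ω | σ y.2 < y.1 ∧ σ y.2 < c} =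
      ⋃ (q : ℚ) (_ : ((Real.toNNReal q : ℝ≥0) : ℝ≥0∞) < c),
        Ioi (Real.toNNReal q) ×ˢ {ω | σ ω ≤ Real.toNNReal q} := by
    ext ⟨t, ω⟩
    simp only [mem_ofPred_eq, mem_iUnion, mem_prod, mem_Ioi, exists_prop]
    constructor
    · rintro ⟨hσt, hσc⟩
      obtain ⟨q, -, hσq, hq⟩ := ENNReal.lt_iff_exists_rat_btwn.1 (lt_min hσt hσc)
      exact ⟨q, hq.trans_le (min_le_right _ _),
        ENNReal.coe_lt_coe.1 (hq.trans_le (min_le_left _ _)), hσq.le⟩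
    · rintro ⟨q, hqc, hqt, hσq⟩
      exact ⟨hσq.trans_lt (ENNReal.coe_lt_coe.2 hqt), hσq.trans_lt hqc⟩
  rw [hset]
  exact MeasurableSet.iUnion fun q => MeasurableSet.iUnion fun _ =>
    measurableSet_predictable_Ioi_prod (hσ _)

lemma measurable_predictable_shifted {φ : ℝ≥0 → ℝ≥0∞} (hφ : Measurable φ) {σ : Ω → ℝ≥0∞}
    (hσ : ∀ r : ℝ≥0, MeasurableSet[𝓕 r] {ω | σ ω ≤ r}) :
    Measurable[𝓕.predictable] fun y : ℝ≥0 × Ω => shifted φ (σ y.2) y.1 :=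
  measurable_shifted_of_measurableSet_lt (mα := 𝓕.predictable) hφ measurable_fst_predictable
    (σ := fun y : ℝ≥0 × Ω => σ y.2) (measurableSet_predictable_lt hσ)

lemma measurableSet_predictable_inter_of_null {P : Measure Ω}
    (hnull : ∀ A, MeasurableSet A → P A = 0 → MeasurableSet[𝓕 0] A) {Z : Set Ω}
    (hZ : MeasurableSet Z) (hPZ : P Z = 0) {E : Set (ℝ≥0 × Ω)} (hE : MeasurableSet E) :
    MeasurableSet[𝓕.predictable] ((univ : Set ℝ≥0) ×ˢ Z ∩ E) := by
  rw [← generateFrom_prod] at hE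
  induction E, hE using MeasurableSpace.generateFrom_induction with
  | hC E hE _ =>
    obtain ⟨B, hB, A, hA, rfl⟩ := hE
    have hrect : (univ : Set ℝ≥0) ×ˢ Z ∩ B ×ˢ A = Prod.fst ⁻¹' B ∩ univ ×ˢ (Z ∩ A) := by
      ext ⟨t, ω⟩
      simp only [mem_inter_iff, mem_prod, mem_univ, true_and, mem_preimage]
      tauto
    rw [hrect]
    exact (measurable_fst_predictable hB).inter (measurableSet_predictable_univ_prod
      (hnull _ (hZ.inter hA) (measure_mono_null inter_subset_left hPZ)))
  | empty => simp
  | compl E _ ih =>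
    rw [← sdiff_eq, ← sdiff_self_inter]
    exact (measurableSet_predictable_univ_prod (hnull Z hZ hPZ)).diff ih
  | iUnion E _ ih =>
    rw [inter_iUnion]
    exact MeasurableSet.iUnion ih

lemma measurable_predictable_of_ae_eq {P : Measure Ω}
    (hnull : ∀ A, MeasurableSet A → P A = 0 → MeasurableSet[𝓕 0] A) {u u' : ℝ≥0 × Ω → ℝ≥0∞}
    (hu : Measurable u) (hu' : Measurable[𝓕.predictable] u')
    (huu' : ∀ᵐ ω ∂P, ∀ t, u (t, ω) = u' (t, ω)) : Measurable[𝓕.predictable] u := by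
  obtain ⟨Z, hZ_sub, hZ, hPZ⟩ := exists_measurable_superset_of_null (ae_iff.1 huu')
  intro B hB
  have hsplit : u ⁻¹' B = (univ ×ˢ Z ∩ u ⁻¹' B) ∪ (u' ⁻¹' B \ univ ×ˢ Z) := by
    ext ⟨t, ω⟩
    simp only [mem_preimage, mem_union, mem_inter_iff, mem_prod, mem_univ, true_and, mem_sdiff]
    by_cases hω : ω ∈ Z
    · simp [hω]
    · have heq : u (t, ω) = u' (t, ω) := by
        by_contra hne
        exact hω (hZ_sub fun h => hne (h t))
      simp [hω, heq]
  rw [hsplit]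
  exact (measurableSet_predictable_inter_of_null hnull hZ hPZ (hu hB)).union
    ((hu' hB).diff (measurableSet_predictable_univ_prod (hnull Z hZ hPZ)))

end Predictable

lemma measurable_generation_Ioc {Ω : Type*} {τ : ℕ → Ω → ℝ≥0}
    {ξ : ℕ × List ℕ → Ω → Measure ℝ≥0} (n : ℕ) (t : ℝ≥0) :
    Measurable[naturalSigma τ ξ t] fun ω => generation τ ξ n ω (Ioc 0 t) := by
  rw [measurable_iff_comap_le]
  exact le_iSup_of_le n (le_iSup_of_le 0 (le_iSup_of_le t (le_iSup_of_le ⟨zero_le, le_rfl⟩ le_rfl)))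

section Augmented

variable {Ω : Type*} [m : MeasurableSpace Ω] {P : Measure Ω} {τ : ℕ → Ω → ℝ≥0}
  {ξ : ℕ × List ℕ → Ω → Measure ℝ≥0} {t : ℝ≥0}

lemma measurableSet_augmentedFiltration_iff {A : Set Ω} :
    MeasurableSet[augmentedFiltration P τ ξ t] A ↔
      MeasurableSet A ∧ ∃ B, MeasurableSet[naturalSigma τ ξ t] B ∧ A =ᵐ[P] B :=
  MeasurableSpace.measurableSet_inf

lemma measurableSet_augmentedFiltration_congr {A B : Set Ω} (hA : MeasurableSet A)
    (hB : MeasurableSet[augmentedFiltration P τ ξ t] B) (hAB : A =ᵐ[P] B) :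
    MeasurableSet[augmentedFiltration P τ ξ t] A := by
  obtain ⟨-, B', hB', hBB'⟩ := measurableSet_augmentedFiltration_iff.1 hB
  exact measurableSet_augmentedFiltration_iff.2 ⟨hA, B', hB', hAB.trans hBB'⟩

lemma measurableSet_augmentedFiltration_of_null (t : ℝ≥0) {A : Set Ω} (hA : MeasurableSet A)
    (hPA : P A = 0) : MeasurableSet[augmentedFiltration P τ ξ t] A :=
  measurableSet_augmentedFiltration_congr hA
    (@MeasurableSet.empty _ (augmentedFiltration P τ ξ t)) (ae_eq_empty.2 hPA)

lemma measurable_augmentedFiltration_of_ae_eq {β : Type*} [MeasurableSpace β] {u u' : Ω → β}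
    (hu : Measurable u) (hu' : Measurable[naturalSigma τ ξ t] u') (huu' : u =ᵐ[P] u') :
    Measurable[augmentedFiltration P τ ξ t] u := fun B hB =>
  measurableSet_augmentedFiltration_iff.2 ⟨hu hB, u' ⁻¹' B, hu' hB, huu'.preimage B⟩

end Augmented

lemma measurable_apply_countable_index {α β γ ι : Type*} [MeasurableSpace α] [MeasurableSpace β]
    [MeasurableSpace γ] [MeasurableSpace ι] [Countable ι] [MeasurableSingletonClass ι]
    {T : ι → α → β} {i : γ → ι} {a : γ → α} (hT : ∀ i, Measurable (T i)) (hi : Measurable i)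
    (ha : Measurable a) : Measurable fun y => T (i y) (a y) :=
  (measurable_from_prod_countable_right (f := fun q : ι × α => T q.1 q.2) hT).comp (hi.prodMk ha)

lemma measurable_hazard_sub {α : Type*} [MeasurableSpace α] {f : ℝ≥0 → ℝ≥0} {t : α → ℝ≥0}
    {p : α → ℝ≥0∞} (hf : Measurable f) (ht : Measurable t) (hp : Measurable p) :
    Measurable fun y => (hazard f (t y - p y).toNNReal : ℝ≥0∞) := by
  have := measurable_hazard hf
  fun_prop

lemma measurable_add_tsum {α ι : Type*} {mα : MeasurableSpace α} [Countable ι] {g : α → ℝ≥0∞}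
    {u : ι → α → ℝ≥0∞} (hg : Measurable g) (hu : ∀ i, Measurable (u i)) :
    Measurable[mα] fun y => g y + ∑' i, u i y :=
  hg.add (Measurable.tsum hu)

namespace IsClusterModel

variable {Ω : Type*} [MeasurableSpace Ω] {P : Measure Ω} {f h : ℝ≥0 → ℝ≥0}
  {τ : ℕ → Ω → ℝ≥0} {ξ : ℕ × List ℕ → Ω → Measure ℝ≥0}

lemma measurable_clusterProcess_Iic (hM : IsClusterModel P f h τ ξ) (t : ℝ≥0) :
    Measurable fun ω => clusterProcess τ ξ ω (Iic t) :=
  (Measure.measurable_coe measurableSet_Iic).comp hM.measurable_clusterProcess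

lemma measurable_point (hM : IsClusterModel P f h τ ξ) (i : ℕ) : Measurable (point τ ξ i) :=
  (measurable_nthPoint i).comp hM.measurable_clusterProcess

open Classical in
lemma measurable_mark (hM : IsClusterModel P f h τ ξ) (i : ℕ) : Measurable (mark τ ξ i) := by
  refine Measurable.ite ?_ measurable_const measurable_const
  rw [ofPred_exists]
  exact MeasurableSet.iUnion fun k =>
    measurableSet_eq_fun (hM.measurable_point i) (hM.measurable_epoch k).coe_nnreal_ennreal

lemma measurable_lastImmigrantBefore (hM : IsClusterModel P f h τ ξ) :
    Measurable fun y : ℝ≥0 × Ω => lastImmigrantBefore (point τ ξ) (mark τ ξ) y.1 y.2 := by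
  refine measurable_sSup_nat fun i => ?_
  have hpoint : MeasurableSet {y : ℝ≥0 × Ω | point τ ξ i y.2 < y.1} :=
    measurableSet_lt ((hM.measurable_point i).comp measurable_snd)
      (measurable_coe_nnreal_ennreal.comp measurable_fst)
  exact hpoint.inter
    (((hM.measurable_mark i).comp measurable_snd) (measurableSet_singleton (0 : Fin 2)))

lemma measurable_point_lastImmigrantBefore (hM : IsClusterModel P f h τ ξ) :
    Measurable fun y : ℝ≥0 × Ω =>
      point τ ξ (lastImmigrantBefore (point τ ξ) (mark τ ξ) y.1 y.2) y.2 :=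
  measurable_apply_countable_index hM.measurable_point hM.measurable_lastImmigrantBefore
    measurable_snd

lemma measurable_lintegral_Iio_clusterProcess (hM : IsClusterModel P f h τ ξ) :
    Measurable fun y : ℝ≥0 × Ω =>
      ∫⁻ x in Iio y.1, (h (y.1 - x) : ℝ≥0∞) ∂(clusterProcess τ ξ y.2) := by
  simp_rw [lintegral_Iio_of_eq_sum (clusterProcess_eq_sum hM.counting _) hM.measurable_h]
  exact Measurable.tsum fun l => (hM.measurable_offspringIntensity l).comp measurable_swap

lemma measurable_hawkesIntensity (hM : IsClusterModel P f h τ ξ) :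
    Measurable fun y : ℝ≥0 × Ω =>
      hawkesIntensity (hazard f) h (clusterProcess τ ξ) (point τ ξ) (mark τ ξ) y.1 y.2 :=
  (measurable_hazard_sub hM.measurable_f measurable_fst
    hM.measurable_point_lastImmigrantBefore).add hM.measurable_lintegral_Iio_clusterProcess

variable [IsProbabilityMeasure P]

lemma adapted_clusterProcess (hM : IsClusterModel P f h τ ξ) (t : ℝ≥0) :
    Measurable[augmentedFiltration P τ ξ t] fun ω => clusterProcess τ ξ ω (Iic t) := by
  have hsum : Measurable[naturalSigma τ ξ t] fun ω => 1 + ∑' n, generation τ ξ n ω (Ioc 0 t) :=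
    measurable_add_tsum (mα := naturalSigma τ ξ t) measurable_const
      fun n => measurable_generation_Ioc n t
  refine measurable_augmentedFiltration_of_ae_eq (hM.measurable_clusterProcess_Iic t) hsum ?_
  filter_upwards [hM.ae_isRegular] with ω R
  rw [measure_Iic_eq, R.measure_singleton_zero, clusterProcess_eq_sum_generation,
    Measure.sum_apply _ measurableSet_Ioc]

lemma measurableSet_point_le (hM : IsClusterModel P f h τ ξ) (i : ℕ) (r : ℝ≥0) :
    MeasurableSet[augmentedFiltration P τ ξ r] {ω | point τ ξ i ω ≤ r} := by
  refine measurableSet_augmentedFiltration_congr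
    (measurableSet_le (hM.measurable_point i) measurable_const)
    (hM.adapted_clusterProcess r (measurableSet_Ioi (a := (i : ℝ≥0∞)))) ?_
  rw [Filter.eventuallyEq_set]
  filter_upwards [hM.ae_isRegular] with ω R
  exact R.point_le_iff i r

lemma measurableSet_epoch_le (hM : IsClusterModel P f h τ ξ) (k : ℕ) (r : ℝ≥0) :
    MeasurableSet[augmentedFiltration P τ ξ r] {ω | (epoch τ k ω : ℝ≥0∞) ≤ r} := by
  refine measurableSet_augmentedFiltration_iff.2
    ⟨measurableSet_le (hM.measurable_epoch k).coe_nnreal_ennreal measurable_const,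
      {ω | (k : ℝ≥0∞) < 1 + generation τ ξ 0 ω (Ioc 0 r)},
      measurable_generation_Ioc 0 r (measurableSet_lt measurable_const
        (measurable_const_add (1 : ℝ≥0∞))), ?_⟩
  rw [Filter.eventuallyEq_set]
  filter_upwards [hM.ae_isRegular] with ω R
  rw [← R.generation_zero_singleton_zero, ← measure_Iic_eq, ← R.epoch_le_iff, ENNReal.coe_le_coe]

lemma adapted_lastImmigrant (hM : IsClusterModel P f h τ ξ) :
    Adapted (augmentedFiltration P τ ξ) (lastImmigrant (point τ ξ) (mark τ ξ)) := by
  refine fun t => measurable_sSup_nat (mα := augmentedFiltration P τ ξ t) fun i => ?_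
  have hset : {ω | i ∈ {i | point τ ξ i ω ≤ t ∧ mark τ ξ i ω = 0}} =
      ⋃ k, {ω | point τ ξ i ω ≤ t ∧ point τ ξ i ω = epoch τ k ω} := by
    ext ω
    simp only [mem_ofPred_eq, IsRegular.mark_eq_zero_iff, mem_iUnion, exists_and_left]
  rw [hset]
  refine MeasurableSet.iUnion fun k => measurableSet_le_inter_eq (fun r hr => ?_) fun r hr => ?_
  · exact (augmentedFiltration P τ ξ).mono hr _ (hM.measurableSet_point_le i r)
  · exact (augmentedFiltration P τ ξ).mono hr _ (hM.measurableSet_epoch_le k r)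

lemma ae_hawkesIntensity_eq (hM : IsClusterModel P f h τ ξ) :
    ∀ᵐ ω ∂P, ∀ t : ℝ≥0, 0 < t →
      hawkesIntensity (hazard f) h (clusterProcess τ ξ) (point τ ξ) (mark τ ξ) t ω =
        sumIntensity f h τ ξ t ω := by
  filter_upwards [hM.ae_isRegular] with ω R t ht
  rw [hawkesIntensity, sumIntensity, R.hazard_lastImmigrantBefore _ ht,
    lintegral_Iio_of_eq_sum R.eq_sum hM.measurable_h]

lemma measurable_predictable_hazardBetween (hM : IsClusterModel P f h τ ξ) (k : ℕ) :
    Measurable[(augmentedFiltration P τ ξ).predictable] fun y : ℝ≥0 × Ω =>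
      hazardBetween f (epoch τ k y.2) (epoch τ (k + 1) y.2) y.1 := by
  have := measurable_hazard hM.measurable_f
  refine Measurable.ite ?_ (measurable_predictable_shifted (φ := fun x => hazard f x)
    (by fun_prop) (hM.measurableSet_epoch_le k)) measurable_const
  convert! (measurableSet_predictable_lt (hM.measurableSet_epoch_le (k + 1)) ⊤).compl using 1
  ext y
  simp

lemma isStronglyPredictable_hawkesIntensity (hM : IsClusterModel P f h τ ξ) :
    IsStronglyPredictable (augmentedFiltration P τ ξ)
      (hawkesIntensity (hazard f) h (clusterProcess τ ξ) (point τ ξ) (mark τ ξ)) := by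
  -- The last immigrant before time `0` does not exist, so that the value at `0` is `hazard f 0`.
  have hzero : Measurable[(augmentedFiltration P τ ξ).predictable] fun y : ℝ≥0 × Ω =>
      ({0} : Set ℝ≥0).indicator (fun _ => (hazard f 0 : ℝ≥0∞)) y.1 :=
    (measurable_const.indicator (measurableSet_singleton 0)).comp measurable_fst_predictable
  have hsum := measurable_add_tsum (mα := (augmentedFiltration P τ ξ).predictable)
    (measurable_add_tsum (mα := (augmentedFiltration P τ ξ).predictable) hzero
      hM.measurable_predictable_hazardBetween)
    fun i => measurable_predictable_shifted hM.measurable_h.coe_nnreal_ennreal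
      (hM.measurableSet_point_le i)
  refine (measurable_predictable_of_ae_eq (fun A => measurableSet_augmentedFiltration_of_null 0)
    hM.measurable_hawkesIntensity hsum ?_).stronglyMeasurable
  filter_upwards [hM.ae_isRegular] with ω R t
  rcases eq_or_ne t 0 with rfl | ht
  · simp [hawkesIntensity, shifted, hazardBetween]
  · rw [hawkesIntensity, R.hazard_lastImmigrantBefore _ (pos_iff_ne_zero.2 ht),
      lintegral_Iio_of_eq_sum R.eq_sum_point hM.measurable_h]
    simp [ht]

end IsClusterModel

section PredictableMeasure

variable {Ω : Type*} {m : MeasurableSpace Ω} {𝓕 : Filtration ℝ≥0 m}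

/-- The rectangles `{0} ×ˢ A` and `Ioc s r ×ˢ A` with `A` known at the left end point of the time
interval: a `π`-system that generates the predictable `σ`-algebra. -/
def predictableRectangles (𝓕 : Filtration ℝ≥0 m) : Set (Set (ℝ≥0 × Ω)) :=
  {E | ∃ A, MeasurableSet[𝓕 0] A ∧ E = {0} ×ˢ A} ∪
    {E | ∃ s r A, MeasurableSet[𝓕 s] A ∧ E = Ioc s r ×ˢ A}

lemma isPiSystem_predictableRectangles : IsPiSystem (predictableRectangles 𝓕) := by
  rintro _ (⟨A, hA, rfl⟩ | ⟨s, r, A, hA, rfl⟩) _ (⟨A', hA', rfl⟩ | ⟨s', r', A', hA', rfl⟩) hne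
  · exact Or.inl ⟨A ∩ A', hA.inter hA', by rw [prod_inter_prod, inter_self]⟩
  · obtain ⟨⟨t, ω⟩, ⟨hzero, -⟩, hIoc, -⟩ := hne
    exact absurd (hIoc.1.trans_eq hzero) not_lt_zero
  · obtain ⟨⟨t, ω⟩, ⟨hIoc, -⟩, hzero, -⟩ := hne
    exact absurd (hIoc.1.trans_eq hzero) not_lt_zero
  · exact Or.inr ⟨s ⊔ s', r ⊓ r', A ∩ A', (𝓕.mono le_sup_left A hA).inter
      (𝓕.mono le_sup_right A' hA'), by rw [prod_inter_prod, Ioc_inter_Ioc]⟩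

lemma predictable_eq_generateFrom :
    𝓕.predictable = MeasurableSpace.generateFrom (predictableRectangles 𝓕) := by
  refine le_antisymm (measurableSpace_le_predictable_of_measurableSet (fun A hA => ?_)
    fun s A hA => ?_) (MeasurableSpace.generateFrom_le ?_)
  · exact MeasurableSpace.measurableSet_generateFrom (Or.inl ⟨A, hA, rfl⟩)
  · rw [← iUnion_Ioc_eq_Ioi_self_iff.2 fun t _ => exists_nat_ge t, iUnion_prod_const]
    exact MeasurableSet.iUnion fun n =>
      MeasurableSpace.measurableSet_generateFrom (Or.inr ⟨s, n, A, hA, rfl⟩)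
  · rintro _ (⟨A, hA, rfl⟩ | ⟨s, r, A, hA, rfl⟩)
    · exact measurableSet_predictable_singleton_bot_prod hA
    · exact measurableSet_predictable_Ioc_prod s r hA

lemma trim_predictable_congr {μ₁ μ₂ : Measure (ℝ≥0 × Ω)} (hzero₁ : μ₁ ({0} ×ˢ univ) = 0)
    (hzero₂ : μ₂ ({0} ×ˢ univ) = 0) (hfin : ∀ r, μ₁ (Ioc 0 r ×ˢ univ) < ⊤)
    (heq : ∀ s r A, MeasurableSet[𝓕 s] A → μ₁ (Ioc s r ×ˢ A) = μ₂ (Ioc s r ×ˢ A)) :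
    μ₁.trim (predictable_le_prod (𝓕 := 𝓕)) = μ₂.trim (predictable_le_prod (𝓕 := 𝓕)) := by
  let B (n : ℕ) : Set (ℝ≥0 × Ω) := n.casesOn ({0} ×ˢ univ) fun k => Ioc 0 (k : ℝ≥0) ×ˢ univ
  have hB : ∀ n, B n ∈ predictableRectangles 𝓕 := by
    rintro (_ | k)
    · exact Or.inl ⟨univ, MeasurableSet.univ, rfl⟩
    · exact Or.inr ⟨0, k, univ, MeasurableSet.univ, rfl⟩
  have hmeas : ∀ E ∈ predictableRectangles 𝓕, MeasurableSet[𝓕.predictable] E := by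
    rw [predictable_eq_generateFrom]
    exact fun E hE => MeasurableSpace.measurableSet_generateFrom hE
  refine @Measure.ext_of_generateFrom_of_iUnion _ 𝓕.predictable _ _ _ B
    predictable_eq_generateFrom isPiSystem_predictableRectangles ?_ hB (fun n => ?_) fun E hE => ?_
  · refine eq_univ_of_forall fun y => mem_iUnion.2 ?_
    rcases eq_or_ne y.1 0 with hy | hy
    · exact ⟨0, hy, mem_univ _⟩
    · obtain ⟨n, hn⟩ := exists_nat_ge y.1
      exact ⟨n + 1, ⟨pos_iff_ne_zero.2 hy, hn⟩, mem_univ _⟩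
  · rw [trim_measurableSet_eq _ (hmeas _ (hB n))]
    rcases n with _ | k
    exacts [hzero₁ ▸ ENNReal.zero_ne_top, (hfin k).ne]
  · rw [trim_measurableSet_eq _ (hmeas _ hE), trim_measurableSet_eq _ (hmeas _ hE)]
    rcases hE with ⟨A, -, rfl⟩ | ⟨s, r, A, hA, rfl⟩
    · rw [measure_mono_null (prod_mono_right (subset_univ A)) hzero₁,
        measure_mono_null (prod_mono_right (subset_univ A)) hzero₂]
    · exact heq s r A hA

lemma setLIntegral_Ioi_prod_predictable_congr {μ₁ μ₂ : Measure (ℝ≥0 × Ω)}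
    (hfin : ∀ r, μ₁ (Ioc 0 r ×ˢ univ) < ⊤)
    (heq : ∀ s r A, MeasurableSet[𝓕 s] A → μ₁ (Ioc s r ×ˢ A) = μ₂ (Ioc s r ×ˢ A))
    {C : ℝ≥0 × Ω → ℝ≥0∞} (hC : Measurable[𝓕.predictable] C) :
    ∫⁻ y in Ioi 0 ×ˢ univ, C y ∂μ₁ = ∫⁻ y in Ioi 0 ×ˢ univ, C y ∂μ₂ := by
  have hzero (μ : Measure (ℝ≥0 × Ω)) : μ.restrict (Ioi 0 ×ˢ univ) ({0} ×ˢ univ) = 0 := by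
    rw [Measure.restrict_apply ((measurableSet_singleton 0).prod MeasurableSet.univ),
      prod_inter_prod]
    simp
  have hsub (s r : ℝ≥0) (A : Set Ω) : Ioc s r ×ˢ A ⊆ Ioi 0 ×ˢ univ :=
    prod_mono (fun t ht => zero_le.trans_lt ht.1) (subset_univ A)
  rw [← lintegral_trim predictable_le_prod hC, ← lintegral_trim predictable_le_prod hC,
    trim_predictable_congr (hzero μ₁) (hzero μ₂) (fun r => ?_) fun s r A hA => ?_]
  · rw [Measure.restrict_eq_self _ (hsub _ _ _)]
    exact hfin r
  · rw [Measure.restrict_eq_self _ (hsub _ _ _), Measure.restrict_eq_self _ (hsub _ _ _)]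
    exact heq s r A hA

lemma setLIntegral_map_swap_compProd {α β : Type*} [MeasurableSpace α] [MeasurableSpace β]
    {μ : Measure α} [SFinite μ] {κ : Kernel α β} [IsSFiniteKernel κ] {g : β × α → ℝ≥0∞}
    (hg : Measurable g) {A : Set α} (hA : MeasurableSet A) {I : Set β} (hI : MeasurableSet I) :
    ∫⁻ y in I ×ˢ A, g y ∂(μ ⊗ₘ κ).map Prod.swap =
      ∫⁻ a in A, ∫⁻ b in I, g (b, a) ∂(κ a) ∂μ := by
  rw [setLIntegral_map (hI.prod hA) hg measurable_swap, preimage_swap_prod]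
  exact Measure.setLIntegral_compProd (hg.comp measurable_swap) hA hI

lemma setLIntegral_prod_withDensity {α β : Type*} [MeasurableSpace α] [MeasurableSpace β]
    {μ : Measure α} [SFinite μ] {ν : Measure β} [SFinite ν] {u g : β × α → ℝ≥0∞}
    (hu : Measurable u) (hg : Measurable g) {A : Set α} (hA : MeasurableSet A) {I : Set β}
    (hI : MeasurableSet I) :
    ∫⁻ y in I ×ˢ A, g y ∂(ν.prod μ).withDensity u =
      ∫⁻ a in A, ∫⁻ b in I, g (b, a) * u (b, a) ∂ν ∂μ := by
  rw [setLIntegral_withDensity_eq_setLIntegral_mul _ hu hg (hI.prod hA),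
    setLIntegral_prod_symm _ (hu.mul hg).aemeasurable]
  simp only [Pi.mul_apply, mul_comm]

lemma restrict_leb_Ioi_zero : leb.restrict (Ioi 0) = leb := by
  rw [Measure.restrict_congr_set Ioi_ae_eq_Ici, ← bot_eq_zero, Ici_bot, Measure.restrict_univ]

lemma lintegral_eq_lintegral_mul_of_isStronglyPredictable {P : Measure Ω} [SFinite P]
    {κ : Kernel Ω ℝ≥0} [IsSFiniteKernel κ] {lam : ℝ≥0 → Ω → ℝ≥0∞}
    (hlam : Measurable (Function.uncurry lam)) (hfin : ∀ r, ∫⁻ ω, κ ω (Ioc 0 r) ∂P < ⊤)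
    (heq : ∀ s r A, MeasurableSet[𝓕 s] A →
      ∫⁻ ω in A, κ ω (Ioc s r) ∂P = ∫⁻ ω in A, ∫⁻ t in Ioc s r, lam t ω ∂leb ∂P)
    {C : ℝ≥0 → Ω → ℝ≥0∞} (hC : IsStronglyPredictable 𝓕 C) :
    ∫⁻ ω, ∫⁻ t in Ioi 0, C t ω ∂(κ ω) ∂P = ∫⁻ ω, ∫⁻ t, C t ω * lam t ω ∂leb ∂P := by
  -- The Campbell measure of `κ` and the measure with density `lam` agree on the rectangles.
  have hCm := hC.measurable.mono predictable_le_prod le_rfl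
  have hcampbell (s r : ℝ≥0) {A : Set Ω} (hA : MeasurableSet A) :
      (P ⊗ₘ κ).map Prod.swap (Ioc s r ×ˢ A) = ∫⁻ ω in A, κ ω (Ioc s r) ∂P := by
    rw [← setLIntegral_one, setLIntegral_map_swap_compProd measurable_const hA measurableSet_Ioc]
    simp_rw [setLIntegral_one]
  have hdensity (s r : ℝ≥0) {A : Set Ω} (hA : MeasurableSet A) :
      (leb.prod P).withDensity (Function.uncurry lam) (Ioc s r ×ˢ A) =
        ∫⁻ ω in A, ∫⁻ t in Ioc s r, lam t ω ∂leb ∂P := by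
    rw [← setLIntegral_one,
      setLIntegral_prod_withDensity hlam measurable_const hA measurableSet_Ioc]
    simp_rw [one_mul, Function.uncurry_apply_pair]
  have hcongr := setLIntegral_Ioi_prod_predictable_congr (𝓕 := 𝓕)
    (fun r => by simpa only [hcampbell 0 r .univ, Measure.restrict_univ] using hfin r)
    (fun s r A hA => (hcampbell s r (𝓕.le s A hA)).trans
      ((heq s r A hA).trans (hdensity s r (𝓕.le s A hA)).symm)) hC.measurable
  rw [setLIntegral_map_swap_compProd hCm .univ measurableSet_Ioi,
    setLIntegral_prod_withDensity hlam hCm .univ measurableSet_Ioi] at hcongr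
  simpa only [Measure.restrict_univ, restrict_leb_Ioi_zero, Function.uncurry_apply_pair]
    using hcongr

end PredictableMeasure

section Compensator

variable {Ω : Type*} {m : MeasurableSpace Ω}

lemma setIntegral_toReal_eq_toReal_setLIntegral {μ : Measure Ω} {U : Ω → ℝ≥0∞}
    (hU : Measurable U) (hfin : ∫⁻ ω, U ω ∂μ < ⊤) (A : Set Ω) :
    ∫ ω in A, (U ω).toReal ∂μ = (∫⁻ ω in A, U ω ∂μ).toReal :=
  integral_toReal hU.aemeasurable (ae_restrict_of_ae (ae_lt_top hU hfin.ne))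

/-- The hypothesis `heq` equates the means of `U r - U s` and `V r - V s`; it is written without
subtraction, which is truncated in `ℝ≥0∞`. -/
lemma martingale_toReal_sub_toReal {ι : Type*} [Preorder ι] {𝓕 : Filtration ι m}
    {P : Measure Ω} [IsFiniteMeasure P] {U V : ι → Ω → ℝ≥0∞}
    (hU : ∀ t, Measurable[𝓕 t] (U t)) (hV : ∀ t, Measurable[𝓕 t] (V t))
    (hUfin : ∀ t, ∫⁻ ω, U t ω ∂P < ⊤) (hVfin : ∀ t, ∫⁻ ω, V t ω ∂P < ⊤)
    (heq : ∀ s r, s ≤ r → ∀ A, MeasurableSet[𝓕 s] A →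
      ∫⁻ ω in A, U r ω ∂P + ∫⁻ ω in A, V s ω ∂P = ∫⁻ ω in A, V r ω ∂P + ∫⁻ ω in A, U s ω ∂P) :
    Martingale (fun t ω => (U t ω).toReal - (V t ω).toReal) 𝓕 P := by
  have hUm (t : ι) : Measurable (U t) := (hU t).mono (𝓕.le t) le_rfl
  have hVm (t : ι) : Measurable (V t) := (hV t).mono (𝓕.le t) le_rfl
  have hUint (t : ι) : Integrable (fun ω => (U t ω).toReal) P :=
    integrable_toReal_of_lintegral_ne_top (hUm t).aemeasurable (hUfin t).ne
  have hVint (t : ι) : Integrable (fun ω => (V t ω).toReal) P :=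
    integrable_toReal_of_lintegral_ne_top (hVm t).aemeasurable (hVfin t).ne
  have hadapted (t : ι) : StronglyMeasurable[𝓕 t] fun ω => (U t ω).toReal - (V t ω).toReal :=
    ((hU t).ennreal_toReal.sub (hV t).ennreal_toReal).stronglyMeasurable
  refine ⟨hadapted, fun s r hsr => (ae_eq_condExp_of_forall_setIntegral_eq (𝓕.le s)
    ((hUint r).sub (hVint r)) (fun A _ _ => ((hUint s).sub (hVint s)).integrableOn)
    (fun A hA _ => ?_) (hadapted s).aestronglyMeasurable).symm⟩
  have hUA (t : ι) : ∫⁻ ω in A, U t ω ∂P ≠ ⊤ :=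
    ((setLIntegral_le_lintegral A _).trans_lt (hUfin t)).ne
  have hVA (t : ι) : ∫⁻ ω in A, V t ω ∂P ≠ ⊤ :=
    ((setLIntegral_le_lintegral A _).trans_lt (hVfin t)).ne
  simp only [Pi.sub_apply]
  rw [integral_sub (hUint s).integrableOn (hVint s).integrableOn,
    integral_sub (hUint r).integrableOn (hVint r).integrableOn,
    setIntegral_toReal_eq_toReal_setLIntegral (hUm s) (hUfin s),
    setIntegral_toReal_eq_toReal_setLIntegral (hUm r) (hUfin r),
    setIntegral_toReal_eq_toReal_setLIntegral (hVm s) (hVfin s),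
    setIntegral_toReal_eq_toReal_setLIntegral (hVm r) (hVfin r)]
  have heqA := congrArg ENNReal.toReal (heq s r hsr A hA)
  rw [ENNReal.toReal_add (hUA r) (hVA s), ENNReal.toReal_add (hVA r) (hUA s)] at heqA
  linarith

lemma measurable_setLIntegral_Iic_of_isStronglyProgressive {𝓕 : Filtration ℝ≥0 m}
    {u : ℝ≥0 → Ω → ℝ≥0∞} (hu : IsStronglyProgressive 𝓕 u) (t : ℝ≥0) :
    Measurable[𝓕 t] fun ω => ∫⁻ s in Iic t, u s ω ∂leb := by
  simp_rw [← lintegral_subtype_comap measurableSet_Iic]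
  have : IsFiniteMeasure (leb.comap (Subtype.val : Iic t → ℝ≥0)) := by
    refine ⟨?_⟩
    rw [(MeasurableEmbedding.subtype_coe measurableSet_Iic).comap_apply, image_univ,
      Subtype.range_coe, leb_Iic]
    exact ENNReal.coe_lt_top
  exact @Measurable.lintegral_prod_left' (Iic t) Ω _ (𝓕 t) (leb.comap Subtype.val) _ _
    (hu t).measurable

end Compensator

lemma lintegral_indicator_one_mul {α : Type*} [MeasurableSpace α] {μ : Measure α} {A : Set α}
    (hA : MeasurableSet A) (g : α → ℝ≥0∞) :
    ∫⁻ a, A.indicator 1 a * g a ∂μ = ∫⁻ a in A, g a ∂μ := by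
  rw [← lintegral_indicator hA]
  refine lintegral_congr fun a => ?_
  by_cases ha : a ∈ A <;> simp [ha]

lemma setLIntegral_Iic_eq_add {ν : Measure ℝ≥0} (g : ℝ≥0 → ℝ≥0∞) {s r : ℝ≥0} (hsr : s ≤ r) :
    ∫⁻ v in Iic r, g v ∂ν = ∫⁻ v in Iic s, g v ∂ν + ∫⁻ v in Ioc s r, g v ∂ν := by
  rw [← Iic_union_Ioc_eq_Iic hsr, lintegral_union measurableSet_Ioc]
  exact Iic_disjoint_Ioc le_rfl

lemma isSFiniteKernel_of_eq_sum_diracTop {Ω ι : Type*} [MeasurableSpace Ω] [Countable ι]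
    {κ : Kernel Ω ℝ≥0} {b : ι → Ω → ℝ≥0∞} (hb : ∀ i, Measurable (b i))
    (hκ : ∀ ω, κ ω = Measure.sum fun i => diracTop (b i ω)) : IsSFiniteKernel κ := by
  let κb (i : ι) : Kernel Ω ℝ≥0 := ⟨fun ω => diracTop (b i ω), measurable_diracTop.comp (hb i)⟩
  have (i : ι) : IsFiniteKernel (κb i) := by
    refine ⟨1, ENNReal.one_lt_top, fun ω => ?_⟩
    exact (diracTop_apply (b i ω) MeasurableSet.univ).trans_le (indicator_le_self' (by simp) _)
  have hsum : κ = Kernel.sum κb := by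
    ext1 ω
    rw [hκ, Kernel.sum_apply]
    rfl
  exact hsum ▸ inferInstance

namespace IsClusterModel

variable {Ω : Type*} [MeasurableSpace Ω] {P : Measure Ω} {f h : ℝ≥0 → ℝ≥0}
  {τ : ℕ → Ω → ℝ≥0} {ξ : ℕ × List ℕ → Ω → Measure ℝ≥0}

/-- The cluster process as a kernel from the sample space to `[0, ∞)`. -/
def clusterKernel (hM : IsClusterModel P f h τ ξ) : Kernel Ω ℝ≥0 :=
  ⟨clusterProcess τ ξ, hM.measurable_clusterProcess⟩

instance (hM : IsClusterModel P f h τ ξ) : IsSFiniteKernel hM.clusterKernel :=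
  isSFiniteKernel_of_eq_sum_diracTop (fun l : ℕ × List ℕ => hM.measurable_birth l.1 l.2)
    (clusterProcess_eq_sum hM.counting)

variable [IsProbabilityMeasure P]

lemma lintegral_density (hM : IsClusterModel P f h τ ξ) : ∫⁻ t, (f t : ℝ≥0∞) ∂leb = 1 := by
  have hlaw : P.map (τ 0) univ = 1 := by
    rw [Measure.map_apply (hM.measurable_waiting 0) MeasurableSet.univ, preimage_univ, measure_univ]
  rwa [hM.law_waiting 0, withDensity_apply _ MeasurableSet.univ, Measure.restrict_univ] at hlaw

lemma setLIntegral_clusterProcess_Ioc (hM : IsClusterModel P f h τ ξ) (s r : ℝ≥0) {A : Set Ω}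
    (hA : MeasurableSet[augmentedFiltration P τ ξ s] A) :
    ∫⁻ ω in A, clusterProcess τ ξ ω (Ioc s r) ∂P =
      ∫⁻ ω in A, ∫⁻ v in Ioc s r, hawkesIntensity (hazard f) h (clusterProcess τ ξ) (point τ ξ)
        (mark τ ξ) v ω ∂leb ∂P := by
  obtain ⟨-, B, hB, hAB⟩ := measurableSet_augmentedFiltration_iff.1 hA
  have hcount := hM.lintegral_clusterProcess s r hB
  simp only [lintegral_indicator_one_mul (hM.naturalSigma_le s B hB)] at hcount
  rw [Measure.restrict_congr_set hAB, hcount]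
  refine lintegral_congr_ae (ae_restrict_of_ae ?_)
  filter_upwards [hM.ae_hawkesIntensity_eq] with ω hω
  exact (setLIntegral_congr_fun measurableSet_Ioc fun v hv => hω v (zero_le.trans_lt hv.1)).symm

lemma lintegral_hawkesIntensity_Iic_lt_top (hM : IsClusterModel P f h τ ξ) (t : ℝ≥0) :
    ∫⁻ ω, ∫⁻ v in Iic t, hawkesIntensity (hazard f) h (clusterProcess τ ξ) (point τ ξ)
      (mark τ ξ) v ω ∂leb ∂P < ⊤ := by
  have hIic : leb.restrict (Iic t) = leb.restrict (Ioc 0 t) := by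
    rw [← Icc_bot, bot_eq_zero, restrict_Ioc_eq_restrict_Icc]
  have hmean := hM.setLIntegral_clusterProcess_Ioc 0 t MeasurableSet.univ
  rw [Measure.restrict_univ] at hmean
  rw [hIic, ← hmean]
  exact (lintegral_mono fun ω => measure_mono Ioc_subset_Iic_self).trans_lt
    (hM.lintegral_clusterProcess_Iic_lt_top t)

lemma measurable_setLIntegral_Iic_hawkesIntensity (hM : IsClusterModel P f h τ ξ) (t : ℝ≥0) :
    Measurable[augmentedFiltration P τ ξ t] fun ω => ∫⁻ v in Iic t, hawkesIntensity (hazard f) h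
      (clusterProcess τ ξ) (point τ ξ) (mark τ ξ) v ω ∂leb :=
  measurable_setLIntegral_Iic_of_isStronglyProgressive
    hM.isStronglyPredictable_hawkesIntensity.isStronglyProgressive t

lemma ae_lintegral_hawkesIntensity_Iic_lt_top (hM : IsClusterModel P f h τ ξ) :
    ∀ᵐ ω ∂P, ∀ t : ℝ≥0, ∫⁻ v in Iic t, hawkesIntensity (hazard f) h (clusterProcess τ ξ)
      (point τ ξ) (mark τ ξ) v ω ∂leb < ⊤ := by
  have hnat : ∀ᵐ ω ∂P, ∀ n : ℕ, ∫⁻ v in Iic (n : ℝ≥0), hawkesIntensity (hazard f) h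
      (clusterProcess τ ξ) (point τ ξ) (mark τ ξ) v ω ∂leb < ⊤ :=
    ae_all_iff.2 fun n => ae_lt_top ((hM.measurable_setLIntegral_Iic_hawkesIntensity n).mono
      ((augmentedFiltration P τ ξ).le n) le_rfl) (hM.lintegral_hawkesIntensity_Iic_lt_top n).ne
  filter_upwards [hnat] with ω hω t
  obtain ⟨n, hn⟩ := exists_nat_ge t
  exact (lintegral_mono_set (Iic_subset_Iic.2 hn)).trans_lt (hω n)

lemma martingale_clusterProcess_sub (hM : IsClusterModel P f h τ ξ) :
    Martingale (fun t ω => (clusterProcess τ ξ ω (Iic t)).toReal -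
      (∫⁻ s in Iic t, hawkesIntensity (hazard f) h (clusterProcess τ ξ) (point τ ξ)
        (mark τ ξ) s ω ∂leb).toReal) (augmentedFiltration P τ ξ) P := by
  refine martingale_toReal_sub_toReal hM.adapted_clusterProcess
    hM.measurable_setLIntegral_Iic_hawkesIntensity hM.lintegral_clusterProcess_Iic_lt_top
    hM.lintegral_hawkesIntensity_Iic_lt_top fun s r hsr A hA => ?_
  have hcount (ω : Ω) : clusterProcess τ ξ ω (Iic r) =
      clusterProcess τ ξ ω (Iic s) + clusterProcess τ ξ ω (Ioc s r) := by
    simpa only [setLIntegral_one] using setLIntegral_Iic_eq_add (fun _ => 1) hsr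
  simp_rw [hcount, setLIntegral_Iic_eq_add _ hsr]
  rw [lintegral_add_left (hM.measurable_clusterProcess_Iic s),
    lintegral_add_left ((hM.measurable_setLIntegral_Iic_hawkesIntensity s).mono
      ((augmentedFiltration P τ ξ).le s) le_rfl),
    hM.setLIntegral_clusterProcess_Ioc s r hA]
  ring

lemma isIntensity (hM : IsClusterModel P f h τ ξ) :
    IsIntensity P (augmentedFiltration P τ ξ) (clusterProcess τ ξ)
      (hawkesIntensity (hazard f) h (clusterProcess τ ξ) (point τ ξ) (mark τ ξ)) where
  adapted := hM.adapted_clusterProcess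
  progressive := hM.isStronglyPredictable_hawkesIntensity.isStronglyProgressive
  locallyIntegrable := hM.ae_lintegral_hawkesIntensity_Iic_lt_top
  martingale := hM.martingale_clusterProcess_sub

lemma lintegral_clusterProcess_of_isStronglyPredictable (hM : IsClusterModel P f h τ ξ)
    {C : ℝ≥0 → Ω → ℝ≥0∞} (hC : IsStronglyPredictable (augmentedFiltration P τ ξ) C) :
    ∫⁻ ω, ∫⁻ t in Ioi 0, C t ω ∂(clusterProcess τ ξ ω) ∂P =
      ∫⁻ ω, ∫⁻ t, C t ω * hawkesIntensity (hazard f) h (clusterProcess τ ξ) (point τ ξ)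
        (mark τ ξ) t ω ∂leb ∂P :=
  lintegral_eq_lintegral_mul_of_isStronglyPredictable (κ := hM.clusterKernel)
    (lam := hawkesIntensity (hazard f) h (clusterProcess τ ξ) (point τ ξ) (mark τ ξ))
    hM.measurable_hawkesIntensity
    (fun r => (lintegral_mono fun _ => measure_mono Ioc_subset_Iic_self).trans_lt
      (hM.lintegral_clusterProcess_Iic_lt_top r))
    (fun s r _ hA => hM.setLIntegral_clusterProcess_Ioc s r hA) hC

lemma isSimplePointProcess (hM : IsClusterModel P f h τ ξ) :
    IsSimplePointProcess P (clusterProcess τ ξ) (point τ ξ) where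
  measurable_points := hM.measurable_point
  strict := hM.ae_isRegular.mono fun _ R i hi => R.point_lt_succ i hi
  absorbing := ae_of_all _ fun ω i hi => top_le_iff.1 (hi ▸ nthPoint_mono _ (Nat.le_succ i))
  measurable := hM.measurable_clusterProcess
  locallyFinite := hM.ae_isRegular.mono fun _ R => R.isCountingMeasure
  eq_sum := by
    filter_upwards [hM.ae_isRegular] with ω R
    conv_lhs => rw [R.eq_sum_point]
    ext B hB
    rw [Measure.sum_apply _ hB, Measure.sum_apply _ hB,
      ← tsum_subtype_eq_of_support_subset (s := {i | point τ ξ i ω ≠ ⊤})]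
    · refine tsum_congr fun i => ?_
      rw [diracTop, if_neg i.2]
    · intro i hi htop
      exact hi (by simp [htop, diracTop_top])

lemma isRenewalHawkesProcess (hM : IsClusterModel P f h τ ξ) :
    IsRenewalHawkesProcess P (augmentedFiltration P τ ξ) (clusterProcess τ ξ) (point τ ξ)
      (mark τ ξ) f h where
  measurable_f := hM.measurable_f
  density := hM.lintegral_density
  measurable_h := hM.measurable_h
  subcritical := hM.subcritical
  simple := hM.isSimplePointProcess
  measurable_marks := hM.measurable_mark
  immigrant_exists := hM.ae_isRegular.mono fun _ R _ ht => R.exists_immigrant_lt ht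
  adapted_lastImmigrant := hM.adapted_lastImmigrant
  predictable := hM.isStronglyPredictable_hawkesIntensity
  intensity := hM.isIntensity

end IsClusterModel

end RenewalHawkes

end

theorem mainTheorem2_general {Ω : Type*} [MeasurableSpace Ω] {P : Measure Ω}
    [IsProbabilityMeasure P] {f h : ℝ≥0 → ℝ≥0} {τ : ℕ → Ω → ℝ≥0}
    {ξ : ℕ × List ℕ → Ω → Measure ℝ≥0} (hM : IsClusterModel P f h τ ξ) :
    IsRenewalHawkesProcess P (augmentedFiltration P τ ξ)
      (clusterProcess τ ξ) (point τ ξ) (mark τ ξ) f h ∧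
    ∀ C : ℝ≥0 → Ω → ℝ≥0∞,
      IsStronglyPredictable (augmentedFiltration P τ ξ) C →
      ∫⁻ ω, ∫⁻ t in Ioi 0, C t ω ∂(clusterProcess τ ξ ω) ∂P =
      ∫⁻ ω, ∫⁻ t, C t ω * hawkesIntensity (hazard f) h
        (clusterProcess τ ξ) (point τ ξ) (mark τ ξ) t ω
        ∂leb ∂P :=
  ⟨hM.isRenewalHawkesProcess, fun _ hC => hM.lintegral_clusterProcess_of_isStronglyPredictable hC⟩

theorem mainTheorem2 {Ω : Type*} [m : MeasurableSpace Ω] (P : Measure Ω) [IsProbabilityMeasure P]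
    (f h : ℝ≥0 → ℝ≥0) (hf : Measurable f) (hh : Measurable h)
    (hsub : ∫⁻ t, (h t : ℝ≥0∞) ∂leb < 1)
    (τ : ℕ → Ω → ℝ≥0) (hτ_meas : ∀ i, Measurable (τ i)) (hτ_indep : iIndepFun τ P)
    (hτ_law : ∀ i, P.map (τ i) = leb.withDensity (fun t => (f t : ℝ≥0∞)))
    (hτ_mean : ∀ i, ∫⁻ ω, (τ i ω : ℝ≥0∞) ∂P < ⊤)
    (ξ : ℕ × List ℕ → Ω → Measure ℝ≥0)
    (hξ_law : ∀ l, IsPoissonProcess P (ξ l)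
      (leb.withDensity (fun t => (h t : ℝ≥0∞))))
    (hξ_indep : iIndepFun ξ P)
    (hτξ_indep : IndepFun (fun ω i => τ i ω) (fun ω l => ξ l ω) P) :
    IsRenewalHawkesProcess P (augmentedFiltration P τ ξ)
      (clusterProcess τ ξ) (point τ ξ) (mark τ ξ) f h ∧
    ∀ C : ℝ≥0 → Ω → ℝ≥0∞,
      IsStronglyPredictable (augmentedFiltration P τ ξ) C →
      ∫⁻ ω, ∫⁻ t in Ioi 0, C t ω ∂(clusterProcess τ ξ ω) ∂P =
      ∫⁻ ω, ∫⁻ t, C t ω * hawkesIntensity (hazard f) h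
        (clusterProcess τ ξ) (point τ ξ) (mark τ ξ) t ω
        ∂leb ∂P :=
  mainTheorem2_general
    ⟨hf, hh, hsub, hτ_meas, hτ_indep, hτ_law, hξ_law, hξ_indep, hτξ_indep⟩
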